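/- Assume the Riemann hypothesis. Let $\varepsilon>0$. Then there exist positive constants $K$ and $b=b(K)$ (which may depend on $\varepsilon$) such that, for all sufficiently large $T$, uniformly for $\frac12+\frac{K}{\log\log T}\le\sigma\le 1-\varepsilon$ and for all complex numbers $z_1,z_2$ with $|z_1|,|z_2|\le b\,(\log T)^{2\sigma-1}$, the series below converges absolutely and $$\frac1T\int_T^{2T}\zeta(\sigma+it)^{z_1}\,\overline{\zeta(\sigma+it)}^{\,z_2}\,dt=\sum_{n=1}^\infty\frac{d_{z_1}(n)d_{z_2}(n)}{n^{2\sigma}}+O\left(\exp\left(-\frac{\log T}{50\log\log T}\right)\right),$$ where the implied constant and the lower bound for $T$ depend at most on $\varepsilon$, $K$ and $b$. Here $d_z$ is the $z$-th divisor function, i.e. the multiplicative function with $d_z(p^a)=\frac{\Gamma(z+a)}{\Gamma(z)\,a!}=\frac{z(z+1)\cdots(z+a-1)}{a!}$ for every prime $p$ and integer $a\ge0$ (the last expression being used at the poles of $\Gamma$), so that $\zeta(s)^z=\sum_{n\ge1}d_z(n)n^{-s}$ for $\mathrm{Re}(s)>1$. The complex powers are $\zeta(s)^{z}=\exp(z\log\zeta(s))$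 and $\overline{\zeta(s)}^{\,z}=\exp(z\,\overline{\log\zeta(s)})$, where $\log\zeta(\sigma+it)=-\int_\sigma^\infty\frac{\zeta'}{\zeta}(x+it)\,dx$ is the branch of the logarithm obtained by continuous variation along the horizontal half-line from $+\infty+it$, where it vanishes. -/

import Mathlib

open Complex

/-- The value at a prime power `p ^ a` of the `z`-th divisor function: `z (z+1) ⋯ (z+a-1) / a!`.
This is `Γ(z+a) / (Γ(z) a!)`, extended by continuity to the poles of `Γ`
(see `divisorLocal_eq_Gamma`). -/
noncomputable def divisorLocal (z : ℂ) (a : ℕ) : ℂ :=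
  (∏ j ∈ Finset.range a, (z + (j : ℂ))) / (a.factorial : ℂ)

theorem divisorLocal_eq_Gamma (z : ℂ) (hz : ∀ m : ℕ, z ≠ -(m : ℂ)) (a : ℕ) :
    divisorLocal z a = Complex.Gamma (z + a) / (Complex.Gamma z * (a.factorial : ℂ)) := by
  have h : ∀ a : ℕ, Complex.Gamma (z + a)
      = (∏ j ∈ Finset.range a, (z + (j : ℂ))) * Complex.Gamma z := by
    intro a
    induction a with
    | zero => simp
    | succ n ih =>
      have hne : z + n ≠ 0 := fun h0 => hz n (eq_neg_of_add_eq_zero_left h0)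
      rw [Finset.prod_range_succ]
      push_cast
      rw [← add_assoc, Complex.Gamma_add_one _ hne, ih]
      ring
  have hG : Complex.Gamma z ≠ 0 := Complex.Gamma_ne_zero hz
  rw [h a, divisorLocal, mul_comm (Complex.Gamma z), mul_div_mul_right _ _ hG]

/-- The `z`-th divisor function `d_z`: the multiplicative function on the positive integers whose
value at `p ^ a` is `divisorLocal z a`.  (The value at `0` is set to `0`.) -/
noncomputable def divisorFun (z : ℂ) (n : ℕ) : ℂ :=
  if n = 0 then 0 else n.factorization.prod fun _ a => divisorLocal z a

theorem divisorFun_prime_pow (z : ℂ) {p : ℕ} (hp : p.Prime) (a : ℕ) :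
    divisorFun z (p ^ a) = divisorLocal z a := by
  have h1 : p ^ a ≠ 0 := pow_ne_zero _ hp.ne_zero
  rw [divisorFun, if_neg h1, hp.factorization_pow, Finsupp.prod_single_index]
  simp [divisorLocal]

theorem divisorFun_mul (z : ℂ) {m n : ℕ} (h : m.Coprime n) (hm : m ≠ 0) (hn : n ≠ 0) :
    divisorFun z (m * n) = divisorFun z m * divisorFun z n := by
  rw [divisorFun, divisorFun, divisorFun, if_neg hm, if_neg hn, if_neg (mul_ne_zero hm hn),
    Nat.factorization_mul_of_coprime h]
  exact Finsupp.prod_add_index_of_disjoint (Nat.Coprime.disjoint_primeFactors h) _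

/-- The logarithm of the Riemann zeta function at `s = σ + it`, obtained by continuous variation
along the half-line `{x + it : x ≥ σ}` from the value `0` at `x = +∞`:
`log ζ(σ + it) = - ∫_σ^∞ (ζ'/ζ)(x + it) dx`.
If the half-line meets no zero and not the pole `1`, this is the branch which for `Re s > 1` is the
Dirichlet series `∑ Λ(n) / (log n · n ^ s)`. -/
noncomputable def logZeta (s : ℂ) : ℂ :=
  -∫ x in Set.Ioi s.re, logDeriv riemannZeta ((x : ℂ) + (s.im : ℂ) * I)

/-- The complex power `ζ(s) ^ z = exp (z log ζ(s))`, the continuation of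
`∑ d_z(n) / n ^ s` from `Re s > 1`. -/
noncomputable def zetaPow (s z : ℂ) : ℂ :=
  Complex.exp (z * logZeta s)

/-- The complex power of the conjugate, `(conj ζ(s)) ^ z = exp (z · conj (log ζ(s)))`. -/
noncomputable def zetaConjPow (s z : ℂ) : ℂ :=
  Complex.exp (z * (starRingEnd ℂ) (logZeta s))

section

open MeasureTheory Set Filter Topology Metric

/-! Write `Y = log T`, `l = log log T`, `η = K / (2l)` and `X = T^(1/12)`. On the segment, `ζ(s)^z`
is replaced by a Dirichlet series smoothed at length `X`. Integrating `ζ(s+w)^z X^w e^(w²) / w`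
along `Re w = 3` produces this series. Moving the line to `Re w = -η` picks up the residue `ζ(s)^z`
and leaves an error of order `X^(-η) max |ζ^z| / η` (`RiemannHypothesis.norm_zetaPow_sub_tsum_le`).
Since `X` is a small power of `T`, the off-diagonal terms in the mean value of the two series are
negligible (`norm_mean_mul_sub_tsum_le`). On the diagonal the weights are `1 + O((n/X)^η / η)`
before squaring, which is harmless because the squared series still converges, with a good bound, at
`σ - η` (`norm_tsum_smoothed_sub_tsum_le`, `summable_and_tsum_divisorFun_sq_le`).

The balance is that `X^η = exp(K Y / (24 l))` must beat `max |ζ^z|`. For `x ≥ σ - η` the Riemann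
hypothesis gives `log ζ(x+iv) ≪ Y^(2-2(σ-η)) / l` (`RiemannHypothesis.norm_logZeta_le`). With `|z| ≤
e^(-2K) Y^(2σ-1)` and `Y^(2η) = e^K`, the product is `≪ e^(-K) Y / l`, so a large `K` gives `|ζ^z| ≤
exp(Y / (10 l))` (`norm_zetaPow_le_exp`).

The bound for `log ζ` is an integral of Littlewood's bound for `ζ'/ζ`, which is proved here without
summing over zeros. Under the Riemann hypothesis every zero near height `t` lies to the left of the
point considered, so dividing the zeros out gives `Re ζ'/ζ ≥ -C log t`, uniformly up to the critical
line (`RiemannHypothesis.logDeriv_riemannZeta_bounds`). For a function with nonnegative real part,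
the Fourier integral against a positive kernel at frequency `ω` is controlled by those at `-ω` and
`0` (`norm_integral_twist_le`). The latter two are evaluated by moving the segment to the right,
where the twist does not grow. Take the kernel to be a damped Poisson kernel, the frequency to be `2
log log t`, and correct `ζ'/ζ` by its Dirichlet polynomial of length `(log t)²`. This yields a gain
`e^(ωη)` of order `(log t)^(2σ-1)` over the trivial bound `log t` (`exp_mul_norm_add_le`, where `η`
is the distance from the segment). -/

/-! ### Cauchy's formula on a rectangle. -/

/-- The integral of `(z - p)⁻¹` around a rectangle containing `p`. -/
theorem integral_rect_inv_sub {a b p V : ℝ} (ha : a < p) (hb : p < b) (hV : 0 < V) :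
    (∫ x : ℝ in a..b, ((x : ℂ) + (-V : ℝ) * I - p)⁻¹) - (∫ x : ℝ in a..b, ((x : ℂ) + V * I - p)⁻¹) +
      I * (∫ v : ℝ in (-V)..V, ((b : ℂ) + v * I - p)⁻¹) -
      I * (∫ v : ℝ in (-V)..V, ((a : ℂ) + v * I - p)⁻¹) = 2 * Real.pi * I := by
  have h1 : ∀ c : ℝ, c ≠ 0 → (∫ x : ℝ in a..b, ((x : ℂ) + c * I - p)⁻¹) =
      log ((b : ℂ) + c * I - p) - log ((a : ℂ) + c * I - p) := by
    intro c hc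
    have hs : ∀ x : ℝ, (x : ℂ) + c * I - p ∈ slitPlane := fun x => by
      right; simpa using hc
    apply intervalIntegral.integral_eq_sub_of_hasDerivAt
      (f := fun x : ℝ => log ((x : ℂ) + c * I - p))
    · intro x _
      have h := (((hasDerivAt_id (x : ℂ)).add_const (c * I)).sub_const (p : ℂ)).clog (hs x)
      simpa using h.comp_ofReal
    · apply ContinuousOn.intervalIntegrable
      intro x _
      have : (x : ℂ) + c * I - p ≠ 0 := slitPlane_ne_zero (hs x)
      apply ContinuousAt.continuousWithinAt
      fun_prop (disch := assumption)
  have h2 : I * (∫ v : ℝ in (-V)..V, ((b : ℂ) + v * I - p)⁻¹) =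
      log ((b : ℂ) + V * I - p) - log ((b : ℂ) + (-V : ℝ) * I - p) := by
    have hs : ∀ v : ℝ, (b : ℂ) + v * I - p ∈ slitPlane := fun v => by
      left; simpa using hb
    rw [← intervalIntegral.integral_const_mul]
    apply intervalIntegral.integral_eq_sub_of_hasDerivAt
      (f := fun v : ℝ => log ((b : ℂ) + v * I - p))
    · intro v _
      have h := ((((hasDerivAt_id (v : ℂ)).mul_const I).const_add (b : ℂ)).sub_const (p : ℂ)).clog
        (hs v)
      simpa [div_eq_mul_inv] using h.comp_ofReal
    · apply ContinuousOn.intervalIntegrable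
      intro v _
      have : (b : ℂ) + v * I - p ≠ 0 := slitPlane_ne_zero (hs v)
      apply ContinuousAt.continuousWithinAt
      fun_prop (disch := assumption)
  -- The left side crosses the cut of `log (z - p)`, so `log (p - z)` serves as the primitive there.
  have h3 : I * (∫ v : ℝ in (-V)..V, ((a : ℂ) + v * I - p)⁻¹) =
      log (p - ((a : ℂ) + V * I)) - log (p - ((a : ℂ) + (-V : ℝ) * I)) := by
    have hs : ∀ v : ℝ, p - ((a : ℂ) + v * I) ∈ slitPlane := fun v => by
      left; simpa using ha
    rw [← intervalIntegral.integral_const_mul]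
    apply intervalIntegral.integral_eq_sub_of_hasDerivAt
      (f := fun v : ℝ => log (p - ((a : ℂ) + v * I)))
    · intro v _
      have h := ((((hasDerivAt_id (v : ℂ)).mul_const I).const_add (a : ℂ)).const_sub (p : ℂ)).clog
        (hs v)
      have e : I * ((a : ℂ) + v * I - p)⁻¹ = -(1 * I) / (p - (a + id (v : ℂ) * I)) := by
        rw [← neg_sub, inv_neg, neg_div, div_eq_mul_inv, one_mul, mul_neg]
        simp
      rw [e]
      exact h.comp_ofReal
    · apply ContinuousOn.intervalIntegrable
      intro v _
      have h0 : p - ((a : ℂ) + v * I) ≠ 0 := slitPlane_ne_zero (hs v)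
      have : (a : ℂ) + v * I - p ≠ 0 := by
        rw [← neg_sub]; exact neg_ne_zero.mpr h0
      apply ContinuousAt.continuousWithinAt
      fun_prop (disch := assumption)
  rw [h1 (-V) (by linarith [hV.ne']), h1 V hV.ne', h2, h3]
  -- The two branches differ by `∓πi` at the two left corners; these jumps add up to the `2πi`.
  have e1 : log ((a : ℂ) + (-V : ℝ) * I - p) = log (p - ((a : ℂ) + (-V : ℝ) * I)) - Real.pi * I := by
    rw [← neg_sub, log, arg_neg_eq_arg_sub_pi_of_im_pos (by simp [hV]), norm_neg, log]
    push_cast; ring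
  have e2 : log ((a : ℂ) + V * I - p) = log (p - ((a : ℂ) + V * I)) + Real.pi * I := by
    rw [← neg_sub, log, arg_neg_eq_arg_add_pi_of_im_neg (by simp [hV]), norm_neg, log]
    push_cast; ring
  rw [e1, e2]; ring

/-- Cauchy's integral formula on a rectangle, for a centre on the real axis, with the horizontal
sides estimated trivially. -/
theorem norm_integral_left_add_sub_integral_right_le {F : ℂ → ℂ} {a b p V E : ℝ} (ha : a < p)
    (hb : p < b) (hV : 0 < V)
    (hF : ∀ x ∈ Icc a b, ∀ v ∈ Icc (-V) V, DifferentiableAt ℂ F ((x : ℂ) + (v : ℂ) * I))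
    (hE : ∀ x ∈ Icc a b, ∀ v : ℝ, |v| = V → ‖F (x + v * I) / ((x : ℂ) + v * I - p)‖ ≤ E) :
    ‖(∫ v : ℝ in (-V)..V, F (a + v * I) / ((a : ℂ) + v * I - p)) + 2 * Real.pi * F p -
      ∫ v : ℝ in (-V)..V, F (b + v * I) / ((b : ℂ) + v * I - p)‖ ≤ 2 * (b - a) * E := by
  have hab : a < b := ha.trans hb
  -- The difference quotient has a removable singularity at `p`, so its boundary integral vanishes.
  -- The remaining part `F p / (z - p)` was integrated explicitly above.
  set D : ℂ → ℂ := dslope F p with hD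
  have hmem : ∀ z : ℂ, z ∈ uIcc a b ×ℂ uIcc (-V) V → DifferentiableAt ℂ F z := by
    intro z hz
    rw [uIcc_of_le hab.le, uIcc_of_le (by linarith)] at hz
    have := hF z.re hz.1 z.im hz.2
    rwa [re_add_im] at this
  have hDc : ContinuousOn D (uIcc a b ×ℂ uIcc (-V) V) := by
    have hp : (uIcc a b ×ℂ uIcc (-V) V) ∈ 𝓝 (p : ℂ) := by
      rw [uIcc_of_le hab.le, uIcc_of_le (by linarith)]
      refine mem_of_superset ((isOpen_Ioo.reProdIm isOpen_Ioo).mem_nhds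
        (show (p : ℂ) ∈ Ioo a b ×ℂ Ioo (-V) V by simp [mem_reProdIm, ha, hb, hV])) ?_
      exact reProdIm_subset_iff.mpr (prod_mono Ioo_subset_Icc_self Ioo_subset_Icc_self)
    rw [hD, continuousOn_dslope hp]
    exact ⟨fun z hz => (hmem z hz).continuousAt.continuousWithinAt, hmem _ (mem_of_mem_nhds hp)⟩
  have hrect := integral_boundary_rect_eq_zero_of_differentiable_on_off_countable D
    ((a : ℂ) + (-V : ℝ) * I) ((b : ℂ) + V * I) {(p : ℂ)} (countable_singleton _)
    (by simpa using hDc) (by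
      intro z hz
      have hz1 : z ∈ uIcc a b ×ℂ uIcc (-V) V := by
        have h := hz.1
        simp only [add_re, ofReal_re, mul_re, I_re, mul_zero, ofReal_im, I_im, mul_one, sub_self,
          add_zero, add_im, mul_im, zero_add, hab.le, min_eq_left, max_eq_right,
          show -V ≤ V by linarith] at h
        rw [uIcc_of_le hab.le, uIcc_of_le (by linarith)]
        exact ⟨Ioo_subset_Icc_self h.1, Ioo_subset_Icc_self h.2⟩
      exact (differentiableAt_dslope_of_ne hz.2).mpr (hmem z hz1))
  simp only [add_re, ofReal_re, mul_re, I_re, mul_zero, ofReal_im, I_im, mul_one, sub_self,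
    add_zero, add_im, mul_im, zero_add, smul_eq_mul] at hrect
  have key : ∀ z : ℂ, z ≠ p → D z = F z / (z - p) - F p * (z - p)⁻¹ := by
    intro z hz
    rw [hD, dslope_of_ne _ hz, slope_def_field]; ring
  have hinv := integral_rect_inv_sub ha hb hV
  have hor : ∀ c : ℝ, |c| = V → (∫ x : ℝ in a..b, D (x + c * I)) =
      (∫ x : ℝ in a..b, F (x + c * I) / ((x : ℂ) + c * I - p)) -
        F p * ∫ x : ℝ in a..b, ((x : ℂ) + c * I - p)⁻¹ := by
    intro c hc
    have hc0 : c ≠ 0 := by rintro rfl; simp at hc; linarith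
    have hne : ∀ x : ℝ, (x : ℂ) + c * I - p ≠ 0 := fun x h => hc0 (by simpa using congrArg im h)
    have hcV : c ∈ Icc (-V) V := abs_le.mp hc.le
    rw [← intervalIntegral.integral_const_mul, ← intervalIntegral.integral_sub]
    · refine intervalIntegral.integral_congr fun x _ => key _ fun h => hne x (by rw [h]; ring)
    · apply ContinuousOn.intervalIntegrable
      intro x hx
      rw [uIcc_of_le hab.le] at hx
      have h1 := (hF x hx c hcV).continuousAt
      have h2 : ContinuousAt (fun x : ℝ => F ((x : ℂ) + c * I)) x :=
        ContinuousAt.comp (f := fun x : ℝ => (x : ℂ) + c * I) h1 (by fun_prop)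
      have h3 : ContinuousAt (fun x : ℝ => (x : ℂ) + c * I - p) x := by fun_prop
      exact (h2.div h3 (hne x)).continuousWithinAt
    · apply ContinuousOn.intervalIntegrable
      intro x _
      have := hne x
      apply ContinuousAt.continuousWithinAt
      fun_prop (disch := assumption)
  have ver : ∀ c ∈ Icc a b, c ≠ p → (∫ v : ℝ in (-V)..V, D (c + v * I)) =
      (∫ v : ℝ in (-V)..V, F (c + v * I) / ((c : ℂ) + v * I - p)) -
        F p * ∫ v : ℝ in (-V)..V, ((c : ℂ) + v * I - p)⁻¹ := by
    intro c hc hcp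
    have hne : ∀ v : ℝ, (c : ℂ) + v * I - p ≠ 0 := fun v h => hcp (by
      have := congrArg re h
      simp at this; linarith)
    rw [← intervalIntegral.integral_const_mul, ← intervalIntegral.integral_sub]
    · refine intervalIntegral.integral_congr fun x _ => key _ fun h => hne x (by rw [h]; ring)
    · apply ContinuousOn.intervalIntegrable
      intro v hv
      rw [uIcc_of_le (by linarith)] at hv
      have h1 := (hF c hc v hv).continuousAt
      have h2 : ContinuousAt (fun v : ℝ => F ((c : ℂ) + v * I)) v :=
        ContinuousAt.comp (f := fun v : ℝ => (c : ℂ) + v * I) h1 (by fun_prop)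
      have h3 : ContinuousAt (fun v : ℝ => (c : ℂ) + v * I - p) v := by fun_prop
      exact (h2.div h3 (hne v)).continuousWithinAt
    · apply ContinuousOn.intervalIntegrable
      intro v _
      have := hne v
      apply ContinuousAt.continuousWithinAt
      fun_prop (disch := assumption)
  rw [hor (-V) (by rw [abs_neg, abs_of_pos hV]), hor V (abs_of_pos hV),
    ver b (right_mem_Icc.mpr hab.le) hb.ne', ver a (left_mem_Icc.mpr hab.le) ha.ne] at hrect
  have bound : ∀ c : ℝ, |c| = V →
      ‖∫ x : ℝ in a..b, F (x + c * I) / ((x : ℂ) + c * I - p)‖ ≤ E * (b - a) := by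
    intro c hc
    have := intervalIntegral.norm_integral_le_of_norm_le_const (a := a) (b := b) (C := E)
      (f := fun x : ℝ => F (x + c * I) / ((x : ℂ) + c * I - p)) (by
        intro x hx
        rw [uIoc_of_le hab.le] at hx
        exact hE x (Ioc_subset_Icc_self hx) c hc)
    rwa [abs_of_pos (by linarith)] at this
  have b1 := bound (-V) (by rw [abs_neg, abs_of_pos hV])
  have b2 := bound V (abs_of_pos hV)
  set H1 := ∫ x : ℝ in a..b, F (x + (-V : ℝ) * I) / ((x : ℂ) + (-V : ℝ) * I - p)
  set H2 := ∫ x : ℝ in a..b, F (x + V * I) / ((x : ℂ) + V * I - p)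
  set VL := ∫ v : ℝ in (-V)..V, F (a + v * I) / ((a : ℂ) + v * I - p)
  set VR := ∫ v : ℝ in (-V)..V, F (b + v * I) / ((b : ℂ) + v * I - p)
  have e : VL + 2 * Real.pi * F p - VR = -I * (H1 - H2) := by
    apply mul_left_cancel₀ I_ne_zero
    have h3 : I * (-I * (H1 - H2)) = H1 - H2 := by
      rw [← mul_assoc]; simp
    rw [h3]
    linear_combination -hrect - F p * hinv
  rw [e, norm_mul, norm_neg, norm_I, one_mul]
  calc ‖H1 - H2‖ ≤ ‖H1‖ + ‖H2‖ := norm_sub_le _ _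
    _ ≤ 2 * (b - a) * E := by linarith
-- Logarithmic derivatives of bounded functions on a disc.
/-- The logarithmic derivative of a bounded zero-free function on a disc. -/
theorem norm_logDeriv_le_of_ne_zero {f : ℂ → ℂ} {M A r r₁ : ℝ} (hr0 : 0 ≤ r) (hr : r < r₁)
    (hf : DifferentiableOn ℂ f (ball 0 r₁)) (hM : ∀ z ∈ ball (0 : ℂ) r₁, ‖f z‖ ≤ M)
    (h0 : ∀ z ∈ ball (0 : ℂ) r₁, f z ≠ 0) (hA : Real.log (M / ‖f 0‖) + 1 ≤ A) {z : ℂ}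
    (hz : ‖z‖ ≤ r) : ‖logDeriv f z‖ ≤ 8 * A * r₁ / (r₁ - r) ^ 2 := by
  have hr1 : 0 < r₁ := hr0.trans_lt hr
  have z0 : (0 : ℂ) ∈ ball (0 : ℂ) r₁ := mem_ball_self hr1
  have hf0 : 0 < ‖f 0‖ := norm_pos_iff.mpr (h0 0 z0)
  have hM0 : ‖f 0‖ ≤ M := hM 0 z0
  have hMpos : 0 < M := hf0.trans_le hM0
  have hApos : 0 < A := by
    have : 0 ≤ Real.log (M / ‖f 0‖) := Real.log_nonneg ((one_le_div hf0).mpr hM0)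
    linarith
  have hLd : DifferentiableOn ℂ (logDeriv f) (ball 0 r₁) :=
    (hf.deriv isOpen_ball).div hf h0
  -- A primitive `h` of `f'/f` gives `f = f 0 * exp h` with `Re h ≤ A`. Borel–Carathéodory then
  -- bounds `h`, and Cauchy's estimate bounds `h' = f'/f`. The `+ 1` in the hypothesis on `A` makes
  -- `A` strictly positive.
  obtain ⟨h, h00, hh⟩ := hLd.isExactOn_ball.with_val_at 0 0
  have hder : ∀ w ∈ ball (0 : ℂ) r₁, HasDerivAt h (logDeriv f w) w := hh
  have hconst : ∀ w ∈ ball (0 : ℂ) r₁, f w = f 0 * exp (h w) := by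
    intro w hw
    have hd : ∀ u ∈ ball (0 : ℂ) r₁, HasDerivAt (fun u => f u * exp (-h u)) 0 u := by
      intro u hu
      have h1 := (hf.differentiableAt (isOpen_ball.mem_nhds hu)).hasDerivAt
      have h2 := h1.mul (hder u hu).neg.cexp
      have e : deriv f u * exp ((-h) u) + f u * (exp ((-h) u) * -logDeriv f u) = 0 := by
        have := h0 u hu
        rw [logDeriv_apply]
        field_simp
        ring
      rw [e] at h2
      exact h2
    have := (convex_ball (0 : ℂ) r₁).is_const_of_fderivWithin_eq_zero (𝕜 := ℂ)
      (f := fun u => f u * exp (-h u))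
      (fun u hu => (hd u hu).differentiableAt.differentiableWithinAt) (fun u hu => by
        rw [fderivWithin_of_isOpen isOpen_ball hu]
        ext; simpa using (hd u hu).deriv) hw z0
    simp only [h00, neg_zero, exp_zero, mul_one] at this
    rw [← this, mul_assoc, ← exp_add]; simp
  have hre : MapsTo h (ball 0 r₁) {w | w.re ≤ A} := by
    intro w hw
    have h1 := hconst w hw
    have h2 : ‖f w‖ = ‖f 0‖ * Real.exp (h w).re := by rw [h1, norm_mul, norm_exp]
    have h3 : Real.exp (h w).re ≤ M / ‖f 0‖ := by
      rw [le_div_iff₀ hf0, mul_comm, ← h2]; exact hM w hw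
    have h4 := (Real.le_log_iff_exp_le (div_pos hMpos hf0)).mpr h3
    show (h w).re ≤ A
    linarith
  have hhd : DifferentiableOn ℂ h (ball 0 r₁) :=
    fun w hw => (hder w hw).differentiableAt.differentiableWithinAt
  -- Borel–Carathéodory and Cauchy's estimate each cost one factor `1 / δ`.
  set δ := (r₁ - r) / 2 with hδ
  have hδ0 : 0 < δ := by rw [hδ]; linarith
  have hzb : z ∈ ball (0 : ℂ) r₁ := by simpa using hz.trans_lt hr
  have hcl : closedBall z δ ⊆ ball (0 : ℂ) r₁ := by
    intro w hw
    rw [mem_closedBall, dist_eq_norm] at hw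
    rw [mem_ball_zero_iff]
    have := norm_le_norm_sub_add w z
    linarith
  have hC : ∀ w ∈ sphere z δ, ‖h w‖ ≤ 2 * A * r₁ / δ := by
    intro w hw
    have hw' := hcl (sphere_subset_closedBall hw)
    have h1 := borelCaratheodory_zero hApos hhd hre hr1 hw' h00
    rw [mem_sphere, dist_eq_norm] at hw
    have h2 := norm_le_norm_sub_add w z
    refine h1.trans ?_
    gcongr
    · linarith
    · linarith
  have := norm_deriv_le_of_forall_mem_sphere_norm_le hδ0
    ((hhd.mono hcl).diffContOnCl_ball subset_rfl) hC
  rw [(hder z hzb).deriv] at this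
  refine this.trans (le_of_eq ?_)
  rw [hδ]
  have : r₁ - r ≠ 0 := by linarith
  field_simp
  ring

/-- The logarithmic derivative of a bounded function on a disc whose zeros lie in a half-plane to
the left: a two-sided bound, and a one-sided bound which is uniform up to the zeros. -/
theorem logDeriv_bounds_of_zeros_left {A R r₁ r c : ℝ} (hr0 : 0 ≤ r) (hr : r < r₁) (hr1 : r₁ < R)
    (N : ℕ) : ∀ (f : ℂ → ℂ) (M : ℝ), DiffContOnCl ℂ f (ball 0 R) →
    (∀ z ∈ sphere (0 : ℂ) R, ‖f z‖ ≤ M) → f 0 ≠ 0 → (∀ a ∈ ball (0 : ℂ) r₁, f a = 0 → a.re ≤ c) →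
    M ≤ ‖f 0‖ * (R / r₁) ^ N → Real.log (M / ‖f 0‖) + 1 ≤ A → ∀ z : ℂ, ‖z‖ ≤ r → c < z.re →
    ‖logDeriv f z‖ ≤ 8 * A * r₁ / (r₁ - r) ^ 2 + N * (1 / (R - r) + 1 / (z.re - c)) ∧
    -(8 * A * r₁ / (r₁ - r) ^ 2 + N * (1 / (R - r))) ≤ (logDeriv f z).re := by
  have hr1pos : 0 < r₁ := hr0.trans_lt hr
  have hR : 0 < R := hr1pos.trans hr1
  have hbd : ∀ (f : ℂ → ℂ) (M : ℝ), DiffContOnCl ℂ f (ball 0 R) →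
      (∀ z ∈ sphere (0 : ℂ) R, ‖f z‖ ≤ M) → ∀ z ∈ ball (0 : ℂ) R, ‖f z‖ ≤ M := by
    intro f M hf hM z hz
    refine norm_le_of_forall_mem_frontier_norm_le isBounded_ball hf ?_ (subset_closure hz)
    intro w hw
    rw [frontier_ball _ hR.ne'] at hw
    exact hM w hw
  -- the case without zeros
  have hzf : ∀ (N : ℕ) (f : ℂ → ℂ) (M : ℝ), DiffContOnCl ℂ f (ball 0 R) →
      (∀ z ∈ sphere (0 : ℂ) R, ‖f z‖ ≤ M) → (∀ a ∈ ball (0 : ℂ) r₁, f a ≠ 0) →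
      Real.log (M / ‖f 0‖) + 1 ≤ A → ∀ z : ℂ, ‖z‖ ≤ r → c < z.re →
      ‖logDeriv f z‖ ≤ 8 * A * r₁ / (r₁ - r) ^ 2 + N * (1 / (R - r) + 1 / (z.re - c)) ∧
      -(8 * A * r₁ / (r₁ - r) ^ 2 + N * (1 / (R - r))) ≤ (logDeriv f z).re := by
    intro N f M hf hM h0 hA z hz hzc
    have hsub : ball (0 : ℂ) r₁ ⊆ ball 0 R := ball_subset_ball hr1.le
    have := norm_logDeriv_le_of_ne_zero hr0 hr (hf.differentiableOn.mono hsub)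
      (fun w hw => hbd f M hf hM w (hsub hw)) h0 hA hz
    have hRr : 0 < R - r := by linarith
    have hzc' : 0 < z.re - c := by linarith
    have p1 : 0 ≤ (N : ℝ) * (1 / (R - r)) := by positivity
    have p2 : 0 ≤ (N : ℝ) * (1 / (R - r) + 1 / (z.re - c)) := by positivity
    have h3 := (abs_le.mp (abs_re_le_norm (logDeriv f z))).1
    constructor <;> linarith
  -- removing one zero
  have hrem : ∀ (f : ℂ → ℂ) (M : ℝ), DiffContOnCl ℂ f (ball 0 R) →
      (∀ z ∈ sphere (0 : ℂ) R, ‖f z‖ ≤ M) → f 0 ≠ 0 → ∀ a ∈ ball (0 : ℂ) r₁, f a = 0 →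
      ∃ g : ℂ → ℂ, DiffContOnCl ℂ g (ball 0 R) ∧ (∀ z ∈ sphere (0 : ℂ) R, ‖g z‖ ≤ M) ∧
        ‖f 0‖ * (R / r₁) ≤ ‖g 0‖ ∧ (∀ z ∈ ball (0 : ℂ) r₁, g z = 0 → f z = 0) ∧
        ∀ z : ℂ, ‖z‖ ≤ r → f z ≠ 0 → logDeriv f z = logDeriv g z + 1 / (z - a) +
          (starRingEnd ℂ) a / (R ^ 2 - (starRingEnd ℂ) a * z) := by
    intro f M hf hM hf0 a ha hfa
    have ha' : ‖a‖ < r₁ := by simpa using ha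
    have haR : ‖a‖ < R := ha'.trans hr1
    have ha0 : a ≠ 0 := by rintro rfl; exact hf0 hfa
    have hden : ∀ z : ℂ, ‖z‖ ≤ R → (R : ℂ) ^ 2 - (starRingEnd ℂ) a * z ≠ 0 := by
      intro z hz h
      have h1 : ‖(R : ℂ) ^ 2‖ = ‖(starRingEnd ℂ) a * z‖ := by rw [sub_eq_zero.mp h]
      rw [norm_mul, norm_conj, norm_pow, norm_real, Real.norm_eq_abs, abs_of_pos hR] at h1
      nlinarith [norm_nonneg a, norm_nonneg z]
    have hRC : (R : ℂ) ≠ 0 := by exact_mod_cast hR.ne'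
    have haball : ball (0 : ℂ) R ∈ 𝓝 a := isOpen_ball.mem_nhds (by simpa using haR)
    have hdsl : DiffContOnCl ℂ (dslope f a) (ball 0 R) := by
      refine ⟨(differentiableOn_dslope haball).mpr hf.differentiableOn, ?_⟩
      rw [continuousOn_dslope (mem_of_superset haball subset_closure)]
      exact ⟨hf.continuousOn, hf.differentiableAt isOpen_ball (mem_of_mem_nhds haball)⟩
    have hval : ∀ z, z ≠ a → dslope f a z = f z / (z - a) := by
      intro z hz
      rw [dslope_of_ne _ hz, slope_def_field, hfa, sub_zero]
    -- Division by the Blaschke factor of `a`. It has modulus one on the sphere, so the bound `M`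
    -- survives, while the value at the centre grows by `R / ‖a‖ ≥ R / r₁`.
    refine ⟨fun z => dslope f a z * (((R : ℂ) ^ 2 - (starRingEnd ℂ) a * z) / R), ?_, ?_, ?_, ?_, ?_⟩
    · have : Differentiable ℂ (fun z : ℂ => ((R : ℂ) ^ 2 - (starRingEnd ℂ) a * z) / R) := by
        fun_prop
      exact hdsl.smul this.diffContOnCl
    · intro z hz
      have hzR : ‖z‖ = R := by simpa using hz
      have hza : z ≠ a := by rintro rfl; linarith
      have hza' : 0 < ‖z - a‖ := norm_pos_iff.mpr (sub_ne_zero.mpr hza)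
      have e : (R : ℂ) ^ 2 - (starRingEnd ℂ) a * z = z * (starRingEnd ℂ) (z - a) := by
        rw [map_sub, mul_sub, mul_conj, normSq_eq_norm_sq, hzR]; push_cast; ring
      show ‖dslope f a z * (((R : ℂ) ^ 2 - (starRingEnd ℂ) a * z) / R)‖ ≤ M
      rw [hval z hza, e, norm_mul, norm_div, norm_div, norm_mul, norm_conj, norm_real,
        Real.norm_eq_abs, abs_of_pos hR, hzR]
      have : ‖f z‖ / ‖z - a‖ * (R * ‖z - a‖ / R) = ‖f z‖ := by field_simp
      rw [this]; exact hM z hz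
    · show _ ≤ ‖dslope f a 0 * (((R : ℂ) ^ 2 - (starRingEnd ℂ) a * 0) / R)‖
      have hapos : 0 < ‖a‖ := norm_pos_iff.mpr ha0
      rw [hval 0 ha0.symm, norm_mul, norm_div, norm_div, zero_sub, norm_neg, mul_zero, sub_zero,
        norm_pow, norm_real, Real.norm_eq_abs, abs_of_pos hR]
      have : ‖f 0‖ / ‖a‖ * (R ^ 2 / R) = ‖f 0‖ * (R / ‖a‖) := by field_simp
      rw [this]
      gcongr
    · intro z hz hgz
      by_cases hza : z = a
      · rw [hza]; exact hfa
      · have h1 : dslope f a z = 0 := by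
          rcases mul_eq_zero.mp hgz with h | h
          · exact h
          · exfalso
            have hzn : ‖z‖ < r₁ := by simpa using hz
            exact (div_ne_zero (hden z (by linarith)) hRC) h
        rw [hval z hza, div_eq_zero_iff] at h1
        exact h1.resolve_right (sub_ne_zero.mpr hza)
    · intro z hz hfz
      have hzR : ‖z‖ < R := by linarith
      have hza : z ≠ a := by rintro rfl; exact hfz hfa
      have hza' : z - a ≠ 0 := sub_ne_zero.mpr hza
      have hd := hden z hzR.le
      have hzball : z ∈ ball (0 : ℂ) R := by simpa using hzR
      have hds : dslope f a z ≠ 0 := by rw [hval z hza]; exact div_ne_zero hfz hza'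
      have hdd : DifferentiableAt ℂ (dslope f a) z := hdsl.differentiableAt isOpen_ball hzball
      have hfe : f = fun w => dslope f a w * (w - a) := by
        funext w
        by_cases hw : w = a
        · simp [hw, hfa]
        · rw [hval w hw, div_mul_cancel₀ _ (sub_ne_zero.mpr hw)]
      have e1 : logDeriv f z = logDeriv (dslope f a) z + 1 / (z - a) := by
        conv_lhs => rw [hfe]
        rw [logDeriv_mul (g := fun w => w - a) z hds hza' hdd (by fun_prop)]
        congr 1
        rw [logDeriv_apply]; simp
      have e2 : logDeriv (fun z => dslope f a z * (((R : ℂ) ^ 2 - (starRingEnd ℂ) a * z) / R)) z =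
          logDeriv (dslope f a) z - (starRingEnd ℂ) a / (R ^ 2 - (starRingEnd ℂ) a * z) := by
        rw [logDeriv_mul (g := fun z => ((R : ℂ) ^ 2 - (starRingEnd ℂ) a * z) / R) z hds
          (div_ne_zero hd hRC) hdd (by fun_prop), sub_eq_add_neg]
        congr 1
        rw [logDeriv_apply, deriv_div_const, deriv_const_sub, deriv_const_mul_field']
        simp
        field_simp
      rw [e1, e2]; ring
  -- estimating the contribution of one zero
  have hone : ∀ a z : ℂ, ‖a‖ < r₁ → a.re ≤ c → ‖z‖ ≤ r → c < z.re →
      ‖1 / (z - a) + (starRingEnd ℂ) a / (R ^ 2 - (starRingEnd ℂ) a * z)‖ ≤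
        1 / (R - r) + 1 / (z.re - c) ∧
      -(1 / (R - r)) ≤ (1 / (z - a) + (starRingEnd ℂ) a / (R ^ 2 - (starRingEnd ℂ) a * z)).re := by
    intro a z ha hac hz hzc
    have hzc' : 0 < z.re - c := by linarith
    have hRr : 0 < R - r := by linarith
    have h1 : ‖(starRingEnd ℂ) a / (R ^ 2 - (starRingEnd ℂ) a * z)‖ ≤ 1 / (R - r) := by
      rw [norm_div, norm_conj]
      have hl : R * (R - r) ≤ ‖(R : ℂ) ^ 2 - (starRingEnd ℂ) a * z‖ := by
        have := norm_sub_norm_le ((R : ℂ) ^ 2) ((starRingEnd ℂ) a * z)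
        rw [norm_mul, norm_conj, norm_pow, norm_real, Real.norm_eq_abs, abs_of_pos hR] at this
        have : ‖a‖ * ‖z‖ ≤ R * r := by gcongr; linarith
        nlinarith
      calc ‖a‖ / ‖(R : ℂ) ^ 2 - (starRingEnd ℂ) a * z‖ ≤ R / (R * (R - r)) := by
            gcongr; linarith
        _ = 1 / (R - r) := by field_simp
    have hre : z.re - c ≤ (z - a).re := by simp; linarith
    have h2 : ‖1 / (z - a)‖ ≤ 1 / (z.re - c) := by
      rw [norm_div, norm_one]
      gcongr
      exact hre.trans (re_le_norm _)
    -- The source of the one-sided bound: a zero to the left of `z` pushes the real part up, however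
    -- close it is.
    have h3 : 0 ≤ (1 / (z - a)).re := by
      rw [one_div, inv_re]
      exact div_nonneg (by linarith) (normSq_nonneg _)
    constructor
    · calc _ ≤ _ := norm_add_le _ _
        _ ≤ _ := by linarith
    · have := (abs_le.mp ((abs_re_le_norm _).trans h1)).1
      rw [add_re]; linarith
  induction N with
  | zero =>
    intro f M hf hM hf0 hz0 hMN hA z hz hzc
    refine hzf 0 f M hf hM ?_ hA z hz hzc
    intro a ha hfa
    -- A further zero would raise the value at the centre above `M`, against the maximum principle.
    -- The exponent `N` is thus an upper bound for the number of zeros, as in Jensen's formula.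
    obtain ⟨g, hg, hgM, hg0, -⟩ := hrem f M hf hM hf0 a ha hfa
    have h1 := hbd g M hg hgM 0 (mem_ball_self hR)
    have h2 : 1 < R / r₁ := (one_lt_div hr1pos).mpr hr1
    have h3 : 0 < ‖f 0‖ := norm_pos_iff.mpr hf0
    simp only [pow_zero, mul_one] at hMN
    nlinarith
  | succ N ih =>
    intro f M hf hM hf0 hz0 hMN hA z hz hzc
    by_cases hex : ∃ a ∈ ball (0 : ℂ) r₁, f a = 0
    · obtain ⟨a, ha, hfa⟩ := hex
      obtain ⟨g, hg, hgM, hg0, hgz, hl⟩ := hrem f M hf hM hf0 a ha hfa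
      have h2 : 1 < R / r₁ := (one_lt_div hr1pos).mpr hr1
      have h3 : 0 < ‖f 0‖ := norm_pos_iff.mpr hf0
      have h4 : ‖f 0‖ ≤ ‖g 0‖ := by nlinarith
      have hg0' : 0 < ‖g 0‖ := h3.trans_le h4
      have hMpos : 0 < M := hg0'.trans_le (hbd g M hg hgM 0 (mem_ball_self hR))
      have hih := ih g M hg hgM (norm_pos_iff.mp hg0') (fun b hb hgb => hz0 b hb (hgz b hb hgb))
        (by
          calc M ≤ ‖f 0‖ * (R / r₁) ^ (N + 1) := hMN
            _ = ‖f 0‖ * (R / r₁) * (R / r₁) ^ N := by ring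
            _ ≤ ‖g 0‖ * (R / r₁) ^ N := by gcongr) (by
          have : Real.log (M / ‖g 0‖) ≤ Real.log (M / ‖f 0‖) :=
            Real.log_le_log (by positivity) (by gcongr)
          linarith) z hz hzc
      have hfz : f z ≠ 0 := fun h => by
        have := hz0 z (by simpa using hz.trans_lt hr) h
        linarith
      have ho := hone a z (by simpa using ha) (hz0 a ha hfa) hz hzc
      rw [hl z hz hfz, add_assoc]
      push_cast
      constructor
      · calc _ ≤ _ := norm_add_le _ _
          _ ≤ _ := by linarith [hih.1, ho.1]
      · rw [add_re]; linarith [hih.2, ho.2]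
    · push Not at hex
      exact hzf (N + 1) f M hf hM hex hA z hz hzc

/-! ### Growth of `ζ` to the right of `Re s = 0`. -/

/-- The terms of the series for `(s - 1) ζ(s) - 1` in the half-plane `Re s > 0`. -/
noncomputable def zetaTerm (n : ℕ) (s : ℂ) : ℂ :=
  (s - 1) * ((n + 1 : ℕ) : ℂ) ^ (-s) + ((n + 2 : ℕ) : ℂ) ^ (1 - s) - ((n + 1 : ℕ) : ℂ) ^ (1 - s)

/-- With `m = n + 1`, the term is `s - 1` times `m^(-s) - ∫ x^(-s) dx` over `[m, m + 1]`. The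
integrand deviates from `m^(-s)` by at most `‖s‖ m^(-Re s - 1)`, which extends convergence from `Re
s > 1` to `Re s > 0`. -/
theorem norm_zetaTerm_le {s : ℂ} (hs : 0 < s.re) (n : ℕ) :
    ‖zetaTerm n s‖ ≤ ‖s - 1‖ * ‖s‖ * ((n + 1 : ℕ) : ℝ) ^ (-s.re - 1) := by
  set m : ℝ := ((n + 1 : ℕ) : ℝ) with hm
  have hm0 : 0 < m := by rw [hm]; positivity
  have hslit : ∀ x ∈ Icc m (m + 1), (x : ℂ) ∈ slitPlane := by
    intro x hx; left; simpa using hm0.trans_le hx.1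
  have hpow : ∀ (w : ℂ), ∀ x ∈ Icc m (m + 1),
      HasDerivAt (fun x : ℝ => (x : ℂ) ^ w) (w * (x : ℂ) ^ (w - 1)) x := by
    intro w x hx
    have := ((hasDerivAt_id (x : ℂ)).cpow_const (c := w) (hslit x hx)).comp_ofReal
    simpa using this
  have h1 : ∀ x ∈ Icc m (m + 1), ‖(x : ℂ) ^ (-s) - (m : ℂ) ^ (-s)‖ ≤ ‖s‖ * m ^ (-s.re - 1) := by
    intro x hx
    have := (convex_Icc m (m + 1)).norm_image_sub_le_of_norm_hasDerivWithin_le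
      (f := fun x : ℝ => (x : ℂ) ^ (-s)) (f' := fun x : ℝ => -s * (x : ℂ) ^ (-s - 1))
      (C := ‖s‖ * m ^ (-s.re - 1)) (fun y hy => (hpow (-s) y hy).hasDerivWithinAt) (by
        intro y hy
        have hy0 : 0 < y := hm0.trans_le hy.1
        rw [norm_mul, norm_neg, norm_cpow_eq_rpow_re_of_pos hy0]
        simp only [sub_re, neg_re, one_re]
        gcongr ‖s‖ * ?_
        exact Real.rpow_le_rpow_of_nonpos hm0 hy.1 (by linarith))
      (left_mem_Icc.mpr (by linarith)) hx
    refine this.trans ?_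
    have hx1 : ‖x - m‖ ≤ 1 := by
      rw [Real.norm_eq_abs, abs_of_nonneg (by linarith [hx.1])]; linarith [hx.2]
    exact mul_le_of_le_one_right (by positivity) hx1
  -- The increment of this function over `[m, m + 1]` is exactly the term, and its derivative is
  -- controlled by `h1`.
  have h2 := (convex_Icc m (m + 1)).norm_image_sub_le_of_norm_hasDerivWithin_le
      (f := fun x : ℝ => (x : ℂ) ^ (1 - s) + (s - 1) * (m : ℂ) ^ (-s) * (x : ℂ))
      (f' := fun x : ℝ => (1 - s) * ((x : ℂ) ^ (-s) - (m : ℂ) ^ (-s)))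
      (C := ‖s - 1‖ * (‖s‖ * m ^ (-s.re - 1))) (by
        intro x hx
        have h3 := (hpow (1 - s) x hx).add
          (((hasDerivAt_id (x : ℂ)).const_mul ((s - 1) * (m : ℂ) ^ (-s))).comp_ofReal)
        have e : (1 - s) * (x : ℂ) ^ (1 - s - 1) + (s - 1) * (m : ℂ) ^ (-s) * 1 =
            (1 - s) * ((x : ℂ) ^ (-s) - (m : ℂ) ^ (-s)) := by
          rw [show 1 - s - 1 = -s by ring]; ring
        rw [e] at h3
        exact h3.hasDerivWithinAt) (by
        intro x hx
        rw [norm_mul, norm_sub_rev 1 s]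
        gcongr
        exact h1 x hx)
      (left_mem_Icc.mpr (by linarith)) (right_mem_Icc.mpr (by linarith))
  have e : ((m + 1 : ℝ) : ℂ) ^ (1 - s) + (s - 1) * (m : ℂ) ^ (-s) * ((m + 1 : ℝ) : ℂ) -
      ((m : ℂ) ^ (1 - s) + (s - 1) * (m : ℂ) ^ (-s) * (m : ℂ)) = zetaTerm n s := by
    have e1 : ((m + 1 : ℝ) : ℂ) = ((n + 2 : ℕ) : ℂ) := by rw [hm]; push_cast; ring
    have e2 : (m : ℂ) = ((n + 1 : ℕ) : ℂ) := by rw [hm]; push_cast; ring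
    rw [zetaTerm, ← e1, ← e2]; push_cast; ring
  rw [e] at h2
  simpa [mul_assoc] using h2

theorem summable_nat_succ_rpow {x : ℝ} (hx : x < -1) :
    Summable fun n : ℕ => ((n + 1 : ℕ) : ℝ) ^ x :=
  (summable_nat_add_iff 1).mpr (Real.summable_nat_rpow.mpr hx)

theorem differentiable_zetaTerm (n : ℕ) : Differentiable ℂ (zetaTerm n) := by
  have h1 : ((n + 1 : ℕ) : ℂ) ≠ 0 := by exact_mod_cast Nat.succ_ne_zero n
  have h2 : ((n + 2 : ℕ) : ℂ) ≠ 0 := by exact_mod_cast Nat.succ_ne_zero (n + 1)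
  have h : ∀ (c : ℂ), c ≠ 0 → ∀ g : ℂ → ℂ, Differentiable ℂ g →
      Differentiable ℂ (fun s => c ^ g s) :=
    fun c hc g hg => hg.const_cpow (Or.inl hc)
  have a1 := h _ h1 (fun s => -s) (by fun_prop)
  have a2 := h _ h2 (fun s => 1 - s) (by fun_prop)
  have a3 := h _ h1 (fun s => 1 - s) (by fun_prop)
  exact (((differentiable_id.sub_const 1).mul a1).add a2).sub a3

/-- The differences `(n+2)^(1-s) - (n+1)^(1-s)` telescope to `-1` when `Re s > 1`. -/
theorem one_add_tsum_zetaTerm_of_one_lt_re {s : ℂ} (hs : 1 < s.re) :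
    1 + ∑' n, zetaTerm n s = (s - 1) * riemannZeta s := by
  have hsum : Summable fun n => zetaTerm n s := by
    refine Summable.of_norm_bounded (((summable_nat_succ_rpow (x := -s.re - 1)
      (by linarith)).mul_left (‖s - 1‖ * ‖s‖))) fun n => norm_zetaTerm_le (by linarith) n
  have h1 := hsum.hasSum.tendsto_sum_nat
  have hz : Summable fun n : ℕ => 1 / ((n : ℂ) + 1) ^ s := by
    have := (summable_nat_add_iff 1).mpr (Complex.summable_one_div_nat_cpow.mpr hs)
    simpa using this
  have h2 : Tendsto (fun N : ℕ => ∑ n ∈ Finset.range N, 1 / ((n : ℂ) + 1) ^ s) atTop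
      (𝓝 (riemannZeta s)) := by
    rw [zeta_eq_tsum_one_div_nat_add_one_cpow hs]
    exact hz.hasSum.tendsto_sum_nat
  have h3 : Tendsto (fun N : ℕ => ((N + 1 : ℕ) : ℂ) ^ (1 - s)) atTop (𝓝 0) := by
    rw [tendsto_zero_iff_norm_tendsto_zero]
    have : Tendsto (fun N : ℕ => ((N + 1 : ℕ) : ℝ) ^ (-(s.re - 1))) atTop (𝓝 0) :=
      (tendsto_rpow_neg_atTop (by linarith)).comp
        (tendsto_natCast_atTop_atTop.comp (tendsto_add_atTop_nat 1))
    refine this.congr fun N => ?_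
    rw [norm_natCast_cpow_of_pos (Nat.succ_pos N)]
    simp
  have h4 : ∀ N : ℕ, ∑ n ∈ Finset.range N, zetaTerm n s =
      (s - 1) * ∑ n ∈ Finset.range N, 1 / ((n : ℂ) + 1) ^ s + (((N + 1 : ℕ) : ℂ) ^ (1 - s) - 1) := by
    intro N
    induction N with
    | zero => simp
    | succ N ih =>
      rw [Finset.sum_range_succ, ih, Finset.sum_range_succ, zetaTerm, cpow_neg]
      push_cast
      rw [show (N : ℂ) + 1 + 1 = N + 2 by ring]
      ring
  have h5 := (h2.const_mul (s - 1)).add (h3.sub_const 1)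
  have h6 := tendsto_nhds_unique (h1.congr h4) h5
  rw [h6]; ring

/-- Analytic continuation from a neighbourhood of `2`, inside a bounded convex set containing both
`2` and `s`, where the series converges uniformly. -/
theorem one_add_tsum_zetaTerm {s : ℂ} (hs : 0 < s.re) (hs1 : s ≠ 1) :
    1 + ∑' n, zetaTerm n s = (s - 1) * riemannZeta s := by
  set δ := min (s.re / 2) 1 with hδ
  have hδ0 : 0 < δ := by rw [hδ]; positivity
  set B := ‖s‖ + 3
  set U : Set ℂ := {z | δ < z.re} ∩ ball 0 B with hU
  have hUo : IsOpen U := (isOpen_lt continuous_const continuous_re).inter isOpen_ball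
  have hUc : Convex ℝ U := (convex_halfSpace_re_gt δ).inter (convex_ball 0 B)
  have hsU : s ∈ U := ⟨show δ < s.re from (min_le_left _ _).trans_lt (by linarith), by simp [B]⟩
  have h2U : (2 : ℂ) ∈ U := ⟨show δ < (2 : ℂ).re from (min_le_right _ _).trans_lt (by norm_num), by
    simp [B]; linarith [norm_nonneg s]⟩
  have hF : DifferentiableOn ℂ (fun z => 1 + ∑' n, zetaTerm n z) U := by
    refine (differentiableOn_const _).add ?_
    refine differentiableOn_tsum_of_summable_norm
      (u := fun n => (B + 1) * B * ((n + 1 : ℕ) : ℝ) ^ (-δ - 1))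
      ((summable_nat_succ_rpow (by linarith)).mul_left _)
      (fun n => (differentiable_zetaTerm n).differentiableOn) hUo ?_
    intro n z hz
    have hzB : ‖z‖ ≤ B := by simpa using (mem_ball_zero_iff.mp hz.2).le
    have hzδ : δ < z.re := hz.1
    refine (norm_zetaTerm_le (hδ0.trans hzδ) n).trans ?_
    have h1 : ‖z - 1‖ ≤ B + 1 := (norm_sub_le _ _).trans (by simpa using hzB)
    gcongr
    exact_mod_cast Nat.succ_le_succ (Nat.zero_le n)
  have hz1 : Differentiable ℂ riemannZeta₁ := differentiable_riemannZeta₁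
  have key := (hF.analyticOnNhd hUo).eqOn_of_preconnected_of_eventuallyEq
    (hz1.differentiableOn.analyticOnNhd hUo) hUc.isPreconnected h2U (by
      filter_upwards [(isOpen_lt continuous_const continuous_re).mem_nhds
        (show (2 : ℂ) ∈ {z : ℂ | 1 < z.re} by simp)] with z hz
      have hz' : 1 < z.re := hz
      have hne : z ≠ 1 := by rintro rfl; simp at hz'
      rw [one_add_tsum_zetaTerm_of_one_lt_re hz', riemannZeta_eq_inv_sub_mul hne, ← mul_assoc,
        mul_inv_cancel₀ (sub_ne_zero.mpr hne), one_mul])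
  have := key hsU
  rw [riemannZeta_eq_inv_sub_mul hs1, ← mul_assoc,
        mul_inv_cancel₀ (sub_ne_zero.mpr hs1), one_mul]
  exact this

/-- Polynomial growth of `ζ` in vertical strips to the right of `0`. -/
theorem norm_riemannZeta_le {δ : ℝ} (hδ : 0 < δ) :
    ∃ C : ℝ, 0 < C ∧ ∀ s : ℂ, δ ≤ s.re → 1 ≤ |s.im| → ‖riemannZeta s‖ ≤ C * (1 + ‖s‖) := by
  set S := ∑' n : ℕ, ((n + 1 : ℕ) : ℝ) ^ (-δ - 1) with hS
  have hsum := summable_nat_succ_rpow (x := -δ - 1) (by linarith)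
  have hS0 : 0 ≤ S := tsum_nonneg fun n => by positivity
  refine ⟨1 + S, by positivity, fun s hs him => ?_⟩
  have hs0 : 0 < s.re := hδ.trans_le hs
  have hs1 : s ≠ 1 := by rintro rfl; simp at him; linarith
  have h1 : 1 ≤ ‖s - 1‖ := by
    have := abs_im_le_norm (s - 1)
    simp at this; linarith
  have hb : ∀ n, ‖zetaTerm n s‖ ≤ ‖s - 1‖ * ‖s‖ * ((n + 1 : ℕ) : ℝ) ^ (-δ - 1) := by
    intro n
    refine (norm_zetaTerm_le hs0 n).trans ?_
    gcongr
    exact_mod_cast Nat.succ_le_succ (Nat.zero_le n)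
  have h2 : ‖∑' n, zetaTerm n s‖ ≤ ‖s - 1‖ * ‖s‖ * S := by
    rw [hS, ← tsum_mul_left]
    exact tsum_of_norm_bounded (hsum.mul_left _).hasSum hb
  have h3 : ‖s - 1‖ * ‖riemannZeta s‖ ≤ 1 + ‖s - 1‖ * ‖s‖ * S := by
    rw [← norm_mul, ← one_add_tsum_zetaTerm hs0 hs1]
    refine (norm_add_le _ _).trans ?_
    rw [norm_one]; linarith
  have h4 : ‖s - 1‖ * ‖riemannZeta s‖ ≤ ‖s - 1‖ * (1 + ‖s‖ * S) := by nlinarith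
  have h5 := le_of_mul_le_mul_left h4 (by linarith)
  nlinarith [norm_nonneg s]

/-- Lower bound for `ζ` on the line `Re s = 2`. -/
theorem le_norm_riemannZeta_two_add (t : ℝ) : 1 / 4 ≤ ‖riemannZeta (2 + t * I)‖ := by
  have hre : (2 + t * I : ℂ).re = 2 := by simp
  have hs : 1 < (2 + t * I : ℂ).re := by rw [hre]; norm_num
  have hsum : Summable fun n : ℕ => 1 / ((n : ℂ) + 1) ^ (2 + t * I) := by
    have := (summable_nat_add_iff 1).mpr (Complex.summable_one_div_nat_cpow.mpr hs)
    simpa using this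
  have h1 := zeta_eq_tsum_one_div_nat_add_one_cpow hs
  rw [hsum.tsum_eq_zero_add] at h1
  have hz2 := (summable_nat_add_iff 1).mpr hasSum_zeta_two.summable
  have h2 := hasSum_zeta_two.tsum_eq
  rw [hasSum_zeta_two.summable.tsum_eq_zero_add, hz2.tsum_eq_zero_add] at h2
  have hb : ‖∑' n : ℕ, 1 / (((n + 1 : ℕ) : ℂ) + 1) ^ (2 + t * I)‖ ≤
      ∑' n : ℕ, 1 / ((n + 1 + 1 : ℕ) : ℝ) ^ 2 := by
    refine tsum_of_norm_bounded ((summable_nat_add_iff 1).mpr hz2).hasSum fun n => ?_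
    have : ((n + 1 : ℕ) : ℂ) + 1 = ((n + 1 + 1 : ℕ) : ℂ) := by push_cast; ring
    rw [this, norm_div, norm_one, norm_natCast_cpow_of_pos (Nat.succ_pos _), hre]
    norm_num
  have h3 : ∑' n : ℕ, 1 / ((n + 1 + 1 : ℕ) : ℝ) ^ 2 = Real.pi ^ 2 / 6 - 1 := by
    simp only [Nat.cast_zero, zero_add, Nat.cast_one] at h2
    norm_num at h2 ⊢
    linarith
  have h4 : Real.pi ^ 2 / 6 - 1 ≤ 3 / 4 := by
    have := Real.pi_lt_d2
    nlinarith [Real.pi_pos]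
  rw [h1]
  simp only [Nat.cast_zero, zero_add, one_cpow, div_one]
  have := norm_sub_le_norm_add (1 : ℂ) (∑' n : ℕ, 1 / (((n + 1 : ℕ) : ℂ) + 1) ^ (2 + t * I))
  rw [norm_one] at this
  linarith
-- First bounds for `ζ'/ζ` under the Riemann hypothesis.
theorem RiemannHypothesis.riemannZeta_ne_zero (hRH : RiemannHypothesis) {s : ℂ}
    (hs : 1 / 2 < s.re) : riemannZeta s ≠ 0 := by
  intro h
  by_cases h1 : s = 1
  · exact riemannZeta_one_ne_zero (h1 ▸ h)
  have := hRH s h (by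
    rintro ⟨n, rfl⟩
    have h2 : ((-2 * ((n : ℂ) + 1)).re) = -2 * ((n : ℝ) + 1) := by simp
    rw [h2] at hs
    have : (0 : ℝ) ≤ n := n.cast_nonneg
    linarith) h1
  linarith

theorem RiemannHypothesis.re_eq_half_of_zero (hRH : RiemannHypothesis) {s : ℂ}
    (hs : s.im ≠ 0) (h : riemannZeta s = 0) : s.re = 1 / 2 :=
  hRH s h (by rintro ⟨n, rfl⟩; simp at hs) (by rintro rfl; simp at hs)

/-- Under the Riemann hypothesis, `Re (ζ'/ζ)(σ + it)` is bounded below by `-C log t` and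
`(ζ'/ζ)(σ + it)` is at most `C log t / (σ - 1/2)`, for `1/2 < σ ≤ 3`. -/
theorem RiemannHypothesis.logDeriv_riemannZeta_bounds (hRH : RiemannHypothesis) :
    ∃ C : ℝ, 0 < C ∧ ∀ σ t : ℝ, 1 / 2 < σ → σ ≤ 3 → 3 ≤ t →
      -(C * Real.log t) ≤ (logDeriv riemannZeta (σ + t * I)).re ∧
      ‖logDeriv riemannZeta (σ + t * I)‖ ≤ C * Real.log t / (σ - 1 / 2) := by
  obtain ⟨C₀, hC₀, hgrow⟩ := norm_riemannZeta_le (δ := 1 / 10) (by norm_num)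
  set q : ℝ := Real.log (19 / 17) with hq
  have hq0 : 0 < q := Real.log_pos (by norm_num)
  set C₁ : ℝ := |Real.log (16 * C₀)| + 2 with hC₁
  have hC₁0 : 0 < C₁ := by positivity
  set C₂ : ℝ := 1400 * C₁ + (C₁ / q + 1) * 10 with hC₂
  have hC₂0 : 0 < C₂ := by positivity
  refine ⟨10 * C₂, by positivity, fun σ t hσ hσ3 ht => ?_⟩
  have hlog1 : 1 ≤ Real.log t := by
    rw [Real.le_log_iff_exp_le (by linarith)]
    linarith [Real.exp_one_lt_d9]
  -- Discs about `2 + it`: radius `19/10` stays in `Re s ≥ 1/10` and at height at least `1`, and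
  -- radius `8/5` contains all `σ - 2` with `1/2 < σ ≤ 3`. Zeros correspond to real part `-3/2`.
  set f : ℂ → ℂ := fun z => riemannZeta (2 + t * I + z) with hf
  set M : ℝ := C₀ * (4 * t) with hM
  have him : ∀ z : ℂ, ‖z‖ ≤ 19 / 10 → 1 ≤ (2 + t * I + z).im ∧ 1 / 10 ≤ (2 + t * I + z).re := by
    intro z hz
    have h1 := (abs_le.mp ((abs_im_le_norm z).trans hz)).1
    have h2 := (abs_le.mp ((abs_re_le_norm z).trans hz)).1
    simp
    constructor <;> linarith
  have hne1 : ∀ z : ℂ, ‖z‖ ≤ 19 / 10 → (2 + t * I + z) ≠ 1 := by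
    intro z hz h
    have := (him z hz).1
    rw [h] at this
    simp at this
    linarith
  have hdiff : ∀ z : ℂ, ‖z‖ ≤ 19 / 10 → DifferentiableAt ℂ f z := fun z hz =>
    DifferentiableAt.comp z (differentiableAt_riemannZeta (hne1 z hz))
      ((differentiableAt_id).const_add _)
  have hdc : DiffContOnCl ℂ f (ball 0 (19 / 10)) := by
    refine DifferentiableOn.diffContOnCl fun z hz => ?_
    rw [closure_ball _ (by norm_num), mem_closedBall_zero_iff] at hz
    exact (hdiff z hz).differentiableWithinAt
  have hMb : ∀ z ∈ sphere (0 : ℂ) (19 / 10), ‖f z‖ ≤ M := by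
    intro z hz
    have hz' : ‖z‖ = 19 / 10 := by simpa using hz
    have h1 := him z hz'.le
    refine (hgrow _ h1.2 (h1.1.trans (le_abs_self _))).trans ?_
    have h2 : ‖2 + t * I + z‖ ≤ 2 + t + 19 / 10 := by
      refine (norm_add_le _ _).trans (add_le_add ((norm_add_le _ _).trans ?_) hz'.le)
      simp [abs_of_pos (show 0 < t by linarith)]
    rw [hM]
    gcongr
    linarith
  have hf0 : 1 / 4 ≤ ‖f 0‖ := by
    simpa [hf] using le_norm_riemannZeta_two_add t
  have hf0pos : 0 < ‖f 0‖ := by linarith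
  have hMpos : 0 < M := by rw [hM]; positivity
  have hlogM : Real.log (M / ‖f 0‖) + 1 ≤ C₁ * Real.log t := by
    have h1 : M / ‖f 0‖ ≤ 16 * C₀ * t := by
      rw [div_le_iff₀ hf0pos, hM]
      have : 0 < C₀ * t := by positivity
      nlinarith
    have h2 := Real.log_le_log (by positivity) h1
    rw [Real.log_mul (by positivity) (by linarith)] at h2
    have h3 := le_abs_self (Real.log (16 * C₀))
    have h4 := abs_nonneg (Real.log (16 * C₀))
    rw [hC₁]
    nlinarith
  -- Since `19/17` is the ratio of the two outer radii, this makes `(19/17)^N` at least `M / ‖f 0‖`,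
  -- with `N` of order `log t`.
  set N : ℕ := ⌈(C₁ * Real.log t) / q⌉₊ with hN
  have hN1 : C₁ * Real.log t ≤ N * q := by
    rw [← div_le_iff₀ hq0]; exact Nat.le_ceil _
  have hN2 : (N : ℝ) ≤ (C₁ / q + 1) * Real.log t := by
    have := Nat.ceil_lt_add_one (show 0 ≤ (C₁ * Real.log t) / q by positivity)
    rw [← hN] at this
    have e : (C₁ / q + 1) * Real.log t = C₁ * Real.log t / q + Real.log t := by ring
    rw [e]; linarith
  have hMN : M ≤ ‖f 0‖ * ((19 / 10) / (17 / 10)) ^ N := by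
    rw [← div_le_iff₀' hf0pos]
    have h1 : (((19 : ℝ) / 10) / (17 / 10)) ^ N = Real.exp (N * q) := by
      rw [hq, Real.exp_nat_mul, Real.exp_log (by norm_num)]
      norm_num
    rw [h1, ← Real.log_le_iff_le_exp (by positivity)]
    linarith
  have hz0 : ∀ a ∈ ball (0 : ℂ) (17 / 10), f a = 0 → a.re ≤ -(3 / 2) := by
    intro a ha hfa
    have ha' : ‖a‖ ≤ 19 / 10 := by
      have : ‖a‖ < 17 / 10 := by simpa using ha
      linarith
    have h1 := him a ha'
    have h2 := hRH.re_eq_half_of_zero (s := 2 + t * I + a) (by linarith) hfa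
    simp at h2
    linarith
  have hz : ‖((σ - 2 : ℝ) : ℂ)‖ ≤ 8 / 5 := by
    rw [norm_real, Real.norm_eq_abs, abs_le]; constructor <;> linarith
  have key := logDeriv_bounds_of_zeros_left (A := C₁ * Real.log t) (R := 19 / 10) (r₁ := 17 / 10)
    (r := 8 / 5) (c := -(3 / 2)) (by norm_num) (by norm_num) (by norm_num) N f M hdc hMb
    (norm_pos_iff.mp hf0pos) hz0 hMN hlogM ((σ - 2 : ℝ) : ℂ) hz (by simp; linarith)
  have hval : logDeriv f ((σ - 2 : ℝ) : ℂ) = logDeriv riemannZeta (σ + t * I) := by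
    have e : 2 + t * I + ((σ - 2 : ℝ) : ℂ) = σ + t * I := by push_cast; ring
    rw [logDeriv_apply, logDeriv_apply, hf, deriv_comp_const_add, e]
    simp only [e]
  rw [hval] at key
  have e1 : 8 * (C₁ * Real.log t) * (17 / 10) / ((17 : ℝ) / 10 - 8 / 5) ^ 2 =
      1360 * C₁ * Real.log t := by norm_num; ring
  have e2 : (1 : ℝ) / (19 / 10 - 8 / 5) = 10 / 3 := by norm_num
  have e3 : ((σ - 2 : ℝ) : ℂ).re - -(3 / 2) = σ - 1 / 2 := by simp; ring
  rw [e1, e2, e3] at key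
  have hb : 1360 * C₁ * Real.log t + N * (10 / 3) ≤ C₂ * Real.log t := by
    rw [hC₂]; nlinarith
  constructor
  · have : C₂ * Real.log t ≤ 10 * C₂ * Real.log t := by nlinarith
    linarith [key.2]
  · refine key.1.trans ?_
    have hσ0 : 0 < σ - 1 / 2 := by linarith
    rw [le_div_iff₀ hσ0]
    have h1 : (1360 * C₁ * Real.log t + N * (10 / 3 + 1 / (σ - 1 / 2))) * (σ - 1 / 2) =
        (1360 * C₁ * Real.log t + N * (10 / 3)) * (σ - 1 / 2) + N := by
      have : 1 / (σ - 1 / 2) * (σ - 1 / 2) = 1 := by rw [one_div, inv_mul_cancel₀ hσ0.ne']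
      linear_combination (N : ℝ) * this
    have h2 : (N : ℝ) ≤ C₂ * Real.log t := by
      refine hN2.trans ?_
      rw [hC₂]
      have : 0 ≤ C₁ / q := by positivity
      nlinarith
    rw [h1]
    have h3 : (1360 * C₁ * Real.log t + N * (10 / 3)) * (σ - 1 / 2) ≤
        C₂ * Real.log t * (5 / 2) := by
      gcongr
      linarith
    nlinarith [mul_pos hC₂0 (by linarith : 0 < Real.log t)]

/-! ### Dirichlet polynomials with von Mangoldt coefficients. -/

/-- Partial summation: weights whose partial sums are at most `c n`, against an antitone sequence. -/
theorem sum_mul_le_of_partial_sums_le {a g : ℕ → ℝ} {c : ℝ} (hg : Antitone g) (hg0 : ∀ i, 0 ≤ g i)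
    (ha : ∀ n, ∑ i ∈ Finset.range n, a i ≤ c * n) (N : ℕ) :
    ∑ i ∈ Finset.range N, a i * g i ≤ c * ∑ i ∈ Finset.range N, g i := by
  have hS : ∀ n, 0 ≤ ∑ i ∈ Finset.range n, (c - a i) := by
    intro n
    rw [Finset.sum_sub_distrib, Finset.sum_const, Finset.card_range, nsmul_eq_mul]
    linarith [ha n, mul_comm c n]
  have key : ∀ n, g n * ∑ i ∈ Finset.range n, (c - a i) ≤
      ∑ i ∈ Finset.range n, (c - a i) * g i := by
    intro n
    induction n with
    | zero => simp
    | succ n ih =>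
      have h1 := mul_le_mul_of_nonneg_right (hg n.le_succ) (hS (n + 1))
      rw [Finset.sum_range_succ (fun i => (c - a i) * g i)]
      rw [Finset.sum_range_succ] at h1 ⊢
      calc _ ≤ _ := h1
        _ = g n * ∑ i ∈ Finset.range n, (c - a i) + (c - a n) * g n := by ring
        _ ≤ _ := by linarith
  have h1 := (mul_nonneg (hg0 N) (hS N)).trans (key N)
  have h2 : ∑ i ∈ Finset.range N, (c - a i) * g i =
      c * ∑ i ∈ Finset.range N, g i - ∑ i ∈ Finset.range N, a i * g i := by
    rw [Finset.mul_sum, ← Finset.sum_sub_distrib]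
    exact Finset.sum_congr rfl fun i _ => by ring
  linarith

theorem sum_range_vonMangoldt_succ_le (n : ℕ) :
    ∑ i ∈ Finset.range n, ArithmeticFunction.vonMangoldt (i + 1) ≤ 6 * n := by
  have h1 := Chebyshev.psi_le_const_mul_self (x := n) n.cast_nonneg
  rw [Chebyshev.psi, Nat.floor_natCast, ← Finset.Ico_add_one_add_one_eq_Ioc,
    Finset.sum_Ico_eq_sum_range] at h1
  have h2 : Real.log 4 + 4 ≤ 6 := by
    rw [show (4 : ℝ) = 2 ^ 2 by norm_num, Real.log_pow]
    have := Real.log_two_lt_d9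
    norm_num
    linarith
  calc _ = _ := Finset.sum_congr (by simp) fun i _ => by rw [zero_add, add_comm]
    _ ≤ _ := h1
    _ ≤ _ := by gcongr

/-- Bernoulli's inequality for the exponent `1 - σ` is the discrete form of comparison with `∫
x^(-σ) dx`: each summand is at most an increment of `n^(1-σ) / (1 - σ)`. -/
theorem sum_range_succ_rpow_neg_le {σ : ℝ} (h0 : 0 ≤ σ) (h1 : σ < 1) (N : ℕ) :
    ∑ i ∈ Finset.range N, ((i + 1 : ℕ) : ℝ) ^ (-σ) ≤ (N : ℝ) ^ (1 - σ) / (1 - σ) := by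
  have h1' : 0 < 1 - σ := by linarith
  induction N with
  | zero => simp [Real.zero_rpow h1'.ne']
  | succ n ih =>
    rw [Finset.sum_range_succ]
    have hn : (0 : ℝ) < ((n + 1 : ℕ) : ℝ) := by positivity
    have hle : 1 / ((n + 1 : ℕ) : ℝ) ≤ 1 := by
      rw [div_le_one hn]; exact_mod_cast Nat.succ_le_succ (Nat.zero_le n)
    have hb := rpow_one_add_le_one_add_mul_self (s := -(1 / ((n + 1 : ℕ) : ℝ)))
      (p := 1 - σ) (by linarith) h1'.le (by linarith)
    have e1 : (n : ℝ) = ((n + 1 : ℕ) : ℝ) * (1 + -(1 / ((n + 1 : ℕ) : ℝ))) := by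
      field_simp; push_cast; ring
    have e2 : (n : ℝ) ^ (1 - σ) =
        ((n + 1 : ℕ) : ℝ) ^ (1 - σ) * (1 + -(1 / ((n + 1 : ℕ) : ℝ))) ^ (1 - σ) := by
      conv_lhs => rw [e1]
      rw [Real.mul_rpow hn.le (by linarith)]
    have e3 : ((n + 1 : ℕ) : ℝ) ^ (1 - σ) = ((n + 1 : ℕ) : ℝ) * ((n + 1 : ℕ) : ℝ) ^ (-σ) := by
      rw [sub_eq_add_neg, Real.rpow_add hn, Real.rpow_one]
    have hq : 0 ≤ ((n + 1 : ℕ) : ℝ) ^ (1 - σ) := by positivity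
    have h3 := mul_le_mul_of_nonneg_left hb hq
    rw [← e2] at h3
    rw [le_div_iff₀ h1'] at ih ⊢
    have e4 : ((n + 1 : ℕ) : ℝ) ^ (1 - σ) * (1 + (1 - σ) * -(1 / ((n + 1 : ℕ) : ℝ))) =
        ((n + 1 : ℕ) : ℝ) ^ (1 - σ) - (1 - σ) * ((n + 1 : ℕ) : ℝ) ^ (-σ) := by
      rw [e3]; field_simp; ring
    rw [e4] at h3
    nlinarith

/-- The Dirichlet polynomial `∑_{n ≤ N} Λ(n) n ^ (-s)`. -/
noncomputable def vonMangoldtSum (N : ℕ) (s : ℂ) : ℂ :=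
  ∑ i ∈ Finset.range N, (ArithmeticFunction.vonMangoldt (i + 1) : ℂ) * ((i + 1 : ℕ) : ℂ) ^ (-s)

theorem differentiable_vonMangoldtSum (N : ℕ) : Differentiable ℂ (vonMangoldtSum N) := by
  unfold vonMangoldtSum
  refine Differentiable.fun_sum fun i _ => ?_
  have h1 : ((i + 1 : ℕ) : ℂ) ≠ 0 := by exact_mod_cast Nat.succ_ne_zero i
  have : Differentiable ℂ fun s : ℂ => ((i + 1 : ℕ) : ℂ) ^ (-s) :=
    Differentiable.const_cpow (by fun_prop) (Or.inl h1)
  exact this.const_mul _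

/-- Chebyshev's bound and partial summation replace `Λ` by the constant `6`, so that no logarithm is
lost. -/
theorem norm_vonMangoldtSum_le {σ : ℝ} (h0 : 0 ≤ σ) (h1 : σ < 1) (N : ℕ) {s : ℂ} (hs : σ ≤ s.re) :
    ‖vonMangoldtSum N s‖ ≤ 6 * (N : ℝ) ^ (1 - σ) / (1 - σ) := by
  calc ‖vonMangoldtSum N s‖
      ≤ ∑ i ∈ Finset.range N, ArithmeticFunction.vonMangoldt (i + 1) * ((i + 1 : ℕ) : ℝ) ^ (-σ) := by
        refine norm_sum_le_of_le _ fun i _ => ?_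
        rw [norm_mul, norm_real, Real.norm_eq_abs,
          abs_of_nonneg ArithmeticFunction.vonMangoldt_nonneg,
          norm_natCast_cpow_of_pos (Nat.succ_pos i), neg_re]
        gcongr
        exact_mod_cast Nat.succ_le_succ (Nat.zero_le i)
    _ ≤ 6 * ∑ i ∈ Finset.range N, ((i + 1 : ℕ) : ℝ) ^ (-σ) := by
        refine sum_mul_le_of_partial_sums_le (fun i j hij => ?_) (fun i => by positivity)
          sum_range_vonMangoldt_succ_le N
        exact Real.rpow_le_rpow_of_nonpos (by positivity) (by exact_mod_cast Nat.succ_le_succ hij)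
          (by linarith)
    _ ≤ _ := by
        rw [mul_div_assoc]
        gcongr
        exact sum_range_succ_rpow_neg_le h0 h1 N

theorem hasSum_vonMangoldt {s : ℂ} (hs : 1 < s.re) :
    HasSum (fun i : ℕ => (ArithmeticFunction.vonMangoldt (i + 1) : ℂ) * ((i + 1 : ℕ) : ℂ) ^ (-s))
      (-logDeriv riemannZeta s) := by
  have h1 := (ArithmeticFunction.LSeriesSummable_vonMangoldt hs)
  have h2 := h1.LSeriesHasSum
  rw [ArithmeticFunction.LSeries_vonMangoldt_eq_deriv_riemannZeta_div hs, neg_div,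
    ← logDeriv_apply] at h2
  have h3 := (hasSum_nat_add_iff' 1).mpr h2
  simpa [LSeries.term, cpow_neg, div_eq_mul_inv] using h3

theorem summable_vonMangoldt_rpow {x : ℝ} (hx : 1 < x) :
    Summable (fun i : ℕ => ArithmeticFunction.vonMangoldt (i + 1) * ((i + 1 : ℕ) : ℝ) ^ (-x)) := by
  have := (hasSum_vonMangoldt (s := x) (by simpa using hx)).summable.norm
  refine this.congr fun i => ?_
  rw [norm_mul, norm_real, Real.norm_eq_abs,
    abs_of_nonneg ArithmeticFunction.vonMangoldt_nonneg,
    norm_natCast_cpow_of_pos (Nat.succ_pos i), neg_re, ofReal_re]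

theorem norm_logDeriv_add_vonMangoldtSum_le {N : ℕ} (hN : 1 ≤ N) {s : ℂ} (hs : s.re = 3) :
    ‖logDeriv riemannZeta s + vonMangoldtSum N s‖ ≤ 12 / (N : ℝ) ^ 2 := by
  have h1 := hasSum_vonMangoldt (s := s) (by rw [hs]; norm_num)
  have hN0 : (0 : ℝ) < N := by exact_mod_cast hN
  have h2 := (hasSum_nat_add_iff' N).mpr h1
  have e : logDeriv riemannZeta s + vonMangoldtSum N s =
      -(-logDeriv riemannZeta s - vonMangoldtSum N s) := by ring
  rw [e, norm_neg, vonMangoldtSum, ← h2.tsum_eq]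
  set F : ℕ → ℝ := fun i => ArithmeticFunction.vonMangoldt (i + N + 1) *
    ((i + N + 1 : ℕ) : ℝ) ^ (-3 : ℝ) with hF
  have hF0 : ∀ i, 0 ≤ F i := fun i =>
    mul_nonneg ArithmeticFunction.vonMangoldt_nonneg (by positivity)
  have hFs : Summable F := (summable_nat_add_iff N).mpr
    (summable_vonMangoldt_rpow (x := 3) (by norm_num))
  have hb := tsum_of_norm_bounded hFs.hasSum (f := fun i : ℕ =>
    (ArithmeticFunction.vonMangoldt (i + N + 1) : ℂ) * ((i + N + 1 : ℕ) : ℂ) ^ (-s)) (by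
      intro i
      rw [norm_mul, norm_real, Real.norm_eq_abs,
        abs_of_nonneg ArithmeticFunction.vonMangoldt_nonneg,
        norm_natCast_cpow_of_pos (Nat.succ_pos _), neg_re, hs])
  refine hb.trans (Real.tsum_le_of_sum_range_le hF0 fun M => ?_)
  -- Flattening the weights below `N` keeps the sequence antitone, so partial summation can start at
  -- the first index. The flat stretch adds only `N * N^(-3)`, the same order as the tail.
  set g : ℕ → ℝ := fun i => (max ((i + 1 : ℕ) : ℝ) N) ^ (-3 : ℝ) with hg
  have hganti : Antitone g := fun i j hij =>
    Real.rpow_le_rpow_of_nonpos (by positivity)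
      (max_le_max_right _ (by exact_mod_cast Nat.succ_le_succ hij)) (by norm_num)
  have hg0 : ∀ i, 0 ≤ g i := fun i => by positivity
  have hgtail : ∀ i, g (N + i) ≤ (N : ℝ)⁻¹ * (((N + i + 1 : ℕ) : ℝ) ^ 2)⁻¹ := by
    intro i
    have hx : (N : ℝ) ≤ ((N + i + 1 : ℕ) : ℝ) := by exact_mod_cast (by omega)
    rw [hg]
    simp only
    rw [max_eq_left hx, Real.rpow_neg (by positivity), ← mul_inv]
    gcongr
    rw [show (3 : ℝ) = ((3 : ℕ) : ℝ) by norm_num, Real.rpow_natCast]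
    calc (N : ℝ) * ((N + i + 1 : ℕ) : ℝ) ^ 2 ≤ ((N + i + 1 : ℕ) : ℝ) * ((N + i + 1 : ℕ) : ℝ) ^ 2 :=
          mul_le_mul_of_nonneg_right hx (sq_nonneg _)
      _ = ((N + i + 1 : ℕ) : ℝ) ^ 3 := by ring
  calc ∑ i ∈ Finset.range M, F i
      = ∑ i ∈ Finset.range M, ArithmeticFunction.vonMangoldt (N + i + 1) * g (N + i) := by
        refine Finset.sum_congr rfl fun i _ => ?_
        have hx : (N : ℝ) ≤ ((N + i + 1 : ℕ) : ℝ) := by exact_mod_cast (by omega)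
        rw [hF, hg]
        simp only
        rw [max_eq_left hx, add_comm i N]
    _ ≤ ∑ i ∈ Finset.range (N + M), ArithmeticFunction.vonMangoldt (i + 1) * g i := by
        rw [Finset.sum_range_add]
        have : 0 ≤ ∑ i ∈ Finset.range N, ArithmeticFunction.vonMangoldt (i + 1) * g i :=
          Finset.sum_nonneg fun i _ => mul_nonneg ArithmeticFunction.vonMangoldt_nonneg (hg0 i)
        linarith
    _ ≤ 6 * ∑ i ∈ Finset.range (N + M), g i :=
        sum_mul_le_of_partial_sums_le hganti hg0 sum_range_vonMangoldt_succ_le _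
    _ ≤ 6 * (1 / (N : ℝ) ^ 2 + 1 / (N : ℝ) ^ 2) := by
        rw [Finset.sum_range_add]
        gcongr
        · calc ∑ i ∈ Finset.range N, g i ≤ ∑ i ∈ Finset.range N, (N : ℝ) ^ (-3 : ℝ) :=
                Finset.sum_le_sum fun i _ => Real.rpow_le_rpow_of_nonpos hN0
                  (le_max_right _ _) (by norm_num)
            _ = 1 / (N : ℝ) ^ 2 := by
                rw [Finset.sum_const, Finset.card_range, nsmul_eq_mul,
                  Real.rpow_neg hN0.le, show (3 : ℝ) = ((3 : ℕ) : ℝ) by norm_num,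
                  Real.rpow_natCast]
                field_simp
        · calc ∑ i ∈ Finset.range M, g (N + i)
              ≤ ∑ i ∈ Finset.range M, (N : ℝ)⁻¹ * (((N + i + 1 : ℕ) : ℝ) ^ 2)⁻¹ :=
                Finset.sum_le_sum fun i _ => hgtail i
            _ = (N : ℝ)⁻¹ * ∑ i ∈ Finset.Ioc N (N + M), ((i : ℝ) ^ 2)⁻¹ := by
                rw [← Finset.mul_sum, ← Finset.Ico_add_one_add_one_eq_Ioc,
                  Finset.sum_Ico_eq_sum_range]
                congr 1
                rw [show N + M + 1 - (N + 1) = M by omega]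
                refine Finset.sum_congr rfl fun i _ => ?_
                rw [show N + 1 + i = N + i + 1 by ring]
            _ ≤ (N : ℝ)⁻¹ * (N : ℝ)⁻¹ := by
                gcongr
                refine (sum_Ioc_inv_sq_le_sub (by omega) (by omega)).trans ?_
                have : (0 : ℝ) ≤ ((N + M : ℕ) : ℝ)⁻¹ := by positivity
                linarith
            _ = 1 / (N : ℝ) ^ 2 := by field_simp
    _ = 12 / (N : ℝ) ^ 2 := by ring

/-- Exponential decay of `ζ'/ζ` to the right. -/
theorem norm_logDeriv_riemannZeta_le_two_rpow :
    ∃ C : ℝ, 0 < C ∧ ∀ s : ℂ, 2 ≤ s.re → ‖logDeriv riemannZeta s‖ ≤ C * (2 : ℝ) ^ (-s.re) := by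
  have hS := summable_vonMangoldt_rpow (x := 2) (by norm_num)
  set S := ∑' i : ℕ, ArithmeticFunction.vonMangoldt (i + 1) * ((i + 1 : ℕ) : ℝ) ^ (-2 : ℝ)
  have hS0 : 0 ≤ S :=
    tsum_nonneg fun i => mul_nonneg ArithmeticFunction.vonMangoldt_nonneg (by positivity)
  refine ⟨4 * S + 1, by positivity, fun s hs => ?_⟩
  have h1 := hasSum_vonMangoldt (s := s) (by linarith)
  rw [← norm_neg, ← h1.tsum_eq]
  have h2 := tsum_of_norm_bounded (hS.hasSum.mul_left ((2 : ℝ) ^ (2 - s.re))) (f := fun i : ℕ =>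
    (ArithmeticFunction.vonMangoldt (i + 1) : ℂ) * ((i + 1 : ℕ) : ℂ) ^ (-s)) (by
      intro i
      rw [norm_mul, norm_real, Real.norm_eq_abs,
        abs_of_nonneg ArithmeticFunction.vonMangoldt_nonneg,
        norm_natCast_cpow_of_pos (Nat.succ_pos _), neg_re]
      rcases Nat.eq_zero_or_pos i with rfl | hi
      · simp
      · have h2i : (2 : ℝ) ≤ ((i + 1 : ℕ) : ℝ) := by exact_mod_cast Nat.succ_le_succ hi
        have : ((i + 1 : ℕ) : ℝ) ^ (-s.re) =
            ((i + 1 : ℕ) : ℝ) ^ (2 - s.re) * ((i + 1 : ℕ) : ℝ) ^ (-2 : ℝ) := by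
          rw [← Real.rpow_add (by positivity)]; congr 1; ring
        rw [this, mul_left_comm]
        have := Real.rpow_le_rpow_of_nonpos (by norm_num) h2i (show 2 - s.re ≤ 0 by linarith)
        gcongr)
  refine h2.trans ?_
  change (2 : ℝ) ^ (2 - s.re) * S ≤ _
  rw [sub_eq_add_neg, Real.rpow_add (by norm_num),
    show (2 : ℝ) ^ (2 : ℝ) = 4 by rw [Real.rpow_two]; norm_num]
  have : (0 : ℝ) < 2 ^ (-s.re) := by positivity
  nlinarith

/-! ### Gaussian-damped Poisson integrals. -/

/-- The Poisson kernel of a half-plane, damped by a Gaussian. -/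
noncomputable def gaussPoisson (η v : ℝ) : ℝ := 2 * η * Real.exp (-v ^ 2) / (v ^ 2 + η ^ 2)

theorem gaussPoisson_nonneg {η : ℝ} (hη : 0 < η) (v : ℝ) : 0 ≤ gaussPoisson η v := by
  unfold gaussPoisson; positivity

theorem continuous_gaussPoisson {η : ℝ} (hη : 0 < η) : Continuous (gaussPoisson η) := by
  unfold gaussPoisson
  refine Continuous.div (by fun_prop) (by fun_prop) fun v => ?_
  positivity

/-- Without the Gaussian this is the Poisson kernel with primitive `2 arctan(v/η)`. The bound does
not depend on `η`, which later shrinks with `t`. -/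
theorem integral_gaussPoisson_le {η V : ℝ} (hη : 0 < η) (hV : 0 ≤ V) :
    ∫ v in (-V)..V, gaussPoisson η v ≤ 2 * Real.pi := by
  have h1 : ∀ v : ℝ, HasDerivAt (fun v => 2 * Real.arctan (v / η)) (2 * η / (v ^ 2 + η ^ 2)) v := by
    intro v
    have h := (((hasDerivAt_id v).div_const η).arctan).const_mul 2
    have e : 2 * (1 / (1 + (id v / η) ^ 2) * (1 / η)) = 2 * η / (v ^ 2 + η ^ 2) := by
      simp only [id]
      have : v ^ 2 + η ^ 2 ≠ 0 := by positivity
      have : 1 + (v / η) ^ 2 ≠ 0 := by positivity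
      field_simp
      ring
    rw [e] at h
    exact h
  have hc : Continuous fun v : ℝ => 2 * η / (v ^ 2 + η ^ 2) :=
    Continuous.div (by fun_prop) (by fun_prop) fun v => by positivity
  have h2 := intervalIntegral.integral_eq_sub_of_hasDerivAt (fun v _ => h1 v)
    (hc.intervalIntegrable (-V) V)
  calc ∫ v in (-V)..V, gaussPoisson η v ≤ ∫ v in (-V)..V, 2 * η / (v ^ 2 + η ^ 2) := by
        refine intervalIntegral.integral_mono_on (by linarith)
          ((continuous_gaussPoisson hη).intervalIntegrable _ _) (hc.intervalIntegrable _ _) ?_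
        intro v _
        unfold gaussPoisson
        have : Real.exp (-v ^ 2) ≤ 1 := Real.exp_le_one_iff.mpr (by nlinarith [sq_nonneg v])
        rw [div_le_div_iff_of_pos_right (by positivity)]
        exact mul_le_of_le_one_right (by positivity) this
    _ ≤ 2 * Real.pi := by
        rw [h2]
        have := Real.arctan_lt_pi_div_two (V / η)
        have := Real.neg_pi_div_two_lt_arctan (-V / η)
        linarith

theorem integral_exp_neg_sq_le {V : ℝ} (hV : 0 ≤ V) :
    ∫ v in (-V)..V, Real.exp (-v ^ 2) ≤ Real.pi := by
  have hc : Continuous fun v : ℝ => (1 + v ^ 2)⁻¹ :=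
    Continuous.inv₀ (by fun_prop) fun v => by positivity
  calc ∫ v in (-V)..V, Real.exp (-v ^ 2) ≤ ∫ v in (-V)..V, (1 + v ^ 2)⁻¹ := by
        refine intervalIntegral.integral_mono_on (by linarith)
          (Continuous.intervalIntegrable (by fun_prop) _ _) (hc.intervalIntegrable _ _) ?_
        intro v _
        rw [Real.exp_neg]
        gcongr
        linarith [Real.add_one_le_exp (v ^ 2)]
    _ ≤ Real.pi := by
        rw [integral_inv_one_add_sq]
        have := Real.arctan_lt_pi_div_two V
        have := Real.neg_pi_div_two_lt_arctan (-V)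
        linarith

/-- Evaluation of a damped Poisson integral over a vertical segment, with a twist `e ^ (iωv)`, by
moving the segment to the right. -/
theorem norm_integral_gaussPoisson_sub_le {f : ℂ → ℂ} {z₀ : ℂ} {η D V ω BR BH : ℝ} (hη : 0 < η)
    (hD : η + 1 ≤ D) (hD3 : D ≤ 3) (hV : 1 ≤ V)
    (hf : ∀ x ∈ Icc 0 D, ∀ v ∈ Icc (-V) V, DifferentiableAt ℂ f (z₀ + ((x : ℂ) + (v : ℂ) * I)))
    (hR : ∀ v ∈ Icc (-V) V, ‖f (z₀ + ((D : ℂ) + v * I))‖ ≤ BR)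
    (hH : ∀ x ∈ Icc 0 D, ∀ v : ℝ, |v| = V → ‖f (z₀ + ((x : ℂ) + v * I))‖ ≤ BH) :
    ‖(∫ v : ℝ in (-V)..V, (gaussPoisson η v : ℂ) * exp (ω * v * I) * f (z₀ + v * I)) -
      2 * Real.pi * (exp (η ^ 2 + ω * η) * f (z₀ + η))‖ ≤
      2 * Real.pi * Real.exp 9 * Real.exp (ω * D) * BR +
        12 * Real.exp (9 - V ^ 2) * Real.exp (|ω| * D) * BH := by
  have hV0 : 0 < V := by linarith
  have hD0 : 0 < D := by linarith
  have hBR : 0 ≤ BR := (norm_nonneg _).trans (hR 0 ⟨by linarith, by linarith⟩)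
  have hBH : 0 ≤ BH := (norm_nonneg _).trans (hH 0 ⟨le_rfl, hD0.le⟩ V (abs_of_pos hV0))
  -- On the imaginary axis `F u / (u - η)` is minus the twisted integrand, because `(iv + η)(iv - η)
  -- = -(v² + η²)`. The only pole in the rectangle is `η`, and there `F η = exp (η² + ωη) f (z₀ +
  -- η)`.
  set F : ℂ → ℂ := fun u => 2 * η * exp (u ^ 2 + ω * u) * f (z₀ + u) / (u + η) with hF
  have hne : ∀ x : ℝ, 0 ≤ x → ∀ v : ℝ, (x : ℂ) + v * I + η ≠ 0 := by
    intro x hx v h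
    have := congrArg re h
    simp at this
    linarith
  have hnorm : ∀ x ∈ Icc 0 D, ∀ v : ℝ, ‖F (x + v * I) / ((x : ℂ) + v * I - η)‖ =
      2 * η * (Real.exp (x ^ 2 - v ^ 2 + ω * x) * ‖f (z₀ + ((x : ℂ) + v * I))‖) /
        (‖(x : ℂ) + v * I + η‖ * ‖(x : ℂ) + v * I - η‖) := by
    intro x hx v
    have e : (((x : ℂ) + v * I) ^ 2 + ω * ((x : ℂ) + v * I)).re = x ^ 2 - v ^ 2 + ω * x := by
      simp [pow_two]
    rw [hF]
    simp only [norm_div, norm_mul, norm_exp, e, norm_real, Real.norm_eq_abs, abs_of_pos hη]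
    rw [div_div]
    norm_num
    ring
  have hlow : ∀ x : ℝ, 0 ≤ x → ∀ v : ℝ, x + η ≤ ‖(x : ℂ) + v * I + η‖ := by
    intro x hx v
    have := re_le_norm ((x : ℂ) + v * I + η)
    simpa using this
  have key := norm_integral_left_add_sub_integral_right_le (F := F) (a := 0) (b := D) (p := η)
    (V := V) (E := 2 * Real.exp (9 - V ^ 2) * Real.exp (|ω| * D) * BH) hη (by linarith) hV0 (by
      intro x hx v hv
      have h1 := hf x hx v hv
      have h2 := hne x hx.1 v
      have h3 : DifferentiableAt ℂ (fun u => f (z₀ + u)) ((x : ℂ) + v * I) :=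
        DifferentiableAt.comp (f := fun u => z₀ + u) _ h1 (by fun_prop)
      have h4 : DifferentiableAt ℂ (fun u : ℂ => 2 * η * exp (u ^ 2 + ω * u)) ((x : ℂ) + v * I) := by
        fun_prop
      exact (h4.mul h3).div (by fun_prop) h2) (by
      intro x hx v hv
      rw [hnorm x hx v]
      have h1 := hlow x hx.1 v
      have h2 : 1 ≤ ‖(x : ℂ) + v * I - η‖ := by
        have := abs_im_le_norm ((x : ℂ) + v * I - η)
        simp at this
        linarith
      have h3 : Real.exp (x ^ 2 - v ^ 2 + ω * x) ≤ Real.exp (9 - V ^ 2) * Real.exp (|ω| * D) := by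
        rw [← Real.exp_add]
        apply Real.exp_le_exp.mpr
        have hv2 : v ^ 2 = V ^ 2 := by rw [← sq_abs, hv]
        have h5 : ω * x ≤ |ω| * D := by
          calc ω * x ≤ |ω| * x := mul_le_mul_of_nonneg_right (le_abs_self _) hx.1
            _ ≤ |ω| * D := mul_le_mul_of_nonneg_left hx.2 (abs_nonneg _)
        nlinarith [hx.1, hx.2]
      have h4 := hH x hx v hv
      have hden : η ≤ ‖(x : ℂ) + v * I + η‖ * ‖(x : ℂ) + v * I - η‖ := by
        nlinarith [hx.1]
      calc _ ≤ 2 * η * (Real.exp (9 - V ^ 2) * Real.exp (|ω| * D) * BH) / η := by gcongr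
        _ = _ := by field_simp)
  have e1 : (∫ v : ℝ in (-V)..V, F ((0 : ℝ) + v * I) / (((0 : ℝ) : ℂ) + v * I - η)) =
      -∫ v : ℝ in (-V)..V, (gaussPoisson η v : ℂ) * exp (ω * v * I) * f (z₀ + v * I) := by
    rw [← intervalIntegral.integral_neg]
    refine intervalIntegral.integral_congr fun v _ => ?_
    have h1 : ((v : ℂ) ^ 2 + η ^ 2) ≠ 0 := by
      have : v ^ 2 + η ^ 2 ≠ 0 := by positivity
      exact_mod_cast this
    have h2 : (v : ℂ) * I + η ≠ 0 := by simpa using hne 0 le_rfl v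
    have h3 : (v : ℂ) * I - η ≠ 0 := by
      intro h
      have := congrArg re h
      simp at this
      linarith
    have h4 : ((v : ℂ) * I + η) * ((v : ℂ) * I - η) = -((v : ℂ) ^ 2 + η ^ 2) := by
      ring_nf; rw [I_sq]; ring
    simp only [hF, gaussPoisson]
    push_cast
    rw [zero_add, div_div, h4, show ((v : ℂ) * I) ^ 2 + ω * (v * I) = -(v : ℂ) ^ 2 + ω * v * I by
      rw [mul_pow, I_sq]; ring, exp_add, div_neg]
    ring
  have e2 : F η = exp (η ^ 2 + ω * η) * f (z₀ + η) := by
    have : (η : ℂ) ≠ 0 := by exact_mod_cast hη.ne'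
    simp only [hF]
    field_simp
    ring
  rw [e1, e2] at key
  set J := ∫ v : ℝ in (-V)..V, (gaussPoisson η v : ℂ) * exp (ω * v * I) * f (z₀ + v * I)
  set VR := ∫ v : ℝ in (-V)..V, F (D + v * I) / ((D : ℂ) + v * I - η) with hVR
  have hVRb : ‖VR‖ ≤ 2 * Real.pi * Real.exp 9 * Real.exp (ω * D) * BR := by
    have h1 : ‖VR‖ ≤ ∫ v in (-V)..V, 2 * Real.exp 9 * Real.exp (ω * D) * BR * Real.exp (-v ^ 2) := by
      refine intervalIntegral.norm_integral_le_of_norm_le (by linarith) ?_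
        (Continuous.intervalIntegrable (by fun_prop) _ _)
      refine Eventually.of_forall fun v hv => ?_
      rw [hnorm D ⟨hD0.le, le_rfl⟩ v]
      have h1 := hlow D hD0.le v
      have h2 : 1 ≤ ‖(D : ℂ) + v * I - η‖ := by
        have := re_le_norm ((D : ℂ) + v * I - η)
        simp at this
        linarith
      have h4 := hR v (Ioc_subset_Icc_self hv)
      have hden : η ≤ ‖(D : ℂ) + v * I + η‖ * ‖(D : ℂ) + v * I - η‖ := by
        nlinarith
      have h3 : Real.exp (D ^ 2 - v ^ 2 + ω * D) ≤
          Real.exp 9 * Real.exp (ω * D) * Real.exp (-v ^ 2) := by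
        rw [← Real.exp_add, ← Real.exp_add]
        apply Real.exp_le_exp.mpr
        nlinarith
      calc _ ≤ 2 * η * (Real.exp 9 * Real.exp (ω * D) * Real.exp (-v ^ 2) * BR) / η := by gcongr
        _ = _ := by field_simp
    rw [intervalIntegral.integral_const_mul] at h1
    refine h1.trans ?_
    calc _ ≤ 2 * Real.exp 9 * Real.exp (ω * D) * BR * Real.pi := by
          gcongr
          exact integral_exp_neg_sq_le hV0.le
      _ = _ := by ring
  have e3 : J - 2 * Real.pi * (exp (η ^ 2 + ω * η) * f (z₀ + η)) =
      -(-J + 2 * Real.pi * (exp (η ^ 2 + ω * η) * f (z₀ + η)) - VR) - VR := by ring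
  rw [e3]
  refine (norm_sub_le _ _).trans ?_
  rw [norm_neg]
  have : 2 * (D - 0) * (2 * Real.exp (9 - V ^ 2) * Real.exp (|ω| * D) * BH) ≤
      12 * Real.exp (9 - V ^ 2) * Real.exp (|ω| * D) * BH := by
    have : 0 ≤ Real.exp (9 - V ^ 2) * Real.exp (|ω| * D) * BH := by positivity
    nlinarith
  linarith

theorem conj_intervalIntegral_of_le {f : ℝ → ℂ} {a b : ℝ} (hab : a ≤ b) :
    (starRingEnd ℂ) (∫ v in a..b, f v) = ∫ v in a..b, (starRingEnd ℂ) (f v) := by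
  rw [intervalIntegral.integral_of_le hab, intervalIntegral.integral_of_le hab, integral_conj]

/-- For functions with nonnegative real part, the negative frequencies and the mean value control
the positive frequencies. -/
theorem norm_integral_twist_le {p : ℝ → ℝ} {g : ℝ → ℂ} {V ω : ℝ} (hV : 0 ≤ V)
    (hp : Continuous p) (hp0 : ∀ v, 0 ≤ p v) (hg : ContinuousOn g (Icc (-V) V))
    (hg0 : ∀ v ∈ Icc (-V) V, 0 ≤ (g v).re) :
    ‖∫ v : ℝ in (-V)..V, (p v : ℂ) * exp (ω * v * I) * g v‖ ≤
      ‖∫ v : ℝ in (-V)..V, (p v : ℂ) * exp ((-ω : ℝ) * v * I) * g v‖ +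
      2 * ‖∫ v : ℝ in (-V)..V, (p v : ℂ) * exp ((0 : ℝ) * v * I) * g v‖ := by
  have huI : uIcc (-V) V = Icc (-V) V := uIcc_of_le (by linarith)
  have hint : ∀ ω : ℝ, IntervalIntegrable (fun v : ℝ => (p v : ℂ) * exp (ω * v * I) * g v)
      volume (-V) V := by
    intro ω
    apply ContinuousOn.intervalIntegrable
    rw [huI]
    exact ContinuousOn.mul (by fun_prop) hg
  have hconj : (starRingEnd ℂ) (∫ v : ℝ in (-V)..V, (p v : ℂ) * exp ((-ω : ℝ) * v * I) * g v) =
      ∫ v : ℝ in (-V)..V, (p v : ℂ) * exp (ω * v * I) * (starRingEnd ℂ) (g v) := by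
    have h := conj_intervalIntegral_of_le (f := fun v : ℝ => (p v : ℂ) * exp ((-ω : ℝ) * v * I) * g v)
      (show -V ≤ V by linarith)
    rw [h]
    refine intervalIntegral.integral_congr fun v _ => ?_
    simp only [map_mul, conj_ofReal, ← exp_conj, conj_I]
    congr 3
    push_cast; ring
  have hint' : IntervalIntegrable
      (fun v : ℝ => (p v : ℂ) * exp (ω * v * I) * (starRingEnd ℂ) (g v)) volume (-V) V := by
    apply ContinuousOn.intervalIntegrable
    rw [huI]
    exact ContinuousOn.mul (by fun_prop) (continuous_conj.comp_continuousOn hg)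
  -- Adding the conjugate of the integral at `-ω` replaces `g` by `2 Re g ≥ 0`. The modulus is then
  -- largest without the twist, that is, at frequency zero.
  have hsum : (∫ v : ℝ in (-V)..V, (p v : ℂ) * exp (ω * v * I) * g v) +
      (starRingEnd ℂ) (∫ v : ℝ in (-V)..V, (p v : ℂ) * exp ((-ω : ℝ) * v * I) * g v) =
      ∫ v : ℝ in (-V)..V, (p v : ℂ) * exp (ω * v * I) * ((2 * (g v).re : ℝ) : ℂ) := by
    rw [hconj, ← intervalIntegral.integral_add (hint ω) hint']
    refine intervalIntegral.integral_congr fun v _ => ?_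
    rw [← mul_add, add_conj]
  have hre : (∫ v : ℝ in (-V)..V, (p v : ℂ) * exp ((0 : ℝ) * v * I) * g v).re =
      ∫ v : ℝ in (-V)..V, p v * (g v).re := by
    have h1 := (reCLM.intervalIntegral_comp_comm (hint 0))
    simp only [reCLM_apply] at h1
    rw [← h1]
    refine intervalIntegral.integral_congr fun v _ => ?_
    simp
  have hb : ‖∫ v : ℝ in (-V)..V, (p v : ℂ) * exp (ω * v * I) * ((2 * (g v).re : ℝ) : ℂ)‖ ≤
      2 * ∫ v : ℝ in (-V)..V, p v * (g v).re := by
    rw [← intervalIntegral.integral_const_mul]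
    refine intervalIntegral.norm_integral_le_of_norm_le (by linarith) ?_ ?_
    · refine Eventually.of_forall fun v hv => ?_
      have h0 := hg0 v (Ioc_subset_Icc_self hv)
      have h1 : ‖exp ((ω : ℂ) * v * I)‖ = 1 := by
        have := norm_exp_ofReal_mul_I (ω * v)
        push_cast at this
        exact this
      rw [norm_mul, norm_mul, h1, norm_real, norm_real, Real.norm_eq_abs, Real.norm_eq_abs,
        abs_of_nonneg (hp0 v), abs_of_nonneg (by positivity)]
      linarith
    · apply ContinuousOn.intervalIntegrable
      rw [huI]
      exact continuousOn_const.mul (hp.continuousOn.mul (continuous_re.comp_continuousOn hg))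
  have e : (∫ v : ℝ in (-V)..V, (p v : ℂ) * exp (ω * v * I) * g v) =
      (∫ v : ℝ in (-V)..V, (p v : ℂ) * exp (ω * v * I) * ((2 * (g v).re : ℝ) : ℂ)) -
      (starRingEnd ℂ) (∫ v : ℝ in (-V)..V, (p v : ℂ) * exp ((-ω : ℝ) * v * I) * g v) := by
    rw [← hsum]; ring
  rw [e]
  refine (norm_sub_le _ _).trans ?_
  rw [norm_conj]
  have := re_le_norm (∫ v : ℝ in (-V)..V, (p v : ℂ) * exp ((0 : ℝ) * v * I) * g v)
  rw [hre] at this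
  linarith
-- The explicit formula without zeros and Littlewood's bound.
theorem eventually_exp_neg_sq_mul_log_pow_le (C : ℝ) (k : ℕ) {c : ℝ} (hc : 0 < c) :
    ∀ᶠ t : ℝ in atTop, C * Real.exp (-(t / 2) ^ 2) * Real.log t ^ k ≤ c := by
  have h1 := (Real.tendsto_pow_mul_exp_neg_atTop_nhds_zero k).const_mul |C|
  rw [mul_zero] at h1
  filter_upwards [h1.eventually (gt_mem_nhds hc), eventually_ge_atTop 4] with t ht ht4
  have h2 : Real.exp (-(t / 2) ^ 2) ≤ Real.exp (-t) := Real.exp_le_exp.mpr (by nlinarith)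
  have h3 : Real.log t ^ k ≤ t ^ k :=
    pow_le_pow_left₀ (Real.log_nonneg (by linarith)) (Real.log_le_self (by linarith)) k
  have h0 : 0 ≤ Real.log t ^ k := pow_nonneg (Real.log_nonneg (by linarith)) k
  calc C * Real.exp (-(t / 2) ^ 2) * Real.log t ^ k
      ≤ |C| * Real.exp (-t) * t ^ k := by
        gcongr
        exact le_abs_self C
    _ ≤ c := by linarith

/-- A quantitative explicit formula without zeros: if `Re f ≥ -c` on a vertical segment, then
`f + P` at distance `η` to the right of the segment is controlled, with a gain `e ^ (-ωη)`, by `f`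
itself, by `P` on the segment, and by `f` and `f + P` far to the right. -/
theorem exp_mul_norm_add_le {f P : ℂ → ℂ} {z₀ : ℂ} {η D V ω c B₁ B₂ B₃ B₄ : ℝ} (hη : 0 < η)
    (hD : η + 1 ≤ D) (hD3 : D ≤ 3) (hV : 1 ≤ V) (hω : 0 < ω) (hc : 0 ≤ c)
    (hf : ∀ x ∈ Icc 0 D, ∀ v ∈ Icc (-V) V, DifferentiableAt ℂ f (z₀ + ((x : ℂ) + (v : ℂ) * I)))
    (hP : Differentiable ℂ P)
    (hre : ∀ v ∈ Icc (-V) V, -c ≤ (f (z₀ + v * I)).re)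
    (h₁ : ∀ v ∈ Icc (-V) V, ‖f (z₀ + ((D : ℂ) + v * I)) + P (z₀ + ((D : ℂ) + v * I))‖ ≤ B₁)
    (h₂ : ∀ v ∈ Icc (-V) V, ‖f (z₀ + ((D : ℂ) + v * I))‖ ≤ B₂)
    (h₃ : ∀ x ∈ Icc 0 D, ∀ v : ℝ, |v| = V → ‖f (z₀ + ((x : ℂ) + v * I))‖ ≤ B₃)
    (h₄ : ∀ x ∈ Icc 0 D, ∀ v ∈ Icc (-V) V, ‖P (z₀ + ((x : ℂ) + v * I))‖ ≤ B₄)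
    (hsmall : 12 * Real.exp (9 - V ^ 2) * Real.exp (ω * D) * (B₃ + B₄ + c) ≤ 1) :
    Real.exp (ω * η) * ‖f (z₀ + η) + P (z₀ + η)‖ ≤
      2 * Real.pi * Real.exp 9 * Real.exp (ω * D) * B₁ + 2 * Real.pi * (B₄ + c) +
      3 * (2 * Real.pi * Real.exp 9 * (B₂ + c)) + 4 + 3 * (‖f (z₀ + η)‖ + c) := by
  have hD0 : 0 < D := by linarith
  have hV0 : 0 < V := by linarith
  have hB₁ : 0 ≤ B₁ := (norm_nonneg _).trans (h₁ 0 ⟨by linarith, by linarith⟩)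
  have hB₂ : 0 ≤ B₂ := (norm_nonneg _).trans (h₂ 0 ⟨by linarith, by linarith⟩)
  have hB₃ : 0 ≤ B₃ := (norm_nonneg _).trans (h₃ 0 ⟨le_rfl, hD0.le⟩ V (abs_of_pos hV0))
  have hB₄ : 0 ≤ B₄ := (norm_nonneg _).trans (h₄ 0 ⟨le_rfl, hD0.le⟩ 0 ⟨by linarith, by linarith⟩)
  have hVI : ∀ v : ℝ, |v| = V → v ∈ Icc (-V) V := fun v hv => abs_le.mp hv.le
  have htiny : ∀ w B : ℝ, |w| ≤ ω → B ≤ B₃ + B₄ + c → 0 ≤ B →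
      12 * Real.exp (9 - V ^ 2) * Real.exp (|w| * D) * B ≤ 1 := by
    intro w B hw hB hB0
    refine le_trans ?_ hsmall
    gcongr
  -- At the positive frequency only `f + P` can be moved to the right edge, where its size `B₁`
  -- offsets the growth `exp (ω D)`.
  have hR := norm_integral_gaussPoisson_sub_le (f := fun s => f s + P s) (z₀ := z₀) (ω := ω)
    (BR := B₁) (BH := B₃ + B₄) hη hD hD3 hV
    (fun x hx v hv => (hf x hx v hv).add (hP _)) h₁
    (fun x hx v hv => (norm_add_le _ _).trans (add_le_add (h₃ x hx v hv) (h₄ x hx v (hVI v hv))))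
  have hR2 := htiny ω (B₃ + B₄) (abs_of_pos hω).le (by linarith) (by positivity)
  -- The shift by `c` makes the real part nonnegative on the segment, as `norm_integral_twist_le`
  -- requires.
  set L₁ : ℂ → ℂ := fun s => f s + c with hL₁
  have hL₁diff : ∀ x ∈ Icc 0 D, ∀ v ∈ Icc (-V) V,
      DifferentiableAt ℂ L₁ (z₀ + ((x : ℂ) + (v : ℂ) * I)) := fun x hx v hv =>
    (hf x hx v hv).add_const _
  have hcn : ‖(c : ℂ)‖ = c := by rw [norm_real, Real.norm_eq_abs, abs_of_nonneg hc]
  -- At nonpositive frequency the twist is at most one on the right edge, so `f` may be moved there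
  -- without subtracting a Dirichlet polynomial.
  have hL₁w : ∀ w : ℝ, |w| ≤ ω → w ≤ 0 →
      ‖(∫ v : ℝ in (-V)..V, (gaussPoisson η v : ℂ) * exp (w * v * I) * L₁ (z₀ + v * I)) -
      2 * Real.pi * (exp (η ^ 2 + w * η) * L₁ (z₀ + η))‖ ≤
        2 * Real.pi * Real.exp 9 * (B₂ + c) + 1 := by
    intro w hw hw0
    have h := norm_integral_gaussPoisson_sub_le
      (f := L₁) (z₀ := z₀) (ω := w) (BR := B₂ + c) (BH := B₃ + c) hη hD hD3 hV
      hL₁diff (fun v hv => (norm_add_le _ _).trans (add_le_add (h₂ v hv) hcn.le))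
      (fun x hx v hv => (norm_add_le _ _).trans (add_le_add (h₃ x hx v hv) hcn.le))
    refine h.trans ?_
    have h1 := htiny w (B₃ + c) hw (by linarith) (by positivity)
    have h2 : Real.exp (w * D) ≤ 1 :=
      Real.exp_le_one_iff.mpr (mul_nonpos_of_nonpos_of_nonneg hw0 hD0.le)
    have h3 : 2 * Real.pi * Real.exp 9 * Real.exp (w * D) * (B₂ + c) ≤
        2 * Real.pi * Real.exp 9 * 1 * (B₂ + c) := by gcongr
    linarith
  have hcontL : ∀ g : ℂ → ℂ, (∀ x ∈ Icc 0 D, ∀ v ∈ Icc (-V) V,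
      DifferentiableAt ℂ g (z₀ + ((x : ℂ) + (v : ℂ) * I))) →
      ContinuousOn (fun v : ℝ => g (z₀ + v * I)) (Icc (-V) V) := by
    intro g hg v hv
    have h := (hg 0 ⟨le_rfl, hD0.le⟩ v hv).continuousAt
    rw [ofReal_zero, zero_add] at h
    exact (ContinuousAt.comp (f := fun v : ℝ => z₀ + v * I) h (by fun_prop)).continuousWithinAt
  have htw := norm_integral_twist_le (p := gaussPoisson η) (g := fun v => L₁ (z₀ + v * I))
    (V := V) (ω := ω) (by linarith) (continuous_gaussPoisson hη) (gaussPoisson_nonneg hη)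
    (hcontL L₁ hL₁diff) (by
      intro v hv
      have h := hre v hv
      simp only [hL₁, add_re, ofReal_re]
      linarith)
  have hp := continuous_gaussPoisson hη
  have hint : ∀ g : ℝ → ℂ, ContinuousOn g (Icc (-V) V) →
      IntervalIntegrable (fun v : ℝ => (gaussPoisson η v : ℂ) * exp (ω * v * I) * g v)
      volume (-V) V := by
    intro g hg
    apply ContinuousOn.intervalIntegrable
    rw [uIcc_of_le (by linarith)]
    exact ContinuousOn.mul (by fun_prop) hg
  have hPc : ‖∫ v : ℝ in (-V)..V, (gaussPoisson η v : ℂ) * exp (ω * v * I) *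
        (P (z₀ + v * I) - c)‖ ≤ 2 * Real.pi * (B₄ + c) := by
    have h1 := intervalIntegral.norm_integral_le_of_norm_le (a := -V) (b := V) (μ := volume)
      (f := fun v : ℝ => (gaussPoisson η v : ℂ) * exp (ω * v * I) * (P (z₀ + v * I) - c))
      (g := fun v => gaussPoisson η v * (B₄ + c)) (by linarith)
      (Eventually.of_forall fun v hv => by
        have h1 : ‖exp ((ω : ℂ) * v * I)‖ = 1 := by
          have := norm_exp_ofReal_mul_I (ω * v)
          push_cast at this
          exact this
        rw [norm_mul, norm_mul, h1, norm_real, Real.norm_eq_abs,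
          abs_of_nonneg (gaussPoisson_nonneg hη v), mul_one]
        have h2 := h₄ 0 ⟨le_rfl, hD0.le⟩ v (Ioc_subset_Icc_self hv)
        rw [ofReal_zero, zero_add] at h2
        exact mul_le_mul_of_nonneg_left ((norm_sub_le _ _).trans (add_le_add h2 hcn.le))
          (gaussPoisson_nonneg hη v))
      ((hp.mul continuous_const).intervalIntegrable _ _)
    rw [intervalIntegral.integral_mul_const] at h1
    exact h1.trans (mul_le_mul_of_nonneg_right (integral_gaussPoisson_le hη (by linarith))
      (by positivity))
  have hsplit : (∫ v : ℝ in (-V)..V, (gaussPoisson η v : ℂ) * exp (ω * v * I) *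
        (f (z₀ + v * I) + P (z₀ + v * I))) =
      (∫ v : ℝ in (-V)..V, (gaussPoisson η v : ℂ) * exp (ω * v * I) * L₁ (z₀ + v * I)) +
      (∫ v : ℝ in (-V)..V, (gaussPoisson η v : ℂ) * exp (ω * v * I) * (P (z₀ + v * I) - c)) := by
    rw [← intervalIntegral.integral_add (hint _ (hcontL L₁ hL₁diff))
      (hint _ (hcontL (fun s => P s - c) fun x _ v _ => (hP _).sub_const _))]
    refine intervalIntegral.integral_congr fun v _ => ?_
    simp only [hL₁]
    ring
  have hneg := hL₁w (-ω) (by rw [abs_neg, abs_of_pos hω]) (by linarith)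
  have hzero := hL₁w 0 (by simpa using hω.le) le_rfl
  have e4 := norm_add_le
    (∫ v : ℝ in (-V)..V, (gaussPoisson η v : ℂ) * exp (ω * v * I) * L₁ (z₀ + v * I))
    (∫ v : ℝ in (-V)..V, (gaussPoisson η v : ℂ) * exp (ω * v * I) * (P (z₀ + v * I) - c))
  rw [← hsplit] at e4
  clear hsplit hint hcontL hL₁w hL₁diff htiny
  generalize (∫ v : ℝ in (-V)..V, (gaussPoisson η v : ℂ) * exp (ω * v * I) *
        (f (z₀ + v * I) + P (z₀ + v * I))) = J at *
  generalize (∫ v : ℝ in (-V)..V, (gaussPoisson η v : ℂ) * exp (ω * v * I) * L₁ (z₀ + v * I)) = Jp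
    at *
  generalize (∫ v : ℝ in (-V)..V, (gaussPoisson η v : ℂ) * exp ((-ω : ℝ) * v * I) *
    L₁ (z₀ + v * I)) = Jn at *
  generalize (∫ v : ℝ in (-V)..V, (gaussPoisson η v : ℂ) * exp ((0 : ℝ) * v * I) *
    L₁ (z₀ + v * I)) = J0 at *
  generalize (∫ v : ℝ in (-V)..V, (gaussPoisson η v : ℂ) * exp (ω * v * I) *
    (P (z₀ + v * I) - c)) = JP at *
  have hE1 : 1 ≤ Real.exp (η ^ 2) := Real.one_le_exp (sq_nonneg η)
  have hnormexp : ∀ (w : ℝ) (z : ℂ), ‖2 * (Real.pi : ℂ) * (exp (η ^ 2 + w * η) * z)‖ =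
      2 * Real.pi * (Real.exp (η ^ 2) * Real.exp (w * η) * ‖z‖) := by
    intro w z
    have : ((η : ℂ) ^ 2 + w * η).re = η ^ 2 + w * η := by
      rw [add_re, ← ofReal_pow, ← ofReal_mul, ofReal_re, ofReal_re]
    rw [norm_mul, norm_mul, norm_mul, norm_exp, norm_real, Real.norm_eq_abs, abs_of_pos Real.pi_pos,
      this, Real.exp_add, Complex.norm_ofNat]
  have e1 := norm_sub_norm_le (2 * (Real.pi : ℂ) * (exp (η ^ 2 + ω * η) *
    (f (z₀ + η) + P (z₀ + η)))) J
  rw [norm_sub_rev, hnormexp] at e1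
  have e2 := norm_le_norm_sub_add Jn
    (2 * (Real.pi : ℂ) * (exp (η ^ 2 + (-ω : ℝ) * η) * L₁ (z₀ + η)))
  rw [hnormexp] at e2
  have e3 := norm_le_norm_sub_add J0
    (2 * (Real.pi : ℂ) * (exp (η ^ 2 + (0 : ℝ) * η) * L₁ (z₀ + η)))
  rw [hnormexp, zero_mul, Real.exp_zero, mul_one] at e3
  have e5 : Real.exp (-ω * η) ≤ 1 := Real.exp_le_one_iff.mpr (by
    rw [neg_mul]; exact neg_nonpos.mpr (mul_pos hω hη).le)
  have hL₁n : ‖L₁ (z₀ + η)‖ ≤ ‖f (z₀ + η)‖ + c := (norm_add_le _ _).trans (by rw [hcn])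
  have hLpos : 0 ≤ ‖L₁ (z₀ + η)‖ := norm_nonneg _
  generalize ‖f (z₀ + η) + P (z₀ + η)‖ = r at *
  generalize ‖L₁ (z₀ + η)‖ = l at *
  generalize Real.exp (η ^ 2) = E at *
  have e6 : 2 * Real.pi * (E * Real.exp (-ω * η) * l) ≤ 2 * Real.pi * (E * 1 * l) := by
    gcongr
  have h2π : 1 ≤ 2 * Real.pi := by linarith [Real.pi_gt_three]
  have h2πE : 1 ≤ 2 * Real.pi * E := one_le_mul_of_one_le_of_one_le h2π hE1
  set B := 2 * Real.pi * Real.exp 9 * Real.exp (ω * D) * B₁ + 2 * Real.pi * (B₄ + c) +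
      3 * (2 * Real.pi * Real.exp 9 * (B₂ + c)) + 4 with hB
  have hB0 : 0 ≤ B := by positivity
  have h1 : 2 * Real.pi * E * (Real.exp (ω * η) * r) ≤ 2 * Real.pi * E * (B + 3 * l) := by
    have h2 : B ≤ 2 * Real.pi * E * B := le_mul_of_one_le_left hB0 h2πE
    linarith
  have h3 := le_of_mul_le_mul_left h1 (by positivity)
  linarith

set_option maxHeartbeats 1000000 in
/-- **Littlewood's bound**: under the Riemann hypothesis, `ζ'/ζ(σ + it) ≪ (log t) ^ (2 - 2θ)` for
all `θ ≤ σ`, uniformly for `σ ≥ 1/2 + 3 / log log t`. -/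
theorem RiemannHypothesis.norm_logDeriv_riemannZeta_le (hRH : RiemannHypothesis) :
    ∃ C : ℝ, 0 < C ∧ ∃ t₀ : ℝ, ∀ t : ℝ, t₀ ≤ t → ∀ σ θ : ℝ,
      1 / 2 + 3 / Real.log (Real.log t) ≤ σ → σ ≤ 2 → 0 ≤ θ → θ < 1 → θ ≤ σ →
      ‖logDeriv riemannZeta (σ + t * I)‖ ≤ C / (1 - θ) * Real.log t ^ (2 - 2 * θ) := by
  obtain ⟨C₁, hC₁, hbd⟩ := hRH.logDeriv_riemannZeta_bounds
  obtain ⟨C₂, hC₂, hright⟩ := norm_logDeriv_riemannZeta_le_two_rpow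
  set A : ℝ := 2 * Real.pi * Real.exp 9 with hA
  have hA0 : 0 < A := by positivity
  set C₃ : ℝ := A * 48 + 2 * Real.pi * (12 + 2 * C₁) + 3 * (A * C₂ + A * (2 * C₁)) + 4 +
    3 * (2 * C₁)
    with hC₃
  have hC₃0 : 0 < C₃ := by positivity
  have hev1 := eventually_exp_neg_sq_mul_log_pow_le (12 * Real.exp 9 * (2 * C₁ + 2 * C₁ + 12)) 8
    one_pos
  have hevl : ∀ᶠ t : ℝ in atTop, 6 ≤ Real.log (Real.log t) :=
    (Real.tendsto_log_atTop.comp Real.tendsto_log_atTop).eventually_ge_atTop 6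
  obtain ⟨t₀, ht₀⟩ := eventually_atTop.mp (hev1.and (hevl.and (eventually_ge_atTop 6)))
  refine ⟨2 * C₃ * Real.exp 2 + 12, by positivity, t₀, ?_⟩
  intro t ht σ θ hσ hσ2 hθ0 hθ1 hθσ
  obtain ⟨hsmall, hl6, ht6⟩ := ht₀ t ht
  set ℓ := Real.log (Real.log t) with hℓ
  set Lg := Real.log t with hLg
  have hLg1 : 1 < Lg := by
    by_contra h
    push Not at h
    have h0 : 0 ≤ Lg := Real.log_nonneg (by linarith)
    have := Real.log_nonpos h0 h
    linarith
  have hLgpos : 0 < Lg := by linarith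
  have hLe : Lg = Real.exp ℓ := (Real.exp_log hLgpos).symm
  have hℓL : ℓ + 1 ≤ Lg := by rw [hLe]; exact Real.add_one_le_exp ℓ
  have hℓ0 : 0 < ℓ := by linarith
  -- The segment lies `1 / ℓ` to the right of the critical line, where `ζ'/ζ` is at most of order
  -- `Lg * ℓ`. The point `σ` is at least `2 / ℓ` further to the right.
  set a : ℝ := 1 / 2 + 1 / ℓ with ha
  have hinv : 0 < 1 / ℓ := by positivity
  have hinv6 : 1 / ℓ ≤ 1 / 6 := one_div_le_one_div_of_le (by norm_num) hl6
  have h3ℓ : 3 / ℓ = 3 * (1 / ℓ) := by ring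
  set η : ℝ := σ - a with hη
  have hη2 : 2 / ℓ ≤ η := by
    have : 2 / ℓ = 2 * (1 / ℓ) := by ring
    rw [hη, ha]; linarith
  have hη0 : 0 < η := lt_of_lt_of_le (by positivity) hη2
  set D : ℝ := 3 - a with hD
  have hD1 : η + 1 ≤ D := by rw [hη, hD]; linarith
  have hD3 : D ≤ 3 := by rw [hD, ha]; linarith
  have hD0 : 0 < D := by linarith
  set V : ℝ := t / 2 with hV
  have hV1 : 1 ≤ V := by rw [hV]; linarith
  set z₀ : ℂ := a + t * I with hz₀
  -- This length makes the polynomial `O(Lg)` on `Re s ≥ 1/2`, the size of the lower bound for `Re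
  -- ζ'/ζ`.
  set N : ℕ := ⌊Lg ^ 2⌋₊ with hN
  have hLg2 : 2 ≤ Lg ^ 2 := by
    have := pow_le_pow_left₀ (by norm_num) (show (7 : ℝ) ≤ Lg by linarith) 2
    linarith
  have hNle : (N : ℝ) ≤ Lg ^ 2 := Nat.floor_le (by positivity)
  have hNge : Lg ^ 2 / 2 ≤ N := by
    have := Nat.lt_floor_add_one (Lg ^ 2)
    rw [← hN] at this
    linarith
  have hN1 : 1 ≤ N := by
    have : (1 : ℝ) ≤ N := by linarith
    exact_mod_cast this
  have hpt : ∀ x v : ℝ, z₀ + ((x : ℂ) + v * I) = ((a + x : ℝ) : ℂ) + ((t + v : ℝ) : ℂ) * I := by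
    intro x v; rw [hz₀]; push_cast; ring
  have hheight : ∀ v ∈ Icc (-V) V, 3 ≤ t + v ∧ Real.log (t + v) ≤ 2 * Lg := by
    intro v hv
    have h1 : t + v ≤ t ^ 2 := by
      have := mul_le_mul_of_nonneg_right ht6 (show 0 ≤ t by linarith)
      rw [hV] at hv
      rw [pow_two]
      linarith [hv.2]
    have h2 : 3 ≤ t + v := by rw [hV] at hv; linarith [hv.1]
    refine ⟨h2, ?_⟩
    have := Real.log_le_log (by linarith) h1
    rwa [Real.log_pow] at this
  -- regularity and bounds for the logarithmic derivative
  have hLdiff : ∀ x ∈ Icc 0 D, ∀ v ∈ Icc (-V) V,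
      DifferentiableAt ℂ (logDeriv riemannZeta) (z₀ + ((x : ℂ) + (v : ℂ) * I)) := by
    intro x hx v hv
    rw [hpt]
    have him := (hheight v hv).1
    have hne : ((a + x : ℝ) : ℂ) + ((t + v : ℝ) : ℂ) * I ≠ 1 := by
      intro h
      have := congrArg im h
      simp at this
      linarith
    have h1 : AnalyticAt ℂ riemannZeta (((a + x : ℝ) : ℂ) + ((t + v : ℝ) : ℂ) * I) :=
      analyticOn_riemannZeta _ hne
    exact (h1.deriv.div h1 (hRH.riemannZeta_ne_zero (by
      simp; linarith [hx.1]))).differentiableAt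
  have hLb : ∀ x ∈ Icc 0 D, ∀ v ∈ Icc (-V) V,
      ‖logDeriv riemannZeta (z₀ + ((x : ℂ) + (v : ℂ) * I))‖ ≤ 2 * C₁ * Lg ^ 2 := by
    intro x hx v hv
    rw [hpt]
    obtain ⟨h3, hlog⟩ := hheight v hv
    refine (hbd (a + x) (t + v) (by linarith [hx.1]) (by linarith [hx.2]) h3).2.trans ?_
    have hl0 : 0 ≤ Real.log (t + v) := Real.log_nonneg (by linarith)
    calc C₁ * Real.log (t + v) / (a + x - 1 / 2) ≤ C₁ * (2 * Lg) / (1 / ℓ) := by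
          gcongr
          rw [ha]; linarith [hx.1]
      _ = 2 * C₁ * (Lg * ℓ) := by field_simp
      _ ≤ 2 * C₁ * Lg ^ 2 := by
          rw [pow_two]; gcongr; linarith
  have hLR : ∀ v : ℝ, ‖logDeriv riemannZeta (z₀ + ((D : ℂ) + (v : ℂ) * I))‖ ≤ C₂ := by
    intro v
    rw [hpt]
    have h1 : (((a + D : ℝ) : ℂ) + ((t + v : ℝ) : ℂ) * I).re = 3 := by simp [hD]
    refine (hright _ (by rw [h1]; norm_num)).trans ?_
    rw [h1]
    refine mul_le_of_le_one_right hC₂.le ?_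
    exact Real.rpow_le_one_of_one_le_of_nonpos (by norm_num) (by norm_num)
  -- bounds for the Dirichlet polynomial
  have hPb : ∀ s : ℂ, 1 / 2 ≤ s.re → ‖vonMangoldtSum N s‖ ≤ 12 * Lg := by
    intro s hs
    refine (norm_vonMangoldtSum_le (σ := 1 / 2) (by norm_num) (by norm_num) N hs).trans ?_
    have : (N : ℝ) ^ ((1 : ℝ) - 1 / 2) ≤ Lg := by
      calc (N : ℝ) ^ ((1 : ℝ) - 1 / 2) ≤ (Lg ^ 2) ^ ((1 : ℝ) - 1 / 2) := by gcongr
        _ = Lg := by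
          rw [show (1 : ℝ) - 1 / 2 = 1 / 2 by norm_num, ← Real.sqrt_eq_rpow, Real.sqrt_sq hLgpos.le]
    calc 6 * (N : ℝ) ^ ((1 : ℝ) - 1 / 2) / (1 - 1 / 2) = 12 * (N : ℝ) ^ ((1 : ℝ) - 1 / 2) := by ring
      _ ≤ _ := by gcongr
  have hre : ∀ x v : ℝ, (z₀ + ((x : ℂ) + v * I)).re = a + x := by
    intro x v; rw [hpt]; simp
  -- The frequency is the logarithm of the length `Lg ^ 2` of the polynomial.
  set ω : ℝ := 2 * ℓ with hω
  have hω0 : 0 < ω := by positivity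
  have hs : z₀ + η = σ + t * I := by rw [hz₀, hη]; push_cast; ring
  set s : ℂ := σ + t * I with hs_def
  have hLg2' : Lg ≤ Lg ^ 2 := by
    rw [pow_two]; exact le_mul_of_one_le_left hLgpos.le hLg1.le
  set c : ℝ := 2 * C₁ * Lg with hc
  have hc0 : 0 < c := by positivity
  have hcore := exp_mul_norm_add_le (f := logDeriv riemannZeta) (P := vonMangoldtSum N) (z₀ := z₀)
    (c := c) (B₁ := 48 * Real.exp (-(4 * ℓ))) (B₂ := C₂) (B₃ := 2 * C₁ * Lg ^ 2) (B₄ := 12 * Lg)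
    hη0 hD1 hD3 hV1 hω0 hc0.le hLdiff (differentiable_vonMangoldtSum N) (by
      intro v hv
      obtain ⟨h3, hlog⟩ := hheight v hv
      have h := (hbd a (t + v) (by linarith) (by linarith) h3).1
      have e : z₀ + v * I = (a : ℂ) + ((t + v : ℝ) : ℂ) * I := by rw [hz₀]; push_cast; ring
      rw [e]
      have : C₁ * Real.log (t + v) ≤ C₁ * (2 * Lg) := mul_le_mul_of_nonneg_left hlog hC₁.le
      rw [hc]; linarith) (by
      intro v _
      refine (norm_logDeriv_add_vonMangoldtSum_le hN1 (by rw [hre, hD]; ring)).trans ?_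
      calc 12 / (N : ℝ) ^ 2 ≤ 12 / (Lg ^ 2 / 2) ^ 2 := by gcongr
        _ = 48 * (Lg ^ 4)⁻¹ := by field_simp; norm_num
        _ = 48 * Real.exp (-(4 * ℓ)) := by
            rw [hLe, ← Real.exp_nat_mul, ← Real.exp_neg]; norm_num) (fun v _ => hLR v)
    (fun x hx v hv => hLb x hx v (abs_le.mp hv.le)) (by
      intro x hx v _
      exact hPb _ (by rw [hre]; linarith [hx.1])) (by
      have h1 : Real.exp (ω * D) ≤ Lg ^ 6 := by
        rw [hLe, ← Real.exp_nat_mul]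
        apply Real.exp_le_exp.mpr
        push_cast
        have := mul_le_mul_of_nonneg_left hD3 hω0.le
        rw [hω] at this ⊢
        linarith
      have h2 : 2 * C₁ * Lg ^ 2 + 12 * Lg + c ≤ (2 * C₁ + 2 * C₁ + 12) * Lg ^ 2 := by
        have := mul_le_mul_of_nonneg_left hLg2' (show 0 ≤ 2 * C₁ + 12 by positivity)
        rw [hc]; linarith
      calc 12 * Real.exp (9 - V ^ 2) * Real.exp (ω * D) * (2 * C₁ * Lg ^ 2 + 12 * Lg + c)
          ≤ 12 * Real.exp (9 - V ^ 2) * Lg ^ 6 * ((2 * C₁ + 2 * C₁ + 12) * Lg ^ 2) := by gcongr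
        _ = 12 * Real.exp 9 * (2 * C₁ + 2 * C₁ + 12) * Real.exp (-(t / 2) ^ 2) * Lg ^ 8 := by
            rw [sub_eq_add_neg, Real.exp_add]; ring
        _ ≤ 1 := hsmall)
  -- Here `ω D = 5ℓ - 2`, while the tail on `Re s = 3` is at most `48 Lg^(-4)`; one power of `Lg`
  -- remains.
  have hR1 : A * Real.exp (ω * D) * (48 * Real.exp (-(4 * ℓ))) ≤ A * 48 * Lg := by
    have : Real.exp (ω * D) * Real.exp (-(4 * ℓ)) ≤ Lg := by
      rw [← Real.exp_add, hLe]
      apply Real.exp_le_exp.mpr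
      have h1 : ℓ * (1 / ℓ) = 1 := by field_simp
      have h2 : ω * D = 5 * ℓ - 2 * (ℓ * (1 / ℓ)) := by rw [hω, hD, ha]; ring
      rw [h2, h1]
      linarith
    calc _ = A * 48 * (Real.exp (ω * D) * Real.exp (-(4 * ℓ))) := by ring
      _ ≤ _ := by gcongr
  rw [hs] at hcore
  set Rs : ℂ := logDeriv riemannZeta s + vonMangoldtSum N s with hRs
  clear hLdiff hLb hLR hPb hheight hpt hbd hright hev1 hevl ht₀ hsmall
  have hσre : s.re = σ := by simp [hs_def]
  have e17 : ‖logDeriv riemannZeta s‖ ≤ ‖Rs‖ + ‖vonMangoldtSum N s‖ := by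
    have : logDeriv riemannZeta s = Rs - vonMangoldtSum N s := by simp only [hRs]; ring
    rw [this]; exact norm_sub_le _ _
  have e10 : Real.exp (ω * η) * ‖Rs‖ ≤ C₃ * Lg + 3 * (‖Rs‖ + ‖vonMangoldtSum N s‖) := by
    have h1 : C₂ ≤ C₂ * Lg := le_mul_of_one_le_right hC₂.le hLg1.le
    have h2 : A * C₂ ≤ A * (C₂ * Lg) := mul_le_mul_of_nonneg_left h1 hA0.le
    have e9 : C₃ * Lg = A * 48 * Lg + 2 * Real.pi * (12 * Lg + c) + 3 * (A * (C₂ * Lg) + A * c) +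
        4 * Lg + 3 * c := by rw [hC₃, hc]; ring
    rw [e9]
    linarith
  -- The distance `η ≥ 2 / ℓ` gives `ωη ≥ 4`. Hence the term `3 ‖Rs‖` on the right of `e10` is at
  -- most half of the left side and can be absorbed.
  have e12 : 6 ≤ Real.exp (ω * η) := by
    have h1 : (4 : ℝ) ≤ ω * η := by
      rw [div_le_iff₀ hℓ0] at hη2
      rw [hω]; linarith
    have h2 : Real.exp 4 ≤ Real.exp (ω * η) := Real.exp_le_exp.mpr h1
    have h3 : (6 : ℝ) ≤ Real.exp 4 := by
      have : Real.exp 4 = Real.exp 1 ^ 4 := by rw [← Real.exp_nat_mul]; norm_num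
      rw [this]
      have h4 := Real.exp_one_gt_d9
      have : (2 : ℝ) ^ 4 ≤ Real.exp 1 ^ 4 := pow_le_pow_left₀ (by norm_num) (by linarith) 4
      linarith
    linarith
  have e13 : Real.exp (ω * η) * ‖Rs‖ ≤ 2 * C₃ * Lg +
      Real.exp (ω * η) * ‖vonMangoldtSum N s‖ := by
    have hX : 6 * ‖Rs‖ ≤ Real.exp (ω * η) * ‖Rs‖ := by gcongr
    have hY : 6 * ‖vonMangoldtSum N s‖ ≤ Real.exp (ω * η) * ‖vonMangoldtSum N s‖ := by gcongr
    linarith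
  have e14 : ‖Rs‖ ≤ 2 * C₃ * (Real.exp (-(ω * η)) * Lg) + ‖vonMangoldtSum N s‖ := by
    have hpos := Real.exp_pos (ω * η)
    rw [Real.exp_neg]
    rw [← mul_le_mul_iff_right₀ hpos]
    calc _ ≤ _ := e13
      _ = _ := by field_simp
  have hpow : ∀ x : ℝ, Lg ^ x = Real.exp (ℓ * x) := fun x => Real.rpow_def_of_pos hLgpos x
  have e15 : Real.exp (-(ω * η)) * Lg ≤ Real.exp 2 * Lg ^ (2 - 2 * θ) := by
    rw [hpow, ← Real.exp_add, hLe, ← Real.exp_add]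
    apply Real.exp_le_exp.mpr
    have h1 : ℓ * (1 / ℓ) = 1 := by field_simp
    have h2 : ω * η = 2 * (ℓ * σ) - ℓ - 2 * (ℓ * (1 / ℓ)) := by rw [hω, hη, ha]; ring
    rw [h2, h1]
    have := mul_le_mul_of_nonneg_left hθσ hℓ0.le
    linarith
  have e16 : ‖vonMangoldtSum N s‖ ≤ 6 * Lg ^ (2 - 2 * θ) / (1 - θ) := by
    refine (norm_vonMangoldtSum_le hθ0 hθ1 N (s := s) (by rw [hσre]; exact hθσ)).trans ?_
    have h1 : 0 < 1 - θ := by linarith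
    have : (N : ℝ) ^ (1 - θ) ≤ Lg ^ (2 - 2 * θ) := by
      calc (N : ℝ) ^ (1 - θ) ≤ (Lg ^ 2) ^ (1 - θ) := by gcongr
        _ = Lg ^ (2 - 2 * θ) := by
          rw [← Real.rpow_natCast, ← Real.rpow_mul hLgpos.le]; congr 1; push_cast; ring
    gcongr
  have hθ' : 0 < 1 - θ := by linarith
  have hQ : 0 < Lg ^ (2 - 2 * θ) := by positivity
  have e18 : 2 * C₃ * (Real.exp (-(ω * η)) * Lg) ≤
      2 * C₃ * Real.exp 2 * Lg ^ (2 - 2 * θ) / (1 - θ) := by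
    rw [le_div_iff₀ hθ']
    calc _ ≤ 2 * C₃ * (Real.exp 2 * Lg ^ (2 - 2 * θ)) * 1 := by
          gcongr
          linarith
      _ = _ := by ring
  calc ‖logDeriv riemannZeta s‖ ≤ _ := e17
    _ ≤ 2 * C₃ * Real.exp 2 * Lg ^ (2 - 2 * θ) / (1 - θ) +
        2 * (6 * Lg ^ (2 - 2 * θ) / (1 - θ)) := by linarith
    _ = _ := by ring

/-! ### The logarithm of `ζ`: holomorphy, Dirichlet series and size. -/

theorem RiemannHypothesis.differentiableAt_logDeriv_riemannZeta (hRH : RiemannHypothesis) {s : ℂ}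
    (hs : 1 / 2 < s.re) (ht : 0 < s.im) : DifferentiableAt ℂ (logDeriv riemannZeta) s := by
  have h1 : s ≠ 1 := fun h => by simp [h] at ht
  have hd : AnalyticAt ℂ riemannZeta s := by
    refine DifferentiableOn.analyticAt (s := {1}ᶜ)
      (fun z hz => (differentiableAt_riemannZeta hz).differentiableWithinAt) ?_
    exact isOpen_compl_singleton.mem_nhds h1
  exact hd.deriv.differentiableAt.div hd.differentiableAt (hRH.riemannZeta_ne_zero hs)

/-- Uniform exponential decay of `ζ'/ζ` along horizontal half-lines starting in a compact set. -/
theorem RiemannHypothesis.exists_norm_logDeriv_le_of_isCompact (hRH : RiemannHypothesis)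
    {S : Set ℂ} (hS : IsCompact S) (hre : ∀ s ∈ S, 1 / 2 < s.re) (him : ∀ s ∈ S, 0 < s.im) :
    ∃ M : ℝ, 0 < M ∧ ∀ s ∈ S, ∀ x : ℝ, 0 ≤ x →
      ‖logDeriv riemannZeta (s + x)‖ ≤ M * Real.exp (-Real.log 2 * x) := by
  obtain ⟨C, hC, hCb⟩ := norm_logDeriv_riemannZeta_le_two_rpow
  have hc : ContinuousOn (fun q : ℂ × ℝ => logDeriv riemannZeta (q.1 + q.2)) (S ×ˢ Icc 0 2) := by
    rintro ⟨s, x⟩ ⟨hs, hx⟩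
    have h := hRH.differentiableAt_logDeriv_riemannZeta (s := s + x)
      (by simpa using by linarith [hre s hs, hx.1]) (by simpa using him s hs)
    have h2 : ContinuousAt (fun q : ℂ × ℝ => q.1 + (q.2 : ℂ)) (s, x) := by fun_prop
    exact (ContinuousAt.comp (g := logDeriv riemannZeta) (f := fun q : ℂ × ℝ => q.1 + (q.2 : ℂ))
      h.continuousAt h2).continuousWithinAt
  obtain ⟨M, hM⟩ := (hS.prod isCompact_Icc).exists_bound_of_continuousOn hc
  refine ⟨4 * |M| + C, by positivity, fun s hs x hx => ?_⟩
  have he : Real.exp (-Real.log 2 * x) = (2 : ℝ) ^ (-x) := by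
    rw [Real.rpow_def_of_pos two_pos]; congr 1; ring
  rw [he]
  have h2x : (0 : ℝ) < 2 ^ (-x) := by positivity
  rcases le_or_gt x 2 with h | h
  · have h4 : (1 : ℝ) / 4 ≤ 2 ^ (-x) := by
      calc (1 : ℝ) / 4 = 2 ^ (-2 : ℝ) := by rw [Real.rpow_neg two_pos.le, Real.rpow_two]; norm_num
        _ ≤ _ := Real.rpow_le_rpow_of_exponent_le (by norm_num) (by linarith)
    have h1 := (hM (s, x) ⟨hs, hx, h⟩).trans (le_abs_self M)
    have := abs_nonneg M
    simp only at h1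
    nlinarith
  · have hr : (s + x).re = s.re + x := by simp
    have h1 := hCb (s + x) (by rw [hr]; linarith [hre s hs])
    have h3 : (2 : ℝ) ^ (-(s + x).re) ≤ 2 ^ (-x) :=
      Real.rpow_le_rpow_of_exponent_le (by norm_num) (by rw [hr]; linarith [hre s hs])
    calc _ ≤ _ := h1
      _ ≤ C * 2 ^ (-x) := by gcongr
      _ ≤ _ := by
        have := abs_nonneg M
        gcongr
        linarith

/-- Translating the half-line moves `s` from the domain of integration into the integrand, so that
one can differentiate under the integral. -/
theorem logZeta_eq_neg_integral_Ioi_zero (s : ℂ) :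
    logZeta s = -∫ x in Ioi (0 : ℝ), logDeriv riemannZeta (s + x) := by
  rw [logZeta]
  congr 1
  have h := (measurePreserving_add_right (volume : Measure ℝ) s.re).setIntegral_preimage_emb
    (measurableEmbedding_addRight s.re)
    (fun x : ℝ => logDeriv riemannZeta ((x : ℂ) + (s.im : ℂ) * I)) (Ioi s.re)
  rw [← h, preimage_add_const_Ioi, sub_self]
  refine integral_congr_ae (Eventually.of_forall fun x => ?_)
  simp only
  congr 1
  apply Complex.ext <;> simp [add_comm]

theorem RiemannHypothesis.continuousOn_logDeriv_add (hRH : RiemannHypothesis) {s : ℂ}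
    (hs : 1 / 2 < s.re) (ht : 0 < s.im) :
    ContinuousOn (fun x : ℝ => logDeriv riemannZeta (s + x)) (Ici 0) := by
  intro x hx
  have h := hRH.differentiableAt_logDeriv_riemannZeta (s := s + x)
      (by simpa using by linarith [mem_Ici.1 hx]) (by simpa using ht)
  have h2 : ContinuousAt (fun q : ℝ => s + (q : ℂ)) x := by fun_prop
  exact (ContinuousAt.comp (g := logDeriv riemannZeta) (f := fun q : ℝ => s + (q : ℂ))
      h.continuousAt h2).continuousWithinAt

theorem RiemannHypothesis.integrableOn_logDeriv_add (hRH : RiemannHypothesis) {s : ℂ}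
    (hs : 1 / 2 < s.re) (ht : 0 < s.im) :
    IntegrableOn (fun x : ℝ => logDeriv riemannZeta (s + x)) (Ioi 0) := by
  obtain ⟨M, hM, hb⟩ := hRH.exists_norm_logDeriv_le_of_isCompact (S := {s}) isCompact_singleton
    (by simpa using hs) (by simpa using ht)
  refine Integrable.mono'
    ((integrableOn_exp_mul_Ioi (neg_lt_zero.2 (Real.log_pos one_lt_two)) 0).const_mul M)
    (((hRH.continuousOn_logDeriv_add hs ht).mono Ioi_subset_Ici_self).aestronglyMeasurable
      measurableSet_Ioi) ?_
  exact (ae_restrict_iff' measurableSet_Ioi).2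
    (Eventually.of_forall fun x hx => hb s rfl x (le_of_lt hx))

theorem RiemannHypothesis.tendsto_logDeriv_add_atTop (hRH : RiemannHypothesis) {s : ℂ}
    (hs : 1 / 2 < s.re) (ht : 0 < s.im) :
    Tendsto (fun x : ℝ => logDeriv riemannZeta (s + x)) atTop (𝓝 0) := by
  obtain ⟨M, hM, hb⟩ := hRH.exists_norm_logDeriv_le_of_isCompact (S := {s}) isCompact_singleton
    (by simpa using hs) (by simpa using ht)
  have h0 : Tendsto (fun x : ℝ => M * Real.exp (-Real.log 2 * x)) atTop (𝓝 0) := by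
    rw [← mul_zero M]
    refine Tendsto.const_mul M (Real.tendsto_exp_atBot.comp ?_)
    exact tendsto_id.const_mul_atTop_of_neg (neg_lt_zero.2 (Real.log_pos one_lt_two))
  refine squeeze_zero_norm' ?_ h0
  filter_upwards [eventually_ge_atTop 0] with x hx using hb s rfl x hx

/-- `log ζ` is a primitive of `ζ'/ζ` in the quarter plane `Re s > 1/2`, `Im s > 0`. -/
theorem RiemannHypothesis.hasDerivAt_logZeta (hRH : RiemannHypothesis) {s : ℂ}
    (hs : 1 / 2 < s.re) (ht : 0 < s.im) : HasDerivAt logZeta (logDeriv riemannZeta s) s := by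
  obtain ⟨r, hr, hr1, hr2⟩ : ∃ r > 0, r < s.re - 1 / 2 ∧ r < s.im :=
    ⟨min (s.re - 1 / 2) s.im / 2, by have := lt_min (sub_pos.2 hs) ht; positivity,
      by have := lt_min (sub_pos.2 hs) ht; have := min_le_left (s.re - 1 / 2) s.im; linarith,
      by have := lt_min (sub_pos.2 hs) ht; have := min_le_right (s.re - 1 / 2) s.im; linarith⟩
  have hre : ∀ w ∈ closedBall s r, 1 / 2 < w.re := fun w hw => by
    have h1 : |(w - s).re| ≤ r := (abs_re_le_norm _).trans (by simpa [dist_eq] using hw)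
    rw [sub_re] at h1
    linarith [(abs_le.1 h1).1]
  have him : ∀ w ∈ closedBall s r, 0 < w.im := fun w hw => by
    have h1 : |(w - s).im| ≤ r := (abs_im_le_norm _).trans (by simpa [dist_eq] using hw)
    rw [sub_im] at h1
    linarith [(abs_le.1 h1).1]
  obtain ⟨M, hM, hb⟩ := hRH.exists_norm_logDeriv_le_of_isCompact (isCompact_closedBall s r) hre him
  have hl := Real.log_pos one_lt_two
  have hdiff : ∀ w ∈ closedBall s r, ∀ x : ℝ, 0 ≤ x →
      DifferentiableAt ℂ (logDeriv riemannZeta) (w + x) := fun w hw x hx =>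
    hRH.differentiableAt_logDeriv_riemannZeta (by simpa using by linarith [hre w hw])
      (by simpa using him w hw)
  have hsub : ball s (r / 2) ⊆ closedBall s r :=
    ball_subset_closedBall.trans (closedBall_subset_closedBall (by linarith))
  -- The derivative of `ζ'/ζ` is dominated by Cauchy's estimate on circles of radius `r / 2`, which
  -- inherits the exponential decay of `ζ'/ζ` itself.
  have key := hasDerivAt_integral_of_dominated_loc_of_deriv_le (μ := volume.restrict (Ioi (0 : ℝ)))
    (F := fun (w : ℂ) (x : ℝ) => logDeriv riemannZeta (w + x)) (x₀ := s) (s := ball s (r / 2))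
    (F' := fun (w : ℂ) (x : ℝ) => deriv (logDeriv riemannZeta) (w + x))
    (bound := fun x => M / (r / 2) * Real.exp (-Real.log 2 * x))
    (ball_mem_nhds s (by positivity))
    (by
      filter_upwards [ball_mem_nhds s hr] with w hw
      exact (hRH.integrableOn_logDeriv_add (hre w (ball_subset_closedBall hw))
        (him w (ball_subset_closedBall hw))).aestronglyMeasurable)
    (hRH.integrableOn_logDeriv_add hs ht)
    (by
      have : Measurable (fun x : ℝ => deriv (logDeriv riemannZeta) (s + x)) :=
        (measurable_deriv _).comp (by fun_prop)
      exact this.aestronglyMeasurable)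
    ((ae_restrict_iff' measurableSet_Ioi).2 (Eventually.of_forall fun x hx w hw => by
      have hcb : ∀ z ∈ closedBall (w + (x : ℂ)) (r / 2), z - x ∈ closedBall s r := fun z hz => by
        rw [mem_closedBall, dist_eq] at hz ⊢
        rw [mem_ball, dist_eq] at hw
        calc ‖z - x - s‖ = ‖(z - (w + x)) + (w - s)‖ := by congr 1; ring
          _ ≤ r := (norm_add_le _ _).trans (by linarith)
      refine (norm_deriv_le_of_forall_mem_sphere_norm_le (C := M * Real.exp (-Real.log 2 * x))
        (half_pos hr) ?_ ?_).trans_eq (by ring)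
      · refine (DifferentiableOn.diffContOnCl fun z hz => ?_)
        rw [closure_ball _ (half_pos hr).ne'] at hz
        have := hdiff _ (hcb z hz) x (le_of_lt hx)
        rw [sub_add_cancel] at this
        exact this.differentiableWithinAt
      · intro z hz
        have := hb _ (hcb z (sphere_subset_closedBall hz)) x (le_of_lt hx)
        rwa [sub_add_cancel] at this))
    ((integrableOn_exp_mul_Ioi (neg_lt_zero.2 hl) 0).const_mul _)
    ((ae_restrict_iff' measurableSet_Ioi).2 (Eventually.of_forall fun x hx w hw =>
      (hdiff w (hsub hw) x (le_of_lt hx)).hasDerivAt.comp_add_const w x))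
  have hint : ∫ x in Ioi (0 : ℝ), deriv (logDeriv riemannZeta) (s + x)
      = 0 - logDeriv riemannZeta (s + (0 : ℝ)) := by
    refine integral_Ioi_of_hasDerivAt_of_tendsto'
      (f := fun x : ℝ => logDeriv riemannZeta (s + x)) (fun x hx => ?_) key.1
      (hRH.tendsto_logDeriv_add_atTop hs ht)
    have h1 := (hdiff s (mem_closedBall_self hr.le) x hx).hasDerivAt
    exact (h1.comp_const_add s (x : ℂ)).comp_ofReal
  have h3 := key.2.neg
  rw [hint] at h3
  simp only [ofReal_zero, add_zero, zero_sub, neg_neg] at h3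
  exact h3.congr_of_eventuallyEq
    (Eventually.of_forall fun w => logZeta_eq_neg_integral_Ioi_zero w)

/-- In the half-plane of absolute convergence `log ζ` is given by its Dirichlet series. -/
theorem RiemannHypothesis.logZeta_eq_LSeries (hRH : RiemannHypothesis) {s : ℂ} (hs : 1 < s.re)
    (ht : 0 < s.im) :
    logZeta s = LSeries (fun n => (ArithmeticFunction.vonMangoldt n : ℂ) / Real.log n) s := by
  set f : ℕ → ℂ := fun n => (ArithmeticFunction.vonMangoldt n : ℂ) / Real.log n with hf
  have hlm : LSeries.logMul f = fun n => (ArithmeticFunction.vonMangoldt n : ℂ) := by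
    funext n
    rw [LSeries.logMul, hf]
    rcases Nat.lt_or_ge n 2 with h | h
    · interval_cases n <;> simp
    · have : Real.log n ≠ 0 := (Real.log_pos (by exact_mod_cast h)).ne'
      have h2 : (Real.log n : ℂ) ≠ 0 := by exact_mod_cast this
      simp only [natCast_log.symm] at h2 ⊢
      field_simp
  have hab : LSeries.abscissaOfAbsConv f ≤ 1 := by
    rw [← LSeries.abscissaOfAbsConv_logMul, hlm]
    exact_mod_cast LSeries.abscissaOfAbsConv_le_of_forall_lt_LSeriesSummable (x := 1) fun y hy =>
      ArithmeticFunction.LSeriesSummable_vonMangoldt (by simpa using hy)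
  have hlt : ∀ w : ℂ, 1 < w.re → LSeries.abscissaOfAbsConv f < w.re := fun w hw =>
    hab.trans_lt (by exact_mod_cast hw)
  have hder : ∀ w : ℂ, 1 < w.re → HasDerivAt (LSeries f) (logDeriv riemannZeta w) w := by
    intro w hw
    have h1 := LSeries_hasDerivAt (hlt w hw)
    rw [hlm, ArithmeticFunction.LSeries_vonMangoldt_eq_deriv_riemannZeta_div hw, neg_div,
      neg_neg] at h1
    exact h1
  have hlim : Tendsto (fun x : ℝ => LSeries f (s + x)) atTop (𝓝 0) := by
    -- Absorbing `n^(-s)` into the coefficients reduces the limit along the horizontal half-line to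
    -- one along the real axis, which is the coefficient at `1`, namely zero.
    set g : ℕ → ℂ := fun n => f n * (n : ℂ) ^ (-s) with hg
    have hterm : ∀ w : ℂ, LSeries.term g w = LSeries.term f (s + w) := by
      intro w
      funext n
      rcases Nat.eq_zero_or_pos n with rfl | hn
      · simp
      · have hn0 : (n : ℂ) ≠ 0 := by exact_mod_cast hn.ne'
        rw [LSeries.term_of_ne_zero hn.ne', LSeries.term_of_ne_zero hn.ne',
          cpow_add _ _ hn0]
        simp only [hg, cpow_neg]
        field_simp
    have h1 : LSeries.abscissaOfAbsConv g < ⊤ := by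
      have : LSeriesSummable g 0 := by
        rw [LSeriesSummable, hterm, add_zero]
        exact LSeriesSummable_of_abscissaOfAbsConv_lt_re (hlt s hs)
      exact this.abscissaOfAbsConv_le.trans_lt (by simp)
    have h2 := LSeries.tendsto_atTop h1
    have h3 : g 1 = 0 := by simp [hg, hf]
    rw [h3] at h2
    refine h2.congr fun x => ?_
    rw [LSeries, LSeries, hterm]
  have h := integral_Ioi_of_hasDerivAt_of_tendsto' (a := (0 : ℝ))
      (f := fun x : ℝ => LSeries f (s + x)) (f' := fun x : ℝ => logDeriv riemannZeta (s + x))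
      (fun x hx => ?_) (hRH.integrableOn_logDeriv_add (by linarith) ht) hlim
  · rw [logZeta_eq_neg_integral_Ioi_zero, h]
    simp
  · have h1 := hder (s + x) (by simpa using by linarith [mem_Ici.1 hx])
    exact (h1.comp_const_add s (x : ℂ)).comp_ofReal

theorem RiemannHypothesis.logZeta_eq_tsum_primes (hRH : RiemannHypothesis) {s : ℂ}
    (hs : 1 < s.re) (ht : 0 < s.im) :
    logZeta s = ∑' p : Nat.Primes, -log (1 - (p : ℂ) ^ (-s)) := by
  have h := DirichletCharacter.eulerProduct_log_eq_LSeries (1 : DirichletCharacter ℂ 1) hs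
  rw [hRH.logZeta_eq_LSeries hs ht]
  simp only [MulChar.one_apply <| isUnit_of_subsingleton _, one_mul] at h
  exact h.symm

theorem norm_logZeta_le_integral {σ₀ σ t : ℝ} {g : ℝ → ℝ} (h : σ₀ ≤ σ)
    (hg : IntegrableOn g (Ioi σ₀))
    (hb : ∀ x, σ₀ < x → ‖logDeriv riemannZeta (x + t * I)‖ ≤ g x) :
    ‖logZeta (σ + t * I)‖ ≤ ∫ x in Ioi σ₀, g x := by
  rw [logZeta, norm_neg]
  have hre : (σ + t * I : ℂ).re = σ := by simp
  have him : (σ + t * I : ℂ).im = t := by simp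
  rw [hre, him]
  have hsub : Ioi σ ⊆ Ioi σ₀ := Ioi_subset_Ioi h
  refine (norm_integral_le_of_norm_le (hg.mono_set hsub) ((ae_restrict_iff' measurableSet_Ioi).2
    (Eventually.of_forall fun x hx => hb x (h.trans_lt hx)))).trans ?_
  refine setIntegral_mono_set hg ?_ hsub.eventuallyLE
  exact (ae_restrict_iff' measurableSet_Ioi).2
    (Eventually.of_forall fun x hx => (norm_nonneg _).trans (hb x hx))

/-- The bound for `log ζ` to the right of the critical line which the Riemann hypothesis implies. -/
theorem RiemannHypothesis.norm_logZeta_le (hRH : RiemannHypothesis) {ε : ℝ} (hε : 0 < ε)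
    (hε4 : ε ≤ 1 / 4) :
    ∃ C : ℝ, 0 < C ∧ ∃ t₀ : ℝ, ∀ t : ℝ, t₀ ≤ t → ∀ σ₀ : ℝ,
      1 / 2 + 3 / Real.log (Real.log t) ≤ σ₀ → σ₀ ≤ 1 - ε → ∀ σ : ℝ, σ₀ ≤ σ →
      ‖logZeta (σ + t * I)‖ ≤ C * Real.log t ^ (2 - 2 * σ₀) / Real.log (Real.log t) := by
  obtain ⟨C₁, hC₁, t₁, h1⟩ := hRH.norm_logDeriv_riemannZeta_le
  obtain ⟨C₂, hC₂, h2⟩ := norm_logDeriv_riemannZeta_le_two_rpow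
  set A := 8 * C₁ / ε + C₂ with hA
  have hA0 : 0 < A := by positivity
  have hA1 : 2 * C₁ / ε ≤ A := by
    have : 0 ≤ C₁ / ε := by positivity
    have e : A = 8 * (C₁ / ε) + C₂ := by rw [hA]; ring
    have e2 : 2 * C₁ / ε = 2 * (C₁ / ε) := by ring
    linarith
  refine ⟨A * (1 + 2 / ε), by positivity, max t₁ (Real.exp (Real.exp 1)),
    fun t ht σ₀ hσ₀ hσ₀' σ hσ => ?_⟩
  have ht1 : t₁ ≤ t := (le_max_left _ _).trans ht
  have ht2 : Real.exp (Real.exp 1) ≤ t := (le_max_right _ _).trans ht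
  have ht0 : 0 < t := (Real.exp_pos _).trans_le ht2
  have hLg : Real.exp 1 ≤ Real.log t := (Real.le_log_iff_exp_le ht0).2 ht2
  have hLg0 : 0 < Real.log t := (Real.exp_pos _).trans_le hLg
  have hll : 1 ≤ Real.log (Real.log t) := (Real.le_log_iff_exp_le hLg0).2 hLg
  have hpow : ∀ a : ℝ, Real.log t ^ a = Real.exp (Real.log (Real.log t) * a) :=
    fun a => Real.rpow_def_of_pos hLg0 a
  set l := Real.log (Real.log t) with hl
  have hl0 : 0 < l := by linarith
  have h2l := Real.log_pos one_lt_two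
  have h2pow : ∀ a : ℝ, (2 : ℝ) ^ (-a) = Real.exp (-Real.log 2 * a) := fun a => by
    rw [Real.rpow_def_of_pos two_pos]; congr 1; ring
  have hhalf : 1 / 2 ≤ σ₀ := le_trans (by have : 0 ≤ 3 / l := by positivity
                                          linarith) hσ₀
  -- The first summand is `A (log t)^(2 - 2x)` and covers `x ≤ 1 - ε/2`. Its decay rate `2l`
  -- produces the saving `1 / log log t` on integration. The second covers larger `x`, using
  -- Littlewood's bound with `θ = 1 - ε/2` up to `2` and the decay of `ζ'/ζ` beyond.
  set g : ℝ → ℝ := fun x => A * Real.exp (2 * l) * Real.exp (-(2 * l) * x)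
    + A * Real.exp (l * ε) * Real.exp (-Real.log 2 * x) with hgdef
  have i1 := integrableOn_exp_mul_Ioi (show -(2 * l) < 0 by linarith) σ₀
  have i2 := integrableOn_exp_mul_Ioi (show -Real.log 2 < 0 by linarith) σ₀
  have hg : IntegrableOn g (Ioi σ₀) :=
    (i1.const_mul (A * Real.exp (2 * l))).add (i2.const_mul (A * Real.exp (l * ε)))
  have hb : ∀ x, σ₀ < x → ‖logDeriv riemannZeta (x + t * I)‖ ≤ g x := by
    intro x hx
    have hp1 : 0 ≤ A * Real.exp (2 * l) * Real.exp (-(2 * l) * x) := by positivity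
    have hp2 : 0 ≤ A * Real.exp (l * ε) * Real.exp (-Real.log 2 * x) := by positivity
    rcases le_or_gt x (1 - ε / 2) with hx1 | hx1
    · refine (h1 t ht1 x x (hσ₀.trans hx.le) (by linarith) (by linarith) (by linarith)
        le_rfl).trans ?_
      have e : Real.log t ^ (2 - 2 * x) = Real.exp (2 * l) * Real.exp (-(2 * l) * x) := by
        rw [hpow, ← Real.exp_add]; congr 1; ring
      rw [e]
      have : C₁ / (1 - x) ≤ A := by
        refine le_trans ?_ hA1
        calc C₁ / (1 - x) ≤ C₁ / (ε / 2) := by gcongr; linarith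
          _ = _ := by ring
      calc _ ≤ A * (Real.exp (2 * l) * Real.exp (-(2 * l) * x)) := by gcongr
        _ ≤ _ := by simp only [hgdef]; linarith
    · rcases le_or_gt x 2 with hx2 | hx2
      · refine (h1 t ht1 x (1 - ε / 2) (hσ₀.trans hx.le) hx2 (by linarith) (by linarith)
          hx1.le).trans ?_
        have e : Real.log t ^ (2 - 2 * (1 - ε / 2)) = Real.exp (l * ε) := by
          rw [hpow]; congr 1; ring
        have h4 : 1 / 4 ≤ Real.exp (-Real.log 2 * x) := by
          rw [← h2pow]
          calc (1 : ℝ) / 4 = 2 ^ (-2 : ℝ) := by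
                rw [Real.rpow_neg two_pos.le, Real.rpow_two]; norm_num
            _ ≤ _ := Real.rpow_le_rpow_of_exponent_le (by norm_num) (by linarith)
        rw [e, show 1 - (1 - ε / 2) = ε / 2 by ring, show C₁ / (ε / 2) = 2 * C₁ / ε by field_simp]
        have h5 : 2 * C₁ / ε ≤ A * Real.exp (-Real.log 2 * x) := by
          calc 2 * C₁ / ε = 8 * C₁ / ε * (1 / 4) := by ring
            _ ≤ A * Real.exp (-Real.log 2 * x) := by gcongr; linarith
        calc _ ≤ A * Real.exp (-Real.log 2 * x) * Real.exp (l * ε) := by gcongr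
          _ = A * Real.exp (l * ε) * Real.exp (-Real.log 2 * x) := by ring
          _ ≤ _ := by simp only [hgdef]; linarith
      · have h3 := h2 (x + t * I) (by simpa using hx2.le)
        have e : (x + t * I : ℂ).re = x := by simp
        rw [e, h2pow] at h3
        have hone : 1 ≤ Real.exp (l * ε) := Real.one_le_exp (by positivity)
        have hAC : C₂ ≤ A := by
          have : 0 ≤ 8 * C₁ / ε := by positivity
          linarith
        calc _ ≤ _ := h3
          _ ≤ A * Real.exp (-Real.log 2 * x) := by gcongr
          _ = A * 1 * Real.exp (-Real.log 2 * x) := by ring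
          _ ≤ A * Real.exp (l * ε) * Real.exp (-Real.log 2 * x) := by gcongr
          _ ≤ _ := by simp only [hgdef]; linarith
  refine (norm_logZeta_le_integral hσ hg hb).trans ?_
  have hint : ∫ x in Ioi σ₀, g x = A * Real.exp (2 * l) * (-Real.exp (-(2 * l) * σ₀) / -(2 * l))
      + A * Real.exp (l * ε) * (-Real.exp (-Real.log 2 * σ₀) / -Real.log 2) := by
    rw [hgdef, integral_add (i1.const_mul _) (i2.const_mul _), integral_const_mul,
      integral_const_mul, integral_exp_mul_Ioi (by linarith), integral_exp_mul_Ioi (by linarith)]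
  rw [hint, hpow]
  set E := Real.exp (l * (2 - 2 * σ₀)) with hE
  have hE0 : 0 < E := Real.exp_pos _
  have t1 : A * Real.exp (2 * l) * (-Real.exp (-(2 * l) * σ₀) / -(2 * l)) ≤ A * (E / l) := by
    have : E = Real.exp (2 * l) * Real.exp (-(2 * l) * σ₀) := by
      rw [hE, ← Real.exp_add]; congr 1; ring
    rw [neg_div_neg_eq, this]
    have h0 : 0 ≤ A * (Real.exp (2 * l) * Real.exp (-(2 * l) * σ₀) / l) := by positivity
    calc _ = A * (Real.exp (2 * l) * Real.exp (-(2 * l) * σ₀) / l) / 2 := by field_simp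
      _ ≤ _ := by linarith
  have t2 : A * Real.exp (l * ε) * (-Real.exp (-Real.log 2 * σ₀) / -Real.log 2)
      ≤ A * (2 / ε * (E / l)) := by
    rw [neg_div_neg_eq]
    have a1 : Real.exp (-Real.log 2 * σ₀) / Real.log 2 ≤ 2 := by
      rw [div_le_iff₀ h2l]
      have : Real.exp (-Real.log 2 * σ₀) ≤ 1 := Real.exp_le_one_iff.2 (by nlinarith)
      linarith [Real.log_two_gt_d9]
    -- Since `σ₀ ≤ 1 - ε`, `E` is at least `(log t)^(2ε)`; one factor `(log t)^ε` pays for `l * ε`.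
    have a2 : Real.exp (l * ε) ≤ 1 / ε * (E / l) := by
      have b1 : l * ε ≤ Real.exp (l * ε) := by linarith [Real.add_one_le_exp (l * ε)]
      have b2 : Real.exp (l * ε) * Real.exp (l * ε) ≤ E := by
        rw [← Real.exp_add, hE]
        exact Real.exp_le_exp.2 (by nlinarith)
      rw [show 1 / ε * (E / l) = E / (l * ε) by field_simp, le_div_iff₀ (by positivity)]
      exact (mul_le_mul_of_nonneg_left b1 (Real.exp_pos _).le).trans b2
    calc _ ≤ A * (1 / ε * (E / l)) * 2 := by gcongr
      _ = _ := by ring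
  calc _ ≤ A * (E / l) + A * (2 / ε * (E / l)) := add_le_add t1 t2
    _ = _ := by ring

/-! ### Divisor functions and the Dirichlet series of `ζ^z`. -/

theorem ringChoose_eq_divisorLocal (z : ℂ) (n : ℕ) :
    Ring.choose (z + n - 1) n = divisorLocal z n := by
  have h : ∀ n : ℕ, (ascPochhammer ℂ n).eval z = ∏ j ∈ Finset.range n, (z + (j : ℂ)) := by
    intro n
    induction n with
    | zero => simp
    | succ n ih => rw [ascPochhammer_succ_eval, ih, Finset.prod_range_succ]
  have h1 := Ring.factorial_nsmul_multichoose_eq_ascPochhammer z n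
  rw [Polynomial.ascPochhammer_smeval_eq_eval, h, nsmul_eq_mul] at h1
  have h2 : Ring.choose (z + n - 1) n = Ring.multichoose z n := by
    rw [Ring.choose]
    congr 1
    ring
  rw [h2, divisorLocal, ← h1, mul_div_cancel_left₀]
  exact_mod_cast n.factorial_ne_zero

/-- The binomial series for `(1 - x)^(-z)`; at `x = p^(-s)` it is the Euler factor of `ζ(s)^z`. -/
theorem hasSum_divisorLocal_mul_pow (z : ℂ) {x : ℂ} (hx : ‖x‖ < 1) :
    HasSum (fun e : ℕ => divisorLocal z e * x ^ e) (exp (z * -log (1 - x))) := by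
  have h := (one_div_one_sub_cpow_hasFPowerSeriesOnBall_zero z).hasSum (y := x) (by
    rw [Metric.mem_eball, edist_zero_right, enorm_eq_nnnorm]
    exact_mod_cast hx)
  have hne : 1 - x ≠ 0 := fun h0 => by
    rw [← sub_eq_zero.1 h0] at hx
    simp at hx
  rw [zero_add, cpow_def_of_ne_zero hne, one_div, ← exp_neg] at h
  have e : z * -log (1 - x) = -(log (1 - x) * z) := by ring
  rw [e]
  refine h.congr_fun fun n => ?_
  rw [FormalMultilinearSeries.ofScalars_apply_eq, ringChoose_eq_divisorLocal, smul_eq_mul]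

theorem norm_divisorLocal_ofReal {κ : ℝ} (hκ : 0 ≤ κ) (a : ℕ) :
    ((‖divisorLocal κ a‖ : ℝ) : ℂ) = divisorLocal κ a := by
  have h : divisorLocal κ a = (((∏ j ∈ Finset.range a, (κ + (j : ℝ))) / (a.factorial : ℝ) : ℝ) : ℂ) := by
    rw [divisorLocal]; push_cast; rfl
  rw [h, norm_real, Real.norm_of_nonneg]
  exact div_nonneg (Finset.prod_nonneg fun j _ => by positivity) (by positivity)

theorem norm_divisorLocal_le {z : ℂ} {κ : ℝ} (hz : ‖z‖ ≤ κ) (a : ℕ) :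
    ‖divisorLocal z a‖ ≤ ‖divisorLocal κ a‖ := by
  rw [divisorLocal, divisorLocal, norm_div, norm_div, norm_prod, norm_prod]
  refine div_le_div_of_nonneg_right (Finset.prod_le_prod (fun _ _ => norm_nonneg _)
    fun j _ => ?_) (norm_nonneg _)
  have hκ : 0 ≤ κ := (norm_nonneg z).trans hz
  calc ‖z + j‖ ≤ ‖z‖ + ‖(j : ℂ)‖ := norm_add_le _ _
    _ ≤ κ + j := by simpa using hz
    _ = ‖(κ : ℂ) + j‖ := by
      rw [← ofReal_natCast, ← ofReal_add, norm_real, Real.norm_of_nonneg (by positivity)]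

/-- The factors satisfy `‖z + j‖ ≤ κ + j`. One real parameter thus dominates all admissible
exponents, which is where uniformity in `z₁` and `z₂` comes from. -/
theorem norm_divisorFun_le {z : ℂ} {κ : ℝ} (hz : ‖z‖ ≤ κ) (n : ℕ) :
    ‖divisorFun z n‖ ≤ ‖divisorFun κ n‖ := by
  rw [divisorFun, divisorFun]
  split_ifs with h
  · rfl
  · rw [Finsupp.prod, Finsupp.prod, norm_prod, norm_prod]
    exact Finset.prod_le_prod (fun _ _ => norm_nonneg _) fun p _ => norm_divisorLocal_le hz _

theorem divisorFun_zero (z : ℂ) : divisorFun z 0 = 0 := by simp [divisorFun]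

theorem divisorFun_one (z : ℂ) : divisorFun z 1 = 1 := by simp [divisorFun]

theorem divisorFun_mul_of_coprime (z : ℂ) {m n : ℕ} (h : m.Coprime n) :
    divisorFun z (m * n) = divisorFun z m * divisorFun z n := by
  rcases Nat.eq_zero_or_pos m with rfl | hm
  · simp [divisorFun_zero]
  rcases Nat.eq_zero_or_pos n with rfl | hn
  · simp [divisorFun_zero]
  exact divisorFun_mul z h hm.ne' hn.ne'

theorem divisorFun_conj (z : ℂ) (n : ℕ) :
    divisorFun (starRingEnd ℂ z) n = starRingEnd ℂ (divisorFun z n) := by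
  have h : ∀ a, divisorLocal (starRingEnd ℂ z) a = starRingEnd ℂ (divisorLocal z a) := by
    intro a
    simp [divisorLocal]
  rw [divisorFun, divisorFun]
  split_ifs
  · simp
  · rw [Finsupp.prod, Finsupp.prod, map_prod]
    exact Finset.prod_congr rfl fun p _ => h _

theorem hasSum_norm_divisorLocal_mul_pow {κ u : ℝ} (hκ : 0 ≤ κ) (hu : 0 ≤ u) (hu1 : u < 1) :
    HasSum (fun e : ℕ => ‖divisorLocal κ e‖ * u ^ e) (Real.exp (κ * -Real.log (1 - u))) := by
  have h := hasSum_divisorLocal_mul_pow (κ : ℂ) (x := u) (by rwa [norm_real, Real.norm_of_nonneg hu])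
  have e : exp (κ * -log (1 - u)) = ((Real.exp (κ * -Real.log (1 - u)) : ℝ) : ℂ) := by
    rw [ofReal_exp]; push_cast; rw [ofReal_log (by linarith)]; push_cast; rfl
  rw [e] at h
  refine hasSum_ofReal.1 (h.congr_fun fun n => ?_)
  push_cast
  rw [norm_divisorLocal_ofReal hκ]

theorem neg_log_one_sub_le {u : ℝ} (hu1 : u < 1) : -Real.log (1 - u) ≤ u / (1 - u) := by
  have h := Real.one_sub_inv_le_log_of_pos (sub_pos.2 hu1)
  have : 1 - (1 - u)⁻¹ = -(u / (1 - u)) := by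
    have := (sub_pos.2 hu1).ne'
    field_simp
    ring
  linarith

/-- Summability of a nonnegative multiplicative function, and a bound for its sum, from bounds for
the local factors. -/
theorem summable_and_tsum_le_exp_of_multiplicative {g : ℕ → ℝ} (h0 : g 0 = 0) (h1 : g 1 = 1)
    (hmul : ∀ {m n : ℕ}, m.Coprime n → g (m * n) = g m * g n) (hnn : ∀ n, 0 ≤ g n) {u : ℕ → ℝ}
    (hs : ∀ p : ℕ, p.Prime → Summable (fun e : ℕ => g (p ^ e)))
    (hu : ∀ p : ℕ, p.Prime → ∑' e : ℕ, g (p ^ e) ≤ Real.exp (u p)) {B : ℝ}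
    (hB : ∀ N : ℕ, ∑ p ∈ N.primesBelow, u p ≤ B) :
    Summable g ∧ ∑' n, g n ≤ Real.exp B := by
  have key : ∀ N : ℕ, ∑ n ∈ Finset.range N, g n ≤ Real.exp B := by
    intro N
    obtain ⟨hsum, hhas⟩ := EulerProduct.summable_and_hasSum_smoothNumbers_prod_primesBelow_tsum
      h1 hmul (fun {p} hp => (hs p hp).norm) N
    -- Positive integers below `N` are `N`-smooth, so the partial sum is dominated by a finite Euler
    -- product.
    have hle : ∑ n ∈ Finset.range N, g n ≤ ∑' m : N.smoothNumbers, g m := by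
      classical
      calc ∑ n ∈ Finset.range N, g n
          = ∑ m ∈ (Finset.range N).subtype (· ∈ N.smoothNumbers), g m := by
            rw [Finset.sum_subtype_eq_sum_filter, Finset.sum_filter]
            refine Finset.sum_congr rfl fun n hn => ?_
            split_ifs with h
            · rfl
            · rcases Nat.eq_zero_or_pos n with rfl | h'
              · exact h0
              · exact absurd (Nat.mem_smoothNumbers_of_lt h' (Finset.mem_range.1 hn)) h
        _ ≤ _ := hhas.summable.sum_le_tsum _ fun m _ => hnn m
    rw [hhas.tsum_eq] at hle
    calc _ ≤ _ := hle
      _ ≤ ∏ p ∈ N.primesBelow, Real.exp (u p) :=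
        Finset.prod_le_prod (fun p _ => tsum_nonneg fun e => hnn _)
          fun p hp => hu p (Nat.prime_of_mem_primesBelow hp)
      _ = Real.exp (∑ p ∈ N.primesBelow, u p) := (Real.exp_sum _ _).symm
      _ ≤ _ := Real.exp_le_exp.2 (hB N)
  exact ⟨summable_of_sum_range_le hnn key, Real.tsum_le_of_sum_range_le hnn key⟩

theorem sum_primesBelow_rpow_neg_two_le (N : ℕ) :
    ∑ p ∈ N.primesBelow, ((p : ℝ) ^ 2)⁻¹ ≤ 1 := by
  have h : ∀ N : ℕ, ∑ p ∈ Finset.Ico 2 (N + 2), ((p : ℝ) ^ 2)⁻¹ ≤ 1 - 1 / (N + 1) := by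
    intro N
    induction N with
    | zero => simp
    | succ N ih =>
      rw [Finset.sum_Ico_succ_top (by omega)]
      have : (((N + 2 : ℕ) : ℝ) ^ 2)⁻¹ ≤ 1 / ((N : ℝ) + 1) - 1 / (N + 1 + 1) := by
        push_cast
        rw [div_sub_div _ _ (by positivity) (by positivity), inv_eq_one_div,
          div_le_div_iff₀ (by positivity) (by positivity)]
        nlinarith
      push_cast at this ⊢
      linarith
  refine (Finset.sum_le_sum_of_subset_of_nonneg (t := Finset.Ico 2 (N + 2)) (fun p hp => ?_)
    fun _ _ _ => by positivity).trans ((h N).trans (by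
      have : (0 : ℝ) ≤ 1 / ((N : ℝ) + 1) := by positivity
      linarith))
  have h1 := Nat.prime_of_mem_primesBelow hp
  have h2 := Nat.lt_of_mem_primesBelow hp
  exact Finset.mem_Ico.2 ⟨h1.two_le, by omega⟩

/-- An Euler product bound for `ζ(2)^κ`. It gives absolute convergence on `Re s ≥ 2` and controls
the off-diagonal terms. -/
theorem summable_norm_divisorFun_and_tsum_le {κ : ℝ} (hκ : 0 ≤ κ) :
    Summable (fun n : ℕ => ‖divisorFun κ n‖ * ((n : ℝ) ^ 2)⁻¹) ∧
      ∑' n : ℕ, ‖divisorFun κ n‖ * ((n : ℝ) ^ 2)⁻¹ ≤ Real.exp (2 * κ) := by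
  have hloc : ∀ p : ℕ, p.Prime →
      HasSum (fun e : ℕ => ‖divisorFun κ (p ^ e)‖ * (((p ^ e : ℕ) : ℝ) ^ 2)⁻¹)
        (Real.exp (κ * -Real.log (1 - ((p : ℝ) ^ 2)⁻¹))) := by
    intro p hp
    have hp2 : (2 : ℝ) ≤ p := by exact_mod_cast hp.two_le
    refine (hasSum_norm_divisorLocal_mul_pow hκ (u := ((p : ℝ) ^ 2)⁻¹) (by positivity)
      (inv_lt_one_of_one_lt₀ (by nlinarith))).congr_fun fun e => ?_
    rw [divisorFun_prime_pow _ hp]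
    push_cast
    rw [inv_pow, ← pow_mul, ← pow_mul, mul_comm 2 e]
  refine summable_and_tsum_le_exp_of_multiplicative (u := fun p => 2 * κ * ((p : ℝ) ^ 2)⁻¹)
    (by simp) (by simp [divisorFun_one]) (fun {m n} h => ?_) (fun n => by positivity)
    (fun p hp => (hloc p hp).summable) (fun p hp => ?_) (fun N => ?_)
  · rw [divisorFun_mul_of_coprime _ h, norm_mul]
    push_cast
    rw [mul_pow, mul_inv]
    ring
  · rw [(hloc p hp).tsum_eq]
    have hp2 : (2 : ℝ) ≤ p := by exact_mod_cast hp.two_le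
    have hu : ((p : ℝ) ^ 2)⁻¹ ≤ 1 / 2 := by
      rw [inv_le_comm₀ (by positivity) (by norm_num)]
      norm_num
      nlinarith
    have hu0 : 0 < ((p : ℝ) ^ 2)⁻¹ := by positivity
    refine Real.exp_le_exp.2 ?_
    rw [mul_comm 2 κ, mul_assoc]
    refine mul_le_mul_of_nonneg_left ((neg_log_one_sub_le (by linarith)).trans ?_) hκ
    rw [div_le_iff₀ (by linarith)]
    nlinarith
  · rw [← Finset.mul_sum]
    have := sum_primesBelow_rpow_neg_two_le N
    nlinarith

theorem norm_divisorFun_mul_cpow_le {z s : ℂ} {κ : ℝ} (hz : ‖z‖ ≤ κ) (hs : 2 ≤ s.re) (n : ℕ) :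
    ‖divisorFun z n * (n : ℂ) ^ (-s)‖ ≤ ‖divisorFun κ n‖ * ((n : ℝ) ^ 2)⁻¹ := by
  rcases Nat.eq_zero_or_pos n with rfl | hn
  · simp [divisorFun_zero]
  · rw [norm_mul, norm_natCast_cpow_of_pos hn, neg_re]
    have h1 : (n : ℝ) ^ (-s.re) ≤ ((n : ℝ) ^ 2)⁻¹ := by
      rw [← Real.rpow_natCast, ← Real.rpow_neg (by positivity)]
      exact Real.rpow_le_rpow_of_exponent_le (by exact_mod_cast hn) (by simpa using hs)
    gcongr
    exact norm_divisorFun_le hz n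

/-- The Dirichlet series of `ζ(s)^z`. -/
theorem RiemannHypothesis.tsum_divisorFun_mul_cpow (hRH : RiemannHypothesis) {s : ℂ}
    (hs : 2 ≤ s.re) (ht : 0 < s.im) (z : ℂ) :
    ∑' n : ℕ, divisorFun z n * (n : ℂ) ^ (-s) = zetaPow s z := by
  have hs1 : 1 < s.re := by linarith
  have hsum : Summable (fun n : ℕ => ‖divisorFun z n * (n : ℂ) ^ (-s)‖) :=
    Summable.of_nonneg_of_le (fun _ => norm_nonneg _) (norm_divisorFun_mul_cpow_le le_rfl hs)
      (summable_norm_divisorFun_and_tsum_le (norm_nonneg z)).1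
  have h := EulerProduct.eulerProduct_hasProd (f := fun n : ℕ => divisorFun z n * (n : ℂ) ^ (-s))
    (by simp [divisorFun_one])
    (fun {m n} hmn => by
      rw [divisorFun_mul_of_coprime _ hmn, Nat.cast_mul, natCast_mul_natCast_cpow]
      ring) hsum (by simp [divisorFun_zero])
  have hx : ∀ p : Nat.Primes, ‖((p : ℕ) : ℂ) ^ (-s)‖ < 1 := fun p => by
    rw [norm_natCast_cpow_of_pos p.2.pos, neg_re]
    exact Real.rpow_lt_one_of_one_lt_of_neg (by exact_mod_cast p.2.one_lt) (by linarith)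
  have hloc : ∀ p : Nat.Primes, ∑' e : ℕ, divisorFun z ((p : ℕ) ^ e) * (((p : ℕ) ^ e : ℕ) : ℂ) ^ (-s)
      = exp (z * -log (1 - ((p : ℕ) : ℂ) ^ (-s))) := by
    intro p
    rw [← (hasSum_divisorLocal_mul_pow z (hx p)).tsum_eq]
    refine tsum_congr fun e => ?_
    rw [divisorFun_prime_pow _ p.2, Nat.cast_pow, ← natCast_cpow_natCast_mul, ← cpow_nat_mul]
  have hps : Summable (fun p : Nat.Primes => -log (1 - ((p : ℕ) : ℂ) ^ (-s))) := by
    have h1 : Summable (fun p : Nat.Primes => ((p : ℕ) : ℂ) ^ (-s)) := by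
      refine Summable.of_norm ?_
      have : Summable (fun n : ℕ => ‖(n : ℂ) ^ (-s)‖) := by
        refine (Complex.summable_one_div_nat_cpow.2 hs1).norm.congr fun n => ?_
        rw [cpow_neg, one_div]
      exact this.comp_injective Subtype.coe_injective
    exact h1.clog_one_sub.neg
  have h2 := (hps.hasSum.mul_left z).cexp
  have h3 : (fun p : Nat.Primes => ∑' e : ℕ, divisorFun z ((p : ℕ) ^ e) * (((p : ℕ) ^ e : ℕ) : ℂ) ^ (-s))
      = cexp ∘ fun p : Nat.Primes => z * -log (1 - ((p : ℕ) : ℂ) ^ (-s)) := funext hloc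
  rw [h3] at h
  rw [h.unique h2, zetaPow, hRH.logZeta_eq_tsum_primes hs1 ht]

/-- Lets both factors of the integrand be handled by the same approximation of `ζ^z`. -/
theorem zetaConjPow_eq_conj (s z : ℂ) :
    zetaConjPow s z = starRingEnd ℂ (zetaPow s (starRingEnd ℂ z)) := by
  rw [zetaConjPow, zetaPow, ← exp_conj, map_mul, conj_conj]

/-! ### Approximation of `ζ^z` by a smoothed Dirichlet series. -/

/-- The weight, as a function of `y = log (X / n)`, with which `n` enters the approximation of
`ζ(s)^z` by a Dirichlet series smoothed at `X`. -/
noncomputable def smoothWeight (V y : ℝ) : ℂ :=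
  1 / (2 * Real.pi) * ∫ v in (-V)..V,
    exp ((3 + v * I) * y + (3 + v * I) ^ 2) / (3 + v * I)

theorem norm_exp_gaussian (x v y : ℝ) :
    ‖exp (((x : ℂ) + v * I) * y + ((x : ℂ) + v * I) ^ 2)‖
      = Real.exp (x * y + x ^ 2 - v ^ 2) := by
  rw [norm_exp]
  congr 1
  simp [pow_two]
  ring

/-- The line of integration moves from `Re w = 3` to `Re w = -η` across the simple pole at `0` with
residue `G 0`; on the new line `e^(wy)` has modulus `e^(-ηy)`. -/
theorem norm_sub_integral_gaussian_le {G : ℂ → ℂ} {η V y Q : ℝ} (hη : 0 < η) (hη1 : η ≤ 1)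
    (hV : 1 ≤ V) (hy : 4 * y ≤ V ^ 2)
    (hG : ∀ x ∈ Icc (-η) 3, ∀ v ∈ Icc (-V) V, DifferentiableAt ℂ G ((x : ℂ) + (v : ℂ) * I))
    (hQ : ∀ x ∈ Icc (-η) 3, ∀ v ∈ Icc (-V) V, ‖G ((x : ℂ) + (v : ℂ) * I)‖ ≤ Q) :
    ‖G 0 - 1 / (2 * Real.pi) * ∫ v in (-V)..V, G (3 + v * I) *
        exp ((3 + v * I) * y + (3 + v * I) ^ 2) / (3 + v * I)‖
      ≤ Real.exp 10 * Q * Real.exp (-η * y) / η := by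
  have hV0 : 0 < V := by linarith
  have hQ0 : 0 ≤ Q := (norm_nonneg _).trans
    (hQ 0 ⟨by linarith, by norm_num⟩ 0 ⟨by linarith, by linarith⟩)
  set F : ℂ → ℂ := fun w => G w * exp (w * y + w ^ 2) with hF
  have key := norm_integral_left_add_sub_integral_right_le (F := F) (a := -η) (b := 3) (p := 0)
    (V := V) (E := Q * Real.exp 9 * Real.exp (-η * y)) (by linarith) (by norm_num) hV0
    (fun x hx v hv => by
      refine (hG x hx v hv).mul ?_
      fun_prop)
    (by
      intro x hx v hv
      have hvm : v ∈ Icc (-V) V := abs_le.1 hv.le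
      rw [ofReal_zero, sub_zero, hF, norm_div, norm_mul, norm_exp_gaussian]
      have hw : 1 ≤ ‖(x : ℂ) + v * I‖ := by
        have := abs_im_le_norm ((x : ℂ) + v * I)
        simp only [add_im, ofReal_im, mul_im, ofReal_re, I_im, mul_one, I_re, mul_zero,
          add_zero, zero_add, hv] at this
        linarith
      have hexp : x * y + x ^ 2 - v ^ 2 ≤ 9 + -η * y := by
        have e : v ^ 2 = V ^ 2 := by rw [← hv, sq_abs]
        have h9 : x ^ 2 ≤ 9 := by nlinarith [hx.1, hx.2]
        -- On the horizontal sides `x + η ≤ 4`, so `4 * y ≤ V ^ 2` lets the Gaussian compensate for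
        -- the growth of `e^(wy)`.
        have : (x + η) * y ≤ V ^ 2 := by
          rcases le_or_gt 0 y with h0 | h0
          · nlinarith [hx.1, hx.2]
          · nlinarith [hx.1, hx.2, sq_nonneg V]
        rw [e]
        linarith
      calc _ ≤ Q * Real.exp (x * y + x ^ 2 - v ^ 2) / 1 := by
            gcongr
            exact hQ x hx v hvm
        _ ≤ Q * Real.exp (9 + -η * y) / 1 := by gcongr
        _ = _ := by rw [Real.exp_add]; ring)
  rw [ofReal_zero] at key
  simp only [sub_zero, ofReal_neg, ofReal_ofNat] at key
  set J := ∫ v in (-V)..V, F (-(η : ℂ) + v * I) / (-(η : ℂ) + v * I) with hJ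
  set R := ∫ v in (-V)..V, F (3 + v * I) / (3 + v * I) with hR
  have hF0 : F 0 = G 0 := by simp [hF]
  have hJb : ‖J‖ ≤ Q * Real.exp 1 * Real.exp (-η * y) / η * Real.pi := by
    have h1 : ‖J‖ ≤ ∫ v in (-V)..V, Q * Real.exp 1 * Real.exp (-η * y) / η * Real.exp (-v ^ 2) := by
      refine intervalIntegral.norm_integral_le_of_norm_le (by linarith)
        (Eventually.of_forall fun v hv => ?_) (by
          apply Continuous.intervalIntegrable; fun_prop)
      have hvm : v ∈ Icc (-V) V := ⟨hv.1.le, hv.2⟩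
      have hq := hQ (-η) ⟨le_rfl, by linarith⟩ v hvm
      have hn := norm_exp_gaussian (-η) v y
      rw [ofReal_neg] at hq hn
      rw [hF, norm_div, norm_mul, hn]
      have hw : η ≤ ‖-(η : ℂ) + v * I‖ := by
        have := abs_re_le_norm (-(η : ℂ) + v * I)
        simp only [add_re, neg_re, ofReal_re, mul_re, I_re, mul_zero, ofReal_im, I_im, mul_one,
          sub_self, add_zero, abs_neg, abs_of_pos hη] at this
        exact this
      calc _ ≤ Q * Real.exp (1 + -η * y + -v ^ 2) / η := by
            gcongr
            nlinarith
        _ = _ := by rw [Real.exp_add, Real.exp_add]; ring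
    refine h1.trans ?_
    rw [intervalIntegral.integral_const_mul]
    gcongr
    exact integral_exp_neg_sq_le hV0.le
  have hpi := Real.pi_gt_three
  have hpi0 : (Real.pi : ℂ) ≠ 0 := by exact_mod_cast Real.pi_ne_zero
  have e1 : G 0 - 1 / (2 * Real.pi) * R
      = 1 / (2 * Real.pi) * ((J + 2 * Real.pi * F 0 - R) - J) := by
    rw [hF0]; field_simp; ring
  rw [e1, norm_mul]
  have e2 : ‖1 / (2 * (Real.pi : ℂ))‖ = 1 / (2 * Real.pi) := by
    rw [norm_div, norm_mul, norm_real, Real.norm_of_nonneg Real.pi_pos.le]; simp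
  rw [e2]
  set Y := Q * Real.exp (-η * y) with hY
  have hY0 : 0 ≤ Y := by positivity
  have h9 : Real.exp 1 ≤ Real.exp 9 := Real.exp_le_exp.2 (by norm_num)
  have h10 : 2 * Real.exp 9 ≤ Real.exp 10 := by
    rw [show (10 : ℝ) = 1 + 9 by norm_num, Real.exp_add]
    gcongr
    linarith [Real.add_one_le_exp (1 : ℝ)]
  have hYη : Y ≤ Y / η := by rw [le_div_iff₀ hη]; nlinarith
  have hn : ‖J + 2 * Real.pi * F 0 - R - J‖ ≤ 4 * Real.pi * (Real.exp 9 * (Y / η)) := by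
    refine (norm_sub_le _ _).trans ((add_le_add key hJb).trans ?_)
    have a1 : 2 * (3 - -η) * (Q * Real.exp 9 * Real.exp (-η * y)) ≤ 8 * (Real.exp 9 * (Y / η)) := by
      calc _ = 2 * (3 + η) * (Real.exp 9 * Y) := by rw [hY]; ring
        _ ≤ 8 * (Real.exp 9 * (Y / η)) := by
          gcongr
          linarith
    have a2 : Q * Real.exp 1 * Real.exp (-η * y) / η * Real.pi
        ≤ Real.pi * (Real.exp 9 * (Y / η)) := by
      calc _ = Real.pi * (Real.exp 1 * (Y / η)) := by rw [hY]; ring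
        _ ≤ _ := by gcongr
    have a3 : 0 ≤ Real.exp 9 * (Y / η) := by positivity
    nlinarith
  calc _ ≤ 1 / (2 * Real.pi) * (4 * Real.pi * (Real.exp 9 * (Y / η))) := by gcongr
    _ = 2 * Real.exp 9 * (Y / η) := by field_simp; ring
    _ ≤ Real.exp 10 * (Y / η) := by gcongr
    _ = _ := by rw [hY]; ring

theorem norm_smoothWeight_sub_one_le {η V y : ℝ} (hη : 0 < η) (hη1 : η ≤ 1)
    (hV : 1 ≤ V) (hy : 4 * y ≤ V ^ 2) :
    ‖smoothWeight V y - 1‖ ≤ Real.exp 10 * Real.exp (-η * y) / η := by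
  have h := norm_sub_integral_gaussian_le (G := fun _ => 1) (Q := 1) hη hη1 hV hy
    (fun _ _ _ _ => differentiableAt_const _) (fun _ _ _ _ => by simp)
  simp only [one_mul, mul_one] at h
  rwa [norm_sub_rev, smoothWeight]

theorem norm_gaussian_right_le (v y : ℝ) :
    ‖exp ((3 + v * I) * y + (3 + v * I) ^ 2) / (3 + v * I)‖
      ≤ Real.exp 9 * Real.exp (3 * y) * Real.exp (-v ^ 2) := by
  have hn := norm_exp_gaussian 3 v y
  rw [ofReal_ofNat] at hn
  have hw : 1 ≤ ‖(3 : ℂ) + v * I‖ := by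
    have := abs_re_le_norm ((3 : ℂ) + v * I)
    norm_num at this
    linarith
  rw [norm_div, hn, ← Real.exp_add, ← Real.exp_add]
  refine (div_le_self (Real.exp_pos _).le hw).trans (Real.exp_le_exp.2 (by linarith))

/-- Estimating on `Re w = 3` without moving the line shows cubic decay in `n` at `y = log (X/n)`,
enough for absolute convergence even after multiplication by `n`. -/
theorem norm_smoothWeight_le {V : ℝ} (hV : 0 ≤ V) (y : ℝ) :
    ‖smoothWeight V y‖ ≤ Real.exp 9 * Real.exp (3 * y) := by
  rw [smoothWeight, norm_mul]
  have e2 : ‖1 / (2 * (Real.pi : ℂ))‖ = 1 / (2 * Real.pi) := by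
    rw [norm_div, norm_mul, norm_real, Real.norm_of_nonneg Real.pi_pos.le]; simp
  have h1 : ‖∫ v in (-V)..V, exp ((3 + v * I) * y + (3 + v * I) ^ 2) / (3 + v * I)‖
      ≤ Real.exp 9 * Real.exp (3 * y) * Real.pi := by
    refine (intervalIntegral.norm_integral_le_of_norm_le (by linarith)
        (Eventually.of_forall fun v _ => norm_gaussian_right_le v y) (by
          apply Continuous.intervalIntegrable; fun_prop)).trans ?_
    rw [intervalIntegral.integral_const_mul]
    gcongr
    exact integral_exp_neg_sq_le hV
  rw [e2]
  have hpi := Real.pi_pos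
  calc _ ≤ 1 / (2 * Real.pi) * (Real.exp 9 * Real.exp (3 * y) * Real.pi) := by gcongr
    _ = Real.exp 9 * Real.exp (3 * y) / 2 := by field_simp
    _ ≤ _ := half_le_self (by positivity)

/-- Approximation of `ζ(s)^z` by a smoothed Dirichlet series. -/
theorem RiemannHypothesis.norm_zetaPow_sub_tsum_le (hRH : RiemannHypothesis)
    {σ t V M η Q : ℝ} {z : ℂ} (hη : 0 < η) (hη1 : η ≤ 1) (hV : 1 ≤ V) (hM : 4 * M ≤ V ^ 2)
    (hσ : 1 / 2 < σ - η) (ht : V < t)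
    (hQ : ∀ x : ℝ, σ - η ≤ x → ∀ v ∈ Icc (t - V) (t + V), ‖zetaPow (x + v * I) z‖ ≤ Q) :
    ‖zetaPow (σ + t * I) z
      - ∑' n : ℕ, divisorFun z n * smoothWeight V (M - Real.log n) * (n : ℂ) ^ (-(σ + t * I : ℂ))‖
      ≤ Real.exp 10 * Q * Real.exp (-η * M) / η := by
  set s : ℂ := σ + t * I with hs
  have hsre : s.re = σ := by simp [hs]
  have hsim : s.im = t := by simp [hs]
  have hshift : ∀ x v : ℝ, s + ((x : ℂ) + v * I) = ((σ + x : ℝ) : ℂ) + ((t + v : ℝ) : ℂ) * I := by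
    intro x v; rw [hs]; push_cast; ring
  have hdiff : ∀ x ∈ Icc (-η) 3, ∀ v ∈ Icc (-V) V,
      DifferentiableAt ℂ (fun w => zetaPow (s + w) z) ((x : ℂ) + (v : ℂ) * I) := by
    intro x hx v hv
    have h1 : HasDerivAt logZeta (logDeriv riemannZeta (s + ((x : ℂ) + v * I)))
        (s + ((x : ℂ) + v * I)) := by
      refine hRH.hasDerivAt_logZeta ?_ ?_
      · rw [hshift]; simp; linarith [hx.1]
      · rw [hshift]; simp; linarith [hv.1]
    have h2 : DifferentiableAt ℂ (fun w => logZeta (s + w)) ((x : ℂ) + v * I) :=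
      (h1.comp_const_add s _).differentiableAt
    exact (h2.const_mul z).cexp
  have key := norm_sub_integral_gaussian_le (G := fun w => zetaPow (s + w) z) hη hη1 hV hM hdiff
    (Q := Q) (fun x hx v hv => by
      rw [hshift]
      exact hQ _ (by linarith [hx.1]) _ ⟨by linarith [hv.1], by linarith [hv.2]⟩)
  simp only [add_zero] at key
  refine le_trans (le_of_eq ?_) key
  congr 2
  have hsum := summable_norm_divisorFun_and_tsum_le (norm_nonneg z)
  -- On `Re w = 3` the series for `ζ(s+w)^z` converges absolutely and can be integrated term by
  -- term.
  have h1 := intervalIntegral.hasSum_integral_of_dominated_convergence (a := -V) (b := V)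
    (μ := volume) (F := fun (n : ℕ) (v : ℝ) => divisorFun z n * (n : ℂ) ^ (-(s + (3 + v * I)))
      * exp ((3 + v * I) * M + (3 + v * I) ^ 2) / (3 + v * I))
    (f := fun v : ℝ => zetaPow (s + (3 + v * I)) z
      * exp ((3 + v * I) * M + (3 + v * I) ^ 2) / (3 + v * I))
    (fun n v => ‖divisorFun ‖z‖ n‖ * ((n : ℝ) ^ 2)⁻¹ * (Real.exp 9 * Real.exp (3 * M)))
    (fun n => by
      have : Continuous (fun v : ℝ => divisorFun z n * (n : ℂ) ^ (-(s + (3 + v * I)))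
          * exp ((3 + v * I) * M + (3 + v * I) ^ 2) / (3 + v * I)) := by
        have hne : ∀ v : ℝ, (3 : ℂ) + v * I ≠ 0 := fun v h => by
          have := congrArg re h
          norm_num at this
        rcases Nat.eq_zero_or_pos n with rfl | hn
        · simp only [divisorFun_zero, zero_mul, zero_div]; exact continuous_const
        · have hn0 : (n : ℂ) ≠ 0 := by exact_mod_cast hn.ne'
          have : Continuous (fun v : ℝ => (n : ℂ) ^ (-(s + (3 + v * I)))) :=
            Continuous.const_cpow (by fun_prop) (Or.inl hn0)
          exact ((continuous_const.mul this).mul (by fun_prop)).div (by fun_prop) hne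
      exact this.aestronglyMeasurable)
    (fun n => Eventually.of_forall fun v _ => by
      rw [mul_div_assoc, norm_mul]
      refine mul_le_mul (norm_divisorFun_mul_cpow_le le_rfl (by
        simp [hsre]; linarith) n) ((norm_gaussian_right_le v M).trans ?_) (norm_nonneg _)
        (by positivity)
      refine mul_le_of_le_one_right (by positivity) (Real.exp_le_one_iff.2 ?_)
      nlinarith [sq_nonneg v])
    (Eventually.of_forall fun v _ => hsum.1.mul_right _)
    (by simp)
    (Eventually.of_forall fun v hv => by
      have hre : 2 ≤ (s + (3 + v * I)).re := by simp [hsre]; linarith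
      have him : 0 < (s + (3 + v * I)).im := by
        have : v ∈ Ioc (-V) V := by rwa [uIoc_of_le (by linarith)] at hv
        simp [hsim]; linarith [this.1]
      have hS : Summable (fun n : ℕ => divisorFun z n * (n : ℂ) ^ (-(s + (3 + v * I)))) :=
        Summable.of_norm (Summable.of_nonneg_of_le (fun _ => norm_nonneg _)
          (norm_divisorFun_mul_cpow_le le_rfl hre) hsum.1)
      have h2 := hS.hasSum
      rw [hRH.tsum_divisorFun_mul_cpow hre him] at h2
      exact (h2.mul_right _).div_const _)
  rw [← h1.tsum_eq, ← tsum_mul_left]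
  refine tsum_congr fun n => ?_
  rcases Nat.eq_zero_or_pos n with rfl | hn
  · simp [divisorFun_zero]
  · have hn0 : (n : ℂ) ≠ 0 := by exact_mod_cast hn.ne'
    rw [smoothWeight]
    have e : ∀ v : ℝ, divisorFun z n * (n : ℂ) ^ (-(s + (3 + v * I)))
        * exp ((3 + v * I) * M + (3 + v * I) ^ 2) / (3 + v * I)
        = divisorFun z n * (n : ℂ) ^ (-s) * (exp ((3 + v * I) * ((M - Real.log n : ℝ) : ℂ)
          + (3 + v * I) ^ 2) / (3 + v * I)) := by
      intro v
      rw [neg_add, cpow_add _ _ hn0, cpow_def_of_ne_zero hn0 (-(3 + v * I)), ← natCast_log]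
      have : exp ((3 + v * I) * ((M - Real.log n : ℝ) : ℂ) + (3 + v * I) ^ 2)
          = exp ((Real.log n : ℂ) * -(3 + v * I)) * exp ((3 + v * I) * M + (3 + v * I) ^ 2) := by
        rw [← exp_add]; congr 1; push_cast; ring
      rw [this]
      ring
    rw [intervalIntegral.integral_congr (fun v _ => e v), intervalIntegral.integral_const_mul]
    ring

/-! ### Mean values of products of Dirichlet series. -/

/-- For `m < n` one has `log (n/m) ≥ 1 - m/n ≥ 1/n`. The weaker bound `m * n` is symmetric and
factorises in the double sum. -/
theorem inv_abs_log_sub_log_le {m n : ℕ} (hm : 0 < m) (hn : 0 < n) (h : m ≠ n) :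
    |Real.log n - Real.log m|⁻¹ ≤ m * n := by
  wlog hlt : m < n generalizing m n
  · rw [abs_sub_comm, mul_comm]
    exact this hn hm h.symm (by omega)
  have hm' : (1 : ℝ) ≤ m := by exact_mod_cast hm
  have hn' : (m : ℝ) + 1 ≤ n := by exact_mod_cast hlt
  have hn0 : (0 : ℝ) < n := by linarith
  have h1 := Real.one_sub_inv_le_log_of_pos (x := (n : ℝ) / m) (by positivity)
  rw [Real.log_div (by positivity) (by positivity), inv_div] at h1
  have h2 : 1 / (n : ℝ) ≤ 1 - m / n := by
    rw [le_sub_iff_add_le, ← add_div, div_le_one hn0]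
    linarith
  have h3 : 1 / (n : ℝ) ≤ |Real.log n - Real.log m| := (h2.trans h1).trans (le_abs_self _)
  calc _ ≤ (1 / (n : ℝ))⁻¹ := inv_anti₀ (by positivity) h3
    _ = 1 * n := by rw [one_div, inv_inv, one_mul]
    _ ≤ m * n := by gcongr

theorem norm_integral_cpow_mul_cpow_sub_le {m n : ℕ} (hm : 0 < m) (hn : 0 < n) {T : ℝ} :
    ‖(∫ t in T..(2 * T), (m : ℂ) ^ (-(t * I)) * (n : ℂ) ^ (t * I))
      - if m = n then (T : ℂ) else 0‖ ≤ 2 * (m * n) := by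
  have hm0 : (m : ℂ) ≠ 0 := by exact_mod_cast hm.ne'
  have hn0 : (n : ℂ) ≠ 0 := by exact_mod_cast hn.ne'
  have e : ∀ t : ℝ, (m : ℂ) ^ (-(t * I)) * (n : ℂ) ^ (t * I)
      = exp (((Real.log n - Real.log m : ℝ) : ℂ) * I * t) := by
    intro t
    rw [cpow_def_of_ne_zero hm0, cpow_def_of_ne_zero hn0, ← exp_add, ← natCast_log, ← natCast_log]
    congr 1
    push_cast
    ring
  simp only [e]
  split_ifs with h
  · subst h
    have : (2 * T - T : ℝ) = T := by ring
    simp [this]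
    positivity
  · rw [sub_zero]
    have hθ : Real.log n - Real.log m ≠ 0 := by
      intro h0
      have h1 := Real.log_injOn_pos (x₁ := (n : ℝ)) (x₂ := m) (by simpa using hn) (by simpa using hm)
        (sub_eq_zero.1 h0)
      exact h (by exact_mod_cast h1.symm)
    have hθ' : (((Real.log n - Real.log m : ℝ) : ℂ) * I) ≠ 0 :=
      mul_ne_zero (by exact_mod_cast hθ) I_ne_zero
    rw [integral_exp_mul_complex hθ', norm_div, norm_mul, norm_I, mul_one, norm_real,
      Real.norm_eq_abs, div_eq_mul_inv]
    have hu : ∀ x : ℝ, ‖exp (((Real.log n - Real.log m : ℝ) : ℂ) * I * x)‖ = 1 := by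
      intro x
      rw [show ((Real.log n - Real.log m : ℝ) : ℂ) * I * x
        = (((Real.log n - Real.log m) * x : ℝ) : ℂ) * I by push_cast; ring]
      exact norm_exp_ofReal_mul_I _
    have h2 := (norm_sub_le (exp (((Real.log n - Real.log m : ℝ) : ℂ) * I * ((2 * T : ℝ) : ℂ)))
      (exp (((Real.log n - Real.log m : ℝ) : ℂ) * I * T)))
    rw [hu, hu] at h2
    exact mul_le_mul (h2.trans (by norm_num)) (inv_abs_log_sub_log_le hm hn h) (by positivity)
      (by norm_num)

/-- The mean value of the product of two absolutely convergent Dirichlet series. -/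
theorem norm_mean_mul_sub_tsum_le {a b : ℕ → ℂ} (ha0 : a 0 = 0) (hb0 : b 0 = 0) {T : ℝ}
    (hT : 0 < T) (ha : Summable fun n => ‖a n‖ * n) (hb : Summable fun n => ‖b n‖ * n) :
    ‖1 / (T : ℂ) * (∫ t in T..(2 * T),
        (∑' n : ℕ, a n * (n : ℂ) ^ (-(t * I))) * ∑' n : ℕ, b n * (n : ℂ) ^ (t * I))
      - ∑' n, a n * b n‖ ≤ 2 / T * ((∑' n, ‖a n‖ * n) * ∑' n, ‖b n‖ * n) := by
  have hnorm : ∀ c : ℕ → ℂ, c 0 = 0 → ∀ n, ‖c n‖ ≤ ‖c n‖ * n := by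
    intro c hc n
    rcases Nat.eq_zero_or_pos n with rfl | hn
    · simp [hc]
    · exact le_mul_of_one_le_right (norm_nonneg _) (by exact_mod_cast hn)
  have ha' : Summable fun n => ‖a n‖ :=
    Summable.of_nonneg_of_le (fun _ => norm_nonneg _) (hnorm a ha0) ha
  have hb' : Summable fun n => ‖b n‖ :=
    Summable.of_nonneg_of_le (fun _ => norm_nonneg _) (hnorm b hb0) hb
  have hterm : ∀ c : ℕ → ℂ, c 0 = 0 → ∀ (n : ℕ) (x : ℝ), ‖c n * (n : ℂ) ^ ((x : ℂ) * I)‖ ≤ ‖c n‖ := by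
    intro c hc n x
    rcases Nat.eq_zero_or_pos n with rfl | hn
    · simp [hc]
    · rw [norm_mul, norm_natCast_cpow_of_pos hn]
      simp
  have hneg : ∀ t : ℝ, -((t : ℂ) * I) = ((-t : ℝ) : ℂ) * I := fun t => by push_cast; ring
  have hterm' : ∀ c : ℕ → ℂ, c 0 = 0 → ∀ (n : ℕ) (x : ℝ), ‖c n * (n : ℂ) ^ (-((x : ℂ) * I))‖ ≤ ‖c n‖ := by
    intro c hc n x
    rw [hneg]
    exact hterm c hc n _
  have hcont : ∀ c : ℕ → ℂ, c 0 = 0 → ∀ n : ℕ,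
      Continuous (fun t : ℝ => c n * (n : ℂ) ^ ((t : ℂ) * I)) := by
    intro c hc n
    rcases Nat.eq_zero_or_pos n with rfl | hn
    · simp only [hc, zero_mul]; exact continuous_const
    · exact continuous_const.mul (Continuous.const_cpow (by fun_prop)
        (Or.inl (by exact_mod_cast hn.ne')))
  have h1 := intervalIntegral.hasSum_integral_of_dominated_convergence (a := T) (b := 2 * T)
    (μ := volume) (F := fun (p : ℕ × ℕ) (t : ℝ) =>
      (a p.1 * (p.1 : ℂ) ^ (-(t * I))) * (b p.2 * (p.2 : ℂ) ^ (t * I)))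
    (f := fun t : ℝ => (∑' n : ℕ, a n * (n : ℂ) ^ (-(t * I))) * ∑' n : ℕ, b n * (n : ℂ) ^ (t * I))
    (fun p _ => ‖a p.1‖ * ‖b p.2‖)
    (fun p => by
      refine Continuous.aestronglyMeasurable (Continuous.mul ?_ (hcont b hb0 p.2))
      have := (hcont a ha0 p.1).comp continuous_neg
      refine this.congr fun t => ?_
      simp only [Function.comp, hneg])
    (fun p => Eventually.of_forall fun t _ => by
      rw [norm_mul]
      exact mul_le_mul (hterm' a ha0 _ _) (hterm b hb0 _ _) (norm_nonneg _) (norm_nonneg _))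
    (Eventually.of_forall fun t _ => ha'.mul_of_nonneg hb' (fun _ => norm_nonneg _)
      fun _ => norm_nonneg _)
    (by simp)
    (Eventually.of_forall fun t _ => by
      have s1 : Summable fun n : ℕ => ‖a n * (n : ℂ) ^ (-((t : ℂ) * I))‖ :=
        Summable.of_nonneg_of_le (fun _ => norm_nonneg _) (fun n => hterm' a ha0 n t) ha'
      have s2 : Summable fun n : ℕ => ‖b n * (n : ℂ) ^ ((t : ℂ) * I)‖ :=
        Summable.of_nonneg_of_le (fun _ => norm_nonneg _) (fun n => hterm b hb0 n t) hb'
      rw [tsum_mul_tsum_of_summable_norm s1 s2]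
      exact (summable_mul_of_summable_norm s1 s2).hasSum)
  have hab : Summable fun n => a n * b n := by
    have h := (summable_mul_of_summable_norm ha' hb').comp_injective
      (i := fun n : ℕ => (n, n)) (fun x y h => (Prod.mk.inj h).1)
    exact h
  -- The diagonal is written as a family on all pairs, so that it can be subtracted from the double
  -- series term by term.
  have h2 : HasSum (fun p : ℕ × ℕ => if p.1 = p.2 then (T : ℂ) * (a p.1 * b p.2) else 0)
      ((T : ℂ) * ∑' n, a n * b n) := by
    have hinj : Function.Injective (fun n : ℕ => (n, n)) := fun x y h => (Prod.mk.inj h).1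
    rw [← hinj.hasSum_iff]
    · refine (hab.hasSum.mul_left (T : ℂ)).congr_fun fun n => ?_
      simp
    · rintro ⟨m, n⟩ hmn
      have : m ≠ n := by
        rintro rfl
        exact hmn ⟨m, rfl⟩
      simp [this]
  have h3 := h1.sub h2
  have h4 : Summable fun p : ℕ × ℕ => (‖a p.1‖ * p.1) * (‖b p.2‖ * p.2) :=
    ha.mul_of_nonneg hb (fun _ => by positivity) fun _ => by positivity
  have hsum4 : ∑' p : ℕ × ℕ, (‖a p.1‖ * p.1) * (‖b p.2‖ * p.2)
      = (∑' n, ‖a n‖ * n) * ∑' n, ‖b n‖ * n :=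
    (ha.tsum_mul_tsum hb h4).symm
  have h5 := tsum_of_norm_bounded (h4.hasSum.mul_left 2) (f := fun p : ℕ × ℕ =>
      (∫ t in T..(2 * T), (a p.1 * (p.1 : ℂ) ^ (-(t * I))) * (b p.2 * (p.2 : ℂ) ^ (t * I)))
        - if p.1 = p.2 then (T : ℂ) * (a p.1 * b p.2) else 0) (by
    rintro ⟨m, n⟩
    simp only
    rcases Nat.eq_zero_or_pos m with rfl | hm
    · simp [ha0]
    rcases Nat.eq_zero_or_pos n with rfl | hn
    · simp [hb0]
    have e : (∫ t in T..(2 * T), (a m * (m : ℂ) ^ (-(t * I))) * (b n * (n : ℂ) ^ (t * I)))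
        - (if m = n then (T : ℂ) * (a m * b n) else 0)
        = a m * b n * ((∫ t in T..(2 * T), (m : ℂ) ^ (-(t * I)) * (n : ℂ) ^ (t * I))
          - if m = n then (T : ℂ) else 0) := by
      rw [mul_sub, ← intervalIntegral.integral_const_mul]
      congr 1
      · refine intervalIntegral.integral_congr fun t _ => ?_
        ring
      · split_ifs <;> ring
    rw [e, norm_mul, norm_mul]
    have := mul_le_mul_of_nonneg_left (norm_integral_cpow_mul_cpow_sub_le hm hn (T := T))
      (mul_nonneg (norm_nonneg (a m)) (norm_nonneg (b n)))
    exact this.trans_eq (by ring))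
  rw [h3.tsum_eq, hsum4] at h5
  have hT' : (T : ℂ) ≠ 0 := by exact_mod_cast hT.ne'
  have e2 : ∀ J S : ℂ, 1 / (T : ℂ) * J - S = 1 / T * (J - T * S) := fun J S => by field_simp
  rw [e2, norm_mul]
  have e3 : ‖1 / (T : ℂ)‖ = 1 / T := by
    rw [norm_div, norm_real, Real.norm_of_nonneg hT.le]; simp
  rw [e3]
  calc _ ≤ 1 / T * (2 * ((∑' n, ‖a n‖ * n) * ∑' n, ‖b n‖ * n)) := by gcongr
    _ = _ := by ring

/-! ### The size of the sum of `d_κ(n)² n^(-2σ)`. -/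

theorem sum_Ioc_rpow_neg_one_sub_le {α : ℝ} (hα : 0 < α) {M : ℕ} (hM : 1 ≤ M) (N : ℕ) :
    ∑ n ∈ Finset.Ioc M N, (n : ℝ) ^ (-(1 + α)) ≤ (M : ℝ) ^ (-α) / α := by
  have step : ∀ n : ℕ, 1 ≤ n → α * ((n + 1 : ℕ) : ℝ) ^ (-(1 + α))
      ≤ (n : ℝ) ^ (-α) - ((n + 1 : ℕ) : ℝ) ^ (-α) := by
    intro n hn
    have hn0 : (0 : ℝ) < n := by exact_mod_cast hn
    set x : ℝ := ((n + 1 : ℕ) : ℝ) with hx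
    have hx1 : x = n + 1 := by push_cast [hx]; rfl
    have hx0 : 0 < x := by linarith
    have e1 : (n : ℝ) = x * (1 - 1 / x) := by field_simp; linarith
    have hpos : 0 < 1 - 1 / x := by
      rw [sub_pos, div_lt_one hx0]; linarith
    have h1 : 1 + α / x ≤ (1 - 1 / x) ^ (-α) := by
      have h2 : 1 - 1 / x ≤ Real.exp (-(1 / x)) := by linarith [Real.add_one_le_exp (-(1 / x))]
      have h3 := Real.rpow_le_rpow_of_nonpos hpos h2 (neg_nonpos.2 hα.le)
      rw [← Real.exp_mul] at h3
      have h4 := Real.add_one_le_exp (-(1 / x) * -α)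
      have e : -(1 / x) * -α = α / x := by ring
      rw [e] at h4 h3
      linarith
    have e2 : x ^ (-(1 + α)) = x ^ (-α) / x := by
      rw [neg_add, add_comm, Real.rpow_add hx0, Real.rpow_neg_one]; rfl
    rw [e1, Real.mul_rpow hx0.le hpos.le, e2]
    have : 0 < x ^ (-α) := by positivity
    calc α * (x ^ (-α) / x) = x ^ (-α) * (1 + α / x) - x ^ (-α) := by ring
      _ ≤ _ := by gcongr
  have key : ∀ k : ℕ, ∑ n ∈ Finset.Ioc M (M + k), (n : ℝ) ^ (-(1 + α))
      ≤ ((M : ℝ) ^ (-α) - ((M + k : ℕ) : ℝ) ^ (-α)) / α := by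
    intro k
    induction k with
    | zero => simp
    | succ k ih =>
      rw [← add_assoc, Finset.sum_Ioc_succ_top (by omega)]
      have := step (M + k) (by omega)
      rw [mul_comm, ← le_div_iff₀ hα] at this
      calc _ ≤ _ := add_le_add ih this
        _ = _ := by ring
  rcases le_total M N with h | h
  · obtain ⟨k, rfl⟩ := Nat.exists_eq_add_of_le h
    refine (key k).trans ?_
    gcongr
    have : (0 : ℝ) ≤ ((M + k : ℕ) : ℝ) ^ (-α) := by positivity
    linarith
  · rw [Finset.Ioc_eq_empty (by omega)]
    simp only [Finset.sum_empty]
    positivity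

theorem norm_divisorLocal_le_pow {κ : ℝ} (hκ : 1 ≤ κ) (a : ℕ) : ‖divisorLocal κ a‖ ≤ κ ^ a := by
  have h0 : 0 ≤ κ := by linarith
  induction a with
  | zero => simp [divisorLocal]
  | succ a ih =>
    have e : divisorLocal κ (a + 1) = divisorLocal κ a * ((κ + a) / (a + 1)) := by
      have : (a.factorial : ℂ) ≠ 0 := by exact_mod_cast a.factorial_ne_zero
      have h1 : (a : ℂ) + 1 ≠ 0 := by exact_mod_cast a.succ_ne_zero
      rw [divisorLocal, divisorLocal, Finset.prod_range_succ, Nat.factorial_succ]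
      push_cast
      field_simp
    have h2 : ‖((κ : ℂ) + a) / (a + 1)‖ = (κ + a) / (a + 1) := by
      rw [show ((κ : ℂ) + a) / (a + 1) = (((κ + a) / (a + 1) : ℝ) : ℂ) by push_cast; rfl,
        norm_real, Real.norm_of_nonneg (by positivity)]
    rw [e, norm_mul, h2, pow_succ]
    refine mul_le_mul ih ?_ (by positivity) (by positivity)
    rw [div_le_iff₀ (by positivity)]
    have : (0 : ℝ) ≤ a := by positivity
    nlinarith

/-- Bounds for the local factors of `∑ d_κ(n)² n^{-2σ}`: summability, and the estimates which are
used at the small and at the large primes. -/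
theorem divisorLocal_sq_local_factor {κ u : ℝ} (hκ : 1 ≤ κ) (hu : 0 ≤ u) (hu1 : u ≤ 3 / 4) :
    Summable (fun e : ℕ => (‖divisorLocal κ e‖ * u ^ e) ^ 2) ∧
      ∑' e : ℕ, (‖divisorLocal κ e‖ * u ^ e) ^ 2 ≤ Real.exp (8 * κ * u) ∧
      (κ * u ≤ 1 / 2 →
        ∑' e : ℕ, (‖divisorLocal κ e‖ * u ^ e) ^ 2 ≤ Real.exp (2 * (κ * u) ^ 2)) := by
  have hκ0 : 0 ≤ κ := by linarith
  have h := hasSum_norm_divisorLocal_mul_pow hκ0 hu (by linarith)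
  set S := Real.exp (κ * -Real.log (1 - u)) with hS
  -- Each term is at most the whole sum `S`, so the sum of squares is at most `S²`; this suffices at
  -- small primes.
  have hle : ∀ e, (‖divisorLocal κ e‖ * u ^ e) ^ 2 ≤ S * (‖divisorLocal κ e‖ * u ^ e) := by
    intro e
    rw [sq]
    gcongr
    exact le_hasSum h e fun _ _ => by positivity
  have hsum : Summable (fun e : ℕ => (‖divisorLocal κ e‖ * u ^ e) ^ 2) :=
    Summable.of_nonneg_of_le (fun _ => by positivity) hle (h.summable.mul_left S)
  refine ⟨hsum, ?_, fun hκu => ?_⟩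
  · calc _ ≤ ∑' e, S * (‖divisorLocal κ e‖ * u ^ e) :=
          hsum.tsum_le_tsum hle (h.summable.mul_left S)
      _ = S * S := by rw [tsum_mul_left, h.tsum_eq]
      _ = Real.exp (2 * κ * -Real.log (1 - u)) := by rw [hS, ← Real.exp_add]; congr 1; ring
      _ ≤ _ := by
        refine Real.exp_le_exp.2 ?_
        have h1 : -Real.log (1 - u) ≤ 4 * u := by
          refine (neg_log_one_sub_le (by linarith)).trans ?_
          rw [div_le_iff₀ (by linarith)]
          nlinarith
        calc _ ≤ 2 * κ * (4 * u) := by gcongr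
          _ = _ := by ring
  · have hq : (κ * u) ^ 2 ≤ 1 / 4 := by
      have : 0 ≤ κ * u := by positivity
      nlinarith
    have hg := hasSum_geometric_of_lt_one (sq_nonneg (κ * u)) (by linarith)
    calc _ ≤ ∑' e : ℕ, ((κ * u) ^ 2) ^ e := by
          refine hsum.tsum_le_tsum (fun e => ?_) hg.summable
          rw [← pow_mul, mul_comm 2 e, pow_mul, mul_pow κ u e]
          gcongr
          exact norm_divisorLocal_le_pow hκ e
      _ = (1 - (κ * u) ^ 2)⁻¹ := hg.tsum_eq
      _ ≤ 2 * (κ * u) ^ 2 + 1 := by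
          have h0 := sq_nonneg (κ * u)
          generalize (κ * u) ^ 2 = q at *
          rw [inv_le_iff_one_le_mul₀ (by linarith)]
          nlinarith
      _ ≤ _ := Real.add_one_le_exp _

/-- Primes are split near `Y`. Up to there an Euler factor costs an exponent of order `κ p^(-σ)`.
Beyond, the hypothesis on `κ` forces `κ p^(-σ) ≤ 1/2`, and the cost drops to `2 κ² p^(-2σ)`. Both
costs are summed over all integers instead of primes. -/
theorem summable_and_tsum_divisorFun_sq_le {κ σ Y : ℝ} (hκ : 1 ≤ κ) (hσ : 1 / 2 < σ) (hσ1 : σ < 1)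
    (hY : 1 ≤ Y) (hκY : κ ≤ Y ^ (2 * σ - 1) / 2) :
    Summable (fun n : ℕ => ‖divisorFun κ n‖ ^ 2 * (n : ℝ) ^ (-(2 * σ))) ∧
      ∑' n : ℕ, ‖divisorFun κ n‖ ^ 2 * (n : ℝ) ^ (-(2 * σ))
        ≤ Real.exp (8 * Y ^ σ / (1 - σ) + Y ^ (2 * σ - 1) / (2 * σ - 1)) := by
  have hκ0 : 0 ≤ κ := by linarith
  have hY0 : 0 < Y := by linarith
  set M := ⌈Y⌉₊ with hMdef
  have hYM : Y ≤ M := Nat.le_ceil Y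
  have hM2 : (M : ℝ) ≤ 2 * Y := by linarith [Nat.ceil_lt_add_one hY0.le]
  have hM1 : 1 ≤ M := Nat.one_le_iff_ne_zero.2 fun h => by rw [h] at hYM; norm_num at hYM; linarith
  have hu34 : ∀ p : ℕ, p.Prime → (p : ℝ) ^ (-σ) ≤ 3 / 4 := by
    intro p hp
    have hp2 : (2 : ℝ) ≤ p := by exact_mod_cast hp.two_le
    calc (p : ℝ) ^ (-σ) ≤ 2 ^ (-σ) :=
          Real.rpow_le_rpow_of_nonpos two_pos hp2 (by linarith)
      _ ≤ 2 ^ (-(1 / 2 : ℝ)) := Real.rpow_le_rpow_of_exponent_le (by norm_num) (by linarith)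
      _ = (√2)⁻¹ := by rw [Real.rpow_neg two_pos.le, ← Real.sqrt_eq_rpow]
      _ ≤ 3 / 4 := by
        rw [inv_le_comm₀ (by positivity) (by norm_num)]
        exact Real.le_sqrt_of_sq_le (by norm_num)
  have hloc : ∀ p : ℕ, p.Prime → ∀ e : ℕ,
      ‖divisorFun κ (p ^ e)‖ ^ 2 * ((p ^ e : ℕ) : ℝ) ^ (-(2 * σ))
        = (‖divisorLocal κ e‖ * ((p : ℝ) ^ (-σ)) ^ e) ^ 2 := by
    intro p hp e
    have hp0 : (0 : ℝ) ≤ p := by positivity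
    rw [divisorFun_prime_pow _ hp, mul_pow]
    congr 1
    push_cast
    rw [← Real.rpow_natCast (p : ℝ) e, ← Real.rpow_mul hp0, ← pow_mul,
      ← Real.rpow_natCast _ (e * 2), ← Real.rpow_mul hp0]
    congr 1
    push_cast
    ring
  set U : ℕ → ℝ := fun p => if p ≤ M then 8 * κ * (p : ℝ) ^ (-σ) else
    2 * κ ^ 2 * (p : ℝ) ^ (-(1 + (2 * σ - 1))) with hU
  refine summable_and_tsum_le_exp_of_multiplicative (u := U)
    (by simp [divisorFun_zero]) (by simp [divisorFun_one]) (fun {m n} h => ?_)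
    (fun n => by positivity) (fun p hp => ?_) (fun p hp => ?_) (fun N => ?_)
  · rw [divisorFun_mul_of_coprime _ h, norm_mul]
    push_cast
    rw [Real.mul_rpow (by positivity) (by positivity)]
    ring
  · simp only [hloc p hp]
    exact (divisorLocal_sq_local_factor hκ (by positivity) (hu34 p hp)).1
  · simp only [hloc p hp]
    obtain ⟨-, h1, h2⟩ := divisorLocal_sq_local_factor hκ (u := (p : ℝ) ^ (-σ)) (by positivity)
      (hu34 p hp)
    simp only [hU]
    split_ifs with hpM
    · exact h1
    · have hpY : Y ≤ p := hYM.trans (by exact_mod_cast (not_le.1 hpM).le)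
      have hp0 : (0 : ℝ) < p := by linarith
      refine (h2 ?_).trans_eq ?_
      · calc κ * (p : ℝ) ^ (-σ) ≤ Y ^ (2 * σ - 1) / 2 * Y ^ (-σ) := by
              gcongr ?_ * ?_
              exact Real.rpow_le_rpow_of_nonpos hY0 hpY (by linarith)
          _ = Y ^ (σ - 1) / 2 := by
              rw [div_mul_eq_mul_div, ← Real.rpow_add hY0]; congr 2; ring
          _ ≤ 1 / 2 := by
              gcongr
              exact Real.rpow_le_one_of_one_le_of_nonpos hY (by linarith)
      · congr 1
        rw [mul_pow, ← Real.rpow_natCast ((p : ℝ) ^ (-σ)) 2, ← Real.rpow_mul hp0.le, mul_assoc]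
        congr 3
        push_cast
        ring
  · have hU0 : ∀ p, 0 ≤ U p := fun p => by
      simp only [hU]; split_ifs <;> positivity
    have hsub : N.primesBelow ⊆ Finset.Ioc 0 M ∪ Finset.Ioc M (M + N) := by
      intro p hp
      have h1 := (Nat.prime_of_mem_primesBelow hp).pos
      have h2 := Nat.lt_of_mem_primesBelow hp
      rw [Finset.mem_union, Finset.mem_Ioc, Finset.mem_Ioc]
      omega
    have hdisj : Disjoint (Finset.Ioc 0 M) (Finset.Ioc M (M + N)) := by
      rw [Finset.disjoint_left]
      intro a ha hb
      rw [Finset.mem_Ioc] at ha hb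
      omega
    have a1 : ∑ p ∈ Finset.Ioc 0 M, U p ≤ 8 * Y ^ σ / (1 - σ) := by
      have e : ∑ p ∈ Finset.Ioc 0 M, U p
          = 8 * κ * ∑ i ∈ Finset.range M, ((i + 1 : ℕ) : ℝ) ^ (-σ) := by
        rw [Finset.mul_sum, Finset.range_eq_Ico,
          Finset.sum_Ico_add' (fun n : ℕ => 8 * κ * (n : ℝ) ^ (-σ)) 0 M 1]
        refine Finset.sum_congr ?_ fun p hp => ?_
        · ext; simp [Finset.mem_Ioc, Finset.mem_Ico]; omega
        · rw [Finset.mem_Ico] at hp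
          simp only [hU]
          rw [if_pos (by omega)]
      rw [e]
      have h1 := sum_range_succ_rpow_neg_le (by linarith : 0 ≤ σ) hσ1 M
      have h2 : (M : ℝ) ^ (1 - σ) ≤ 2 * Y ^ (1 - σ) := by
        calc (M : ℝ) ^ (1 - σ) ≤ (2 * Y) ^ (1 - σ) :=
              Real.rpow_le_rpow (by positivity) hM2 (by linarith)
          _ = 2 ^ (1 - σ) * Y ^ (1 - σ) := Real.mul_rpow two_pos.le hY0.le
          _ ≤ 2 ^ (1 : ℝ) * Y ^ (1 - σ) := by
              gcongr
              · norm_num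
              · linarith
          _ = _ := by rw [Real.rpow_one]
      have h3 : 0 < 1 - σ := by linarith
      calc _ ≤ 8 * (Y ^ (2 * σ - 1) / 2) * (2 * Y ^ (1 - σ) / (1 - σ)) := by
            gcongr
            exact h1.trans (by gcongr)
        _ = 8 * (Y ^ (2 * σ - 1) * Y ^ (1 - σ)) / (1 - σ) := by ring
        _ = _ := by rw [← Real.rpow_add hY0]; congr 3; ring
    have a2 : ∑ p ∈ Finset.Ioc M (M + N), U p ≤ Y ^ (2 * σ - 1) / (2 * σ - 1) := by
      have hα : 0 < 2 * σ - 1 := by linarith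
      have e : ∑ p ∈ Finset.Ioc M (M + N), U p
          = 2 * κ ^ 2 * ∑ n ∈ Finset.Ioc M (M + N), (n : ℝ) ^ (-(1 + (2 * σ - 1))) := by
        rw [Finset.mul_sum]
        refine Finset.sum_congr rfl fun p hp => ?_
        rw [Finset.mem_Ioc] at hp
        simp only [hU]
        rw [if_neg (by omega)]
      rw [e]
      have h2 : (M : ℝ) ^ (-(2 * σ - 1)) ≤ Y ^ (-(2 * σ - 1)) :=
        Real.rpow_le_rpow_of_nonpos hY0 hYM (by linarith)
      calc _ ≤ 2 * (Y ^ (2 * σ - 1) / 2) ^ 2 * (Y ^ (-(2 * σ - 1)) / (2 * σ - 1)) := by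
            gcongr
            exact (sum_Ioc_rpow_neg_one_sub_le hα hM1 _).trans (by gcongr)
        _ = Y ^ (2 * σ - 1) * (Y ^ (2 * σ - 1) * Y ^ (-(2 * σ - 1))) / (2 * σ - 1) / 2 := by ring
        _ = Y ^ (2 * σ - 1) / (2 * σ - 1) / 2 := by
            rw [← Real.rpow_add hY0, add_neg_cancel, Real.rpow_zero, mul_one]
        _ ≤ _ := half_le_self (by positivity)
    calc _ ≤ ∑ p ∈ Finset.Ioc 0 M ∪ Finset.Ioc M (M + N), U p :=
          Finset.sum_le_sum_of_subset_of_nonneg hsub fun _ _ _ => hU0 _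
      _ = _ := Finset.sum_union hdisj
      _ ≤ _ := add_le_add a1 a2

/-! ### From the smoothed series to the mean value formula. -/

theorem conj_natCast_cpow {n : ℕ} (hn : 0 < n) (w : ℂ) :
    starRingEnd ℂ ((n : ℂ) ^ w) = (n : ℂ) ^ (starRingEnd ℂ w) := by
  have hn0 : (n : ℂ) ≠ 0 := by exact_mod_cast hn.ne'
  rw [cpow_def_of_ne_zero hn0, cpow_def_of_ne_zero hn0, ← exp_conj, map_mul, ← natCast_log,
    conj_ofReal]

theorem norm_mul_conj_sub_one_le (w : ℂ) :
    ‖w * starRingEnd ℂ w - 1‖ ≤ ‖w - 1‖ * (‖w - 1‖ + 2) := by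
  have e : w * starRingEnd ℂ w - 1 = (w - 1) * starRingEnd ℂ w + starRingEnd ℂ (w - 1) := by
    rw [map_sub, map_one]; ring
  have h1 : ‖w‖ ≤ ‖w - 1‖ + 1 := by
    calc ‖w‖ = ‖(w - 1) + 1‖ := by rw [sub_add_cancel]
      _ ≤ _ := (norm_add_le _ _).trans (by simp)
  rw [e]
  refine (norm_add_le _ _).trans ?_
  rw [norm_mul, norm_conj, norm_conj]
  nlinarith [norm_nonneg (w - 1)]

/-- The terms of the main term of the mean value. -/
theorem norm_divisorFun_mul_div_le {z₁ z₂ : ℂ} {κ : ℝ} (h₁ : ‖z₁‖ ≤ κ) (h₂ : ‖z₂‖ ≤ κ) (σ : ℝ)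
    (n : ℕ) :
    ‖divisorFun z₁ n * divisorFun z₂ n / (((n : ℝ) ^ (2 * σ) : ℝ) : ℂ)‖
      ≤ ‖divisorFun κ n‖ ^ 2 * (n : ℝ) ^ (-(2 * σ)) := by
  rw [norm_div, norm_mul, norm_real, Real.norm_of_nonneg (by positivity),
    Real.rpow_neg (by positivity), ← div_eq_mul_inv, sq]
  gcongr
  · exact norm_divisorFun_le h₁ n
  · exact norm_divisorFun_le h₂ n

theorem rpow_neg_two_mul_le (σ : ℝ) {η : ℝ} (hη : 0 ≤ η) {n : ℕ} (hn : 0 < n) :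
    (n : ℝ) ^ (-(2 * σ)) ≤ (n : ℝ) ^ (-(2 * (σ - η))) :=
  Real.rpow_le_rpow_of_exponent_le (by exact_mod_cast hn) (by linarith)

theorem summable_divisorFun_mul_div {z₁ z₂ : ℂ} {κ σ η : ℝ} (h₁ : ‖z₁‖ ≤ κ) (h₂ : ‖z₂‖ ≤ κ)
    (hη : 0 ≤ η)
    (hS : Summable (fun n : ℕ => ‖divisorFun κ n‖ ^ 2 * (n : ℝ) ^ (-(2 * (σ - η))))) :
    Summable (fun n : ℕ => divisorFun z₁ n * divisorFun z₂ n / (((n : ℝ) ^ (2 * σ) : ℝ) : ℂ)) := by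
  refine Summable.of_norm_bounded hS fun n => ?_
  rcases Nat.eq_zero_or_pos n with rfl | hn
  · simp [divisorFun_zero]
  · refine (norm_divisorFun_mul_div_le h₁ h₂ σ n).trans ?_
    gcongr ?_ * ?_
    exact rpow_neg_two_mul_le σ hη hn

/-- For every `n`, large or small, the weight differs from `1` by `O(e^(-ηM) n^η / η)`. The loss of
at most `n^(2η)` in the product of two weights is absorbed by evaluating the dominating series at `σ
- η`; no truncation is needed. -/
theorem norm_tsum_smoothed_sub_tsum_le {z₁ z₂ : ℂ} {κ σ η V M : ℝ} (h₁ : ‖z₁‖ ≤ κ)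
    (h₂ : ‖z₂‖ ≤ κ) (hη : 0 < η) (hη1 : η ≤ 1) (hV : 1 ≤ V) (hM0 : 0 ≤ M) (hM : 4 * M ≤ V ^ 2)
    (hS : Summable (fun n : ℕ => ‖divisorFun κ n‖ ^ 2 * (n : ℝ) ^ (-(2 * (σ - η))))) :
    ‖∑' n : ℕ, (divisorFun z₁ n * divisorFun z₂ n / (((n : ℝ) ^ (2 * σ) : ℝ) : ℂ))
        * (smoothWeight V (M - Real.log n) * starRingEnd ℂ (smoothWeight V (M - Real.log n)))
      - ∑' n : ℕ, divisorFun z₁ n * divisorFun z₂ n / (((n : ℝ) ^ (2 * σ) : ℝ) : ℂ)‖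
      ≤ 3 * Real.exp 20 * Real.exp (-η * M) / η ^ 2 *
        ∑' n : ℕ, ‖divisorFun κ n‖ ^ 2 * (n : ℝ) ^ (-(2 * (σ - η))) := by
  set c : ℕ → ℂ := fun n => divisorFun z₁ n * divisorFun z₂ n / (((n : ℝ) ^ (2 * σ) : ℝ) : ℂ)
    with hc
  set W : ℕ → ℂ := fun n => smoothWeight V (M - Real.log n) with hW
  have hcs : Summable c := summable_divisorFun_mul_div h₁ h₂ hη.le hS
  have hb : ∀ n, ‖c n * (W n * starRingEnd ℂ (W n) - 1)‖
      ≤ 3 * Real.exp 20 * Real.exp (-η * M) / η ^ 2 *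
        (‖divisorFun κ n‖ ^ 2 * (n : ℝ) ^ (-(2 * (σ - η)))) := by
    intro n
    rcases Nat.eq_zero_or_pos n with rfl | hn
    · simp [hc, divisorFun_zero]
    have hn1 : (1 : ℝ) ≤ n := by exact_mod_cast hn
    have hn0 : (0 : ℝ) < n := by linarith
    have hlog : 0 ≤ Real.log n := Real.log_nonneg hn1
    have hD := norm_smoothWeight_sub_one_le hη hη1 hV (y := M - Real.log n) (by linarith)
    have e1 : Real.exp (-η * (M - Real.log n)) = Real.exp (-η * M) * (n : ℝ) ^ η := by
      rw [Real.rpow_def_of_pos hn0, ← Real.exp_add]; congr 1; ring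
    rw [e1] at hD
    set N := (n : ℝ) ^ η with hN
    have hN1 : 1 ≤ N := Real.one_le_rpow hn1 hη.le
    set x := Real.exp (-η * M) with hx
    have hx0 : 0 < x := Real.exp_pos _
    have hx1 : x ≤ 1 := Real.exp_le_one_iff.2 (by nlinarith)
    have hE : Real.exp 20 = Real.exp 10 * Real.exp 10 := by rw [← Real.exp_add]; norm_num
    have hE1 : 1 ≤ Real.exp 10 := Real.one_le_exp (by norm_num)
    have hWW : ‖W n * starRingEnd ℂ (W n) - 1‖ ≤ 3 * Real.exp 20 * x / η ^ 2 * N ^ 2 := by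
      refine (norm_mul_conj_sub_one_le (W n)).trans ?_
      set D := Real.exp 10 * N / η with hDdef
      have hD1 : 1 ≤ D := by
        rw [hDdef, le_div_iff₀ hη]
        nlinarith
      have hD' : ‖W n - 1‖ ≤ D * x := hD.trans_eq (by rw [hDdef]; ring)
      calc _ ≤ D * x * (D * x + 2) := by gcongr
        _ ≤ D * x * (D * 1 + 2 * D) := by gcongr; linarith
        _ = 3 * D ^ 2 * x := by ring
        _ = _ := by rw [hDdef, hE]; ring
    have e2 : (n : ℝ) ^ (-(2 * (σ - η))) = (n : ℝ) ^ (-(2 * σ)) * N ^ 2 := by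
      rw [hN, ← Real.rpow_natCast, ← Real.rpow_mul hn0.le, ← Real.rpow_add hn0]
      congr 1
      push_cast
      ring
    rw [norm_mul, e2]
    calc _ ≤ (‖divisorFun κ n‖ ^ 2 * (n : ℝ) ^ (-(2 * σ))) * (3 * Real.exp 20 * x / η ^ 2 * N ^ 2) :=
          mul_le_mul (norm_divisorFun_mul_div_le h₁ h₂ σ n) hWW (norm_nonneg _) (by positivity)
      _ = _ := by ring
  have hds : Summable (fun n => c n * (W n * starRingEnd ℂ (W n) - 1)) :=
    Summable.of_norm_bounded (hS.mul_left _) hb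
  have hcw : Summable (fun n => c n * (W n * starRingEnd ℂ (W n))) :=
    (hds.add hcs).congr fun n => by ring
  rw [← hcw.tsum_sub hcs]
  have e : (fun n => c n * (W n * starRingEnd ℂ (W n)) - c n)
      = fun n => c n * (W n * starRingEnd ℂ (W n) - 1) := by funext n; ring
  rw [e]
  exact tsum_of_norm_bounded (hS.hasSum.mul_left _) hb

/-- The coefficients of the smoothed Dirichlet polynomial for `ζ(s)^z`. -/
noncomputable def smoothCoeff (V M σ : ℝ) (z : ℂ) (n : ℕ) : ℂ :=
  divisorFun z n * smoothWeight V (M - Real.log n) * (n : ℂ) ^ (-(σ : ℂ))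

theorem smoothCoeff_zero (V M σ : ℝ) (z : ℂ) : smoothCoeff V M σ z 0 = 0 := by
  simp [smoothCoeff, divisorFun_zero]

/-- The cubic decay of the weight leaves `n^(-2)` after multiplication by `n`. -/
theorem norm_smoothCoeff_mul_le {V M σ κ : ℝ} {z : ℂ} (hz : ‖z‖ ≤ κ) (hV : 0 ≤ V) (hσ : 0 ≤ σ)
    (n : ℕ) : ‖smoothCoeff V M σ z n‖ * n
      ≤ Real.exp 9 * Real.exp (3 * M) * (‖divisorFun κ n‖ * ((n : ℝ) ^ 2)⁻¹) := by
  rcases Nat.eq_zero_or_pos n with rfl | hn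
  · simp [divisorFun_zero]
  have hn1 : (1 : ℝ) ≤ n := by exact_mod_cast hn
  have hn0 : (0 : ℝ) < n := by linarith
  rw [smoothCoeff, norm_mul, norm_mul, norm_natCast_cpow_of_pos hn, neg_re, ofReal_re]
  have h1 := norm_smoothWeight_le hV (M - Real.log n)
  have e1 : Real.exp (3 * (M - Real.log n)) = Real.exp (3 * M) * ((n : ℝ) ^ 3)⁻¹ := by
    rw [mul_sub, Real.exp_sub, show 3 * Real.log n = (3 : ℕ) * Real.log n by norm_num,
      Real.exp_nat_mul, Real.exp_log hn0, div_eq_mul_inv]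
  rw [e1] at h1
  have h2 : (n : ℝ) ^ (-σ) ≤ 1 := Real.rpow_le_one_of_one_le_of_nonpos hn1 (by linarith)
  calc _ ≤ ‖divisorFun κ n‖ * (Real.exp 9 * (Real.exp (3 * M) * ((n : ℝ) ^ 3)⁻¹)) * 1 * n := by
        gcongr
        exact norm_divisorFun_le hz n
    _ = _ := by field_simp

theorem summable_norm_smoothCoeff_mul {V M σ κ : ℝ} {z : ℂ} (hz : ‖z‖ ≤ κ) (hV : 0 ≤ V)
    (hσ : 0 ≤ σ) : Summable (fun n => ‖smoothCoeff V M σ z n‖ * n) ∧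
      ∑' n, ‖smoothCoeff V M σ z n‖ * n ≤ Real.exp 9 * Real.exp (3 * M) * Real.exp (2 * κ) := by
  obtain ⟨h1, h2⟩ := summable_norm_divisorFun_and_tsum_le ((norm_nonneg z).trans hz)
  have hs : Summable (fun n => ‖smoothCoeff V M σ z n‖ * n) :=
    Summable.of_nonneg_of_le (fun _ => by positivity) (norm_smoothCoeff_mul_le hz hV hσ)
      (h1.mul_left _)
  refine ⟨hs, (hs.tsum_le_tsum (norm_smoothCoeff_mul_le hz hV hσ) (h1.mul_left _)).trans ?_⟩
  rw [tsum_mul_left]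
  gcongr

theorem continuous_tsum_mul_cpow {a : ℕ → ℂ} (ha0 : a 0 = 0) (ha : Summable fun n => ‖a n‖ * n) :
    Continuous (fun t : ℝ => ∑' n : ℕ, a n * (n : ℂ) ^ ((t : ℂ) * I)) := by
  refine continuous_tsum (u := fun n => ‖a n‖ * n) (fun n => ?_) ha fun n t => ?_
  · rcases Nat.eq_zero_or_pos n with rfl | hn
    · simp only [ha0, zero_mul]; exact continuous_const
    · exact continuous_const.mul (Continuous.const_cpow (by fun_prop)
        (Or.inl (by exact_mod_cast hn.ne')))
  · rcases Nat.eq_zero_or_pos n with rfl | hn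
    · simp [ha0]
    · rw [norm_mul, norm_natCast_cpow_of_pos hn]
      simpa using le_mul_of_one_le_right (norm_nonneg (a n)) (by exact_mod_cast hn : (1 : ℝ) ≤ n)

theorem RiemannHypothesis.continuousOn_zetaPow (hRH : RiemannHypothesis) {σ : ℝ} (hσ : 1 / 2 < σ)
    (z : ℂ) : ContinuousOn (fun t : ℝ => zetaPow (σ + t * I) z) (Ioi 0) := by
  intro t ht
  have h1 : ContinuousAt logZeta ((σ : ℂ) + t * I) :=
    (hRH.hasDerivAt_logZeta (by simpa using hσ) (by simpa using ht)).continuousAt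
  have h2 : ContinuousAt (fun u : ℝ => (σ : ℂ) + u * I) t := by fun_prop
  have h3 : ContinuousAt (fun u : ℝ => logZeta ((σ : ℂ) + u * I)) t :=
    ContinuousAt.comp (g := logZeta) (f := fun u : ℝ => (σ : ℂ) + u * I) h1 h2
  exact (continuousAt_const.mul h3).cexp.continuousWithinAt

theorem RiemannHypothesis.continuousOn_zetaPow_mul_zetaConjPow (hRH : RiemannHypothesis) {σ : ℝ}
    (hσ : 1 / 2 < σ) (z₁ z₂ : ℂ) :
    ContinuousOn (fun t : ℝ => zetaPow (σ + t * I) z₁ * zetaConjPow (σ + t * I) z₂) (Ioi 0) := by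
  simp only [zetaConjPow_eq_conj]
  exact (hRH.continuousOn_zetaPow hσ z₁).mul
    (continuous_conj.comp_continuousOn (hRH.continuousOn_zetaPow hσ _))

theorem smoothCoeff_mul_conj (V M σ : ℝ) (z₁ z₂ : ℂ) (n : ℕ) :
    smoothCoeff V M σ z₁ n * starRingEnd ℂ (smoothCoeff V M σ (starRingEnd ℂ z₂) n)
      = divisorFun z₁ n * divisorFun z₂ n / (((n : ℝ) ^ (2 * σ) : ℝ) : ℂ)
        * (smoothWeight V (M - Real.log n) * starRingEnd ℂ (smoothWeight V (M - Real.log n))) := by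
  rcases Nat.eq_zero_or_pos n with rfl | hn
  · simp [smoothCoeff, divisorFun_zero]
  have hn0 : (n : ℂ) ≠ 0 := by exact_mod_cast hn.ne'
  have e : (n : ℂ) ^ (-(σ : ℂ)) * (n : ℂ) ^ (-(σ : ℂ)) = (((n : ℝ) ^ (2 * σ) : ℝ) : ℂ)⁻¹ := by
    rw [← cpow_add _ _ hn0, ofReal_cpow (by positivity), ← cpow_neg]
    congr 1
    push_cast
    ring
  rw [smoothCoeff, smoothCoeff, map_mul, map_mul, divisorFun_conj, conj_conj, conj_natCast_cpow hn,
    map_neg, conj_ofReal, div_eq_mul_inv, ← e]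
  ring

/-- The mean value theorem, with all error terms explicit. -/
theorem RiemannHypothesis.norm_mean_zetaPow_sub_tsum_le (hRH : RiemannHypothesis)
    {T σ η M κ Q : ℝ} {z₁ z₂ : ℂ} (hη : 0 < η) (hη1 : η ≤ 1) (hT : 2 ≤ T) (hM0 : 0 ≤ M)
    (hM : 4 * M ≤ (T / 2) ^ 2) (hσ : 1 / 2 < σ - η) (h₁ : ‖z₁‖ ≤ κ) (h₂ : ‖z₂‖ ≤ κ)
    (hQ : ∀ z : ℂ, ‖z‖ ≤ κ → ∀ x : ℝ, σ - η ≤ x → ∀ v ∈ Icc (T / 2) (5 * T / 2),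
      ‖zetaPow (x + v * I) z‖ ≤ Q)
    (hS : Summable (fun n : ℕ => ‖divisorFun κ n‖ ^ 2 * (n : ℝ) ^ (-(2 * (σ - η))))) :
    ‖1 / (T : ℂ) * (∫ t in T..(2 * T),
        zetaPow (σ + t * I) z₁ * zetaConjPow (σ + t * I) z₂)
      - ∑' n : ℕ, divisorFun z₁ n * divisorFun z₂ n / (((n : ℝ) ^ (2 * σ) : ℝ) : ℂ)‖
    ≤ 2 * Q * (Real.exp 10 * Q * Real.exp (-η * M) / η)
      + (Real.exp 10 * Q * Real.exp (-η * M) / η) ^ 2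
      + 2 / T * (Real.exp 9 * Real.exp (3 * M) * Real.exp (2 * κ)) ^ 2
      + 3 * Real.exp 20 * Real.exp (-η * M) / η ^ 2 *
        ∑' n : ℕ, ‖divisorFun κ n‖ ^ 2 * (n : ℝ) ^ (-(2 * (σ - η))) := by
  have hT0 : 0 < T := by linarith
  set δ := Real.exp 10 * Q * Real.exp (-η * M) / η with hδ
  set V := T / 2 with hVdef
  have hV : 1 ≤ V := by rw [hVdef]; linarith
  have h₂' : ‖starRingEnd ℂ z₂‖ ≤ κ := by rwa [norm_conj]
  set a := smoothCoeff V M σ z₁ with ha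
  set b : ℕ → ℂ := fun n => starRingEnd ℂ (smoothCoeff V M σ (starRingEnd ℂ z₂) n) with hb
  have ha0 : a 0 = 0 := smoothCoeff_zero _ _ _ _
  have hb0 : b 0 = 0 := by simp [hb, smoothCoeff_zero]
  obtain ⟨has, has'⟩ := summable_norm_smoothCoeff_mul (V := V) (M := M) (σ := σ) h₁ (by linarith)
    (by linarith)
  obtain ⟨hbs, hbs'⟩ := summable_norm_smoothCoeff_mul (V := V) (M := M) (σ := σ) h₂' (by linarith)
    (by linarith)
  have hbn : ∀ n, ‖b n‖ * n = ‖smoothCoeff V M σ (starRingEnd ℂ z₂) n‖ * n := fun n => by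
    simp only [hb, norm_conj]
  set A : ℝ → ℂ := fun t => ∑' n : ℕ, a n * (n : ℂ) ^ (-((t : ℂ) * I)) with hA
  set B : ℝ → ℂ := fun t => ∑' n : ℕ, b n * (n : ℂ) ^ ((t : ℂ) * I) with hB
  have hbs2 : Summable fun n => ‖b n‖ * n := by simpa only [hbn] using hbs
  have hBc : Continuous B := continuous_tsum_mul_cpow hb0 hbs2
  have hAc : Continuous A := by
    refine ((continuous_tsum_mul_cpow ha0 has).comp continuous_neg).congr fun t => ?_
    simp only [hA, Function.comp, ofReal_neg, neg_mul]
  have hsplit : ∀ (z : ℂ) (t : ℝ), ∑' n : ℕ, divisorFun z n * smoothWeight V (M - Real.log n)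
      * (n : ℂ) ^ (-((σ : ℂ) + t * I))
      = ∑' n : ℕ, smoothCoeff V M σ z n * (n : ℂ) ^ (-((t : ℂ) * I)) := by
    intro z t
    refine tsum_congr fun n => ?_
    rcases Nat.eq_zero_or_pos n with rfl | hn
    · simp [smoothCoeff, divisorFun_zero]
    · have hn0 : (n : ℂ) ≠ 0 := by exact_mod_cast hn.ne'
      rw [smoothCoeff, neg_add, cpow_add _ _ hn0]
      ring
  have happ : ∀ z : ℂ, ‖z‖ ≤ κ → ∀ t ∈ Icc T (2 * T), ‖zetaPow (σ + t * I) z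
      - ∑' n : ℕ, smoothCoeff V M σ z n * (n : ℂ) ^ (-((t : ℂ) * I))‖ ≤ δ := by
    intro z hz t ht
    rw [← hsplit]
    refine hRH.norm_zetaPow_sub_tsum_le hη hη1 hV hM hσ (by rw [hVdef]; linarith [ht.1])
      fun x hx v hv => hQ z hz x hx v ⟨?_, ?_⟩
    · linarith [hv.1, ht.1]
    · linarith [hv.2, ht.2]
  have hpb : ∀ z : ℂ, ‖z‖ ≤ κ → ∀ t ∈ Icc T (2 * T), ‖zetaPow (σ + t * I) z‖ ≤ Q :=
    fun z hz t ht => hQ z hz σ (by linarith) t ⟨by linarith [ht.1], by linarith [ht.2]⟩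
  have hBconj : ∀ t : ℝ, B t = starRingEnd ℂ
      (∑' n : ℕ, smoothCoeff V M σ (starRingEnd ℂ z₂) n * (n : ℂ) ^ (-((t : ℂ) * I))) := by
    intro t
    rw [conj_tsum]
    refine tsum_congr fun n => ?_
    rcases Nat.eq_zero_or_pos n with rfl | hn
    · simp [hb, smoothCoeff_zero]
    · rw [map_mul, conj_natCast_cpow hn]
      simp [hb]
  have hQ0 : 0 ≤ Q := (norm_nonneg _).trans (hpb z₁ h₁ T ⟨le_rfl, by linarith⟩)
  have hdiff : ∀ t ∈ Icc T (2 * T), ‖zetaPow (σ + t * I) z₁ * zetaConjPow (σ + t * I) z₂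
      - A t * B t‖ ≤ 2 * Q * δ + δ ^ 2 := by
    intro t ht
    have p1 := happ z₁ h₁ t ht
    have p2 : ‖zetaConjPow (σ + t * I) z₂ - B t‖ ≤ δ := by
      rw [zetaConjPow_eq_conj, hBconj, ← map_sub, norm_conj]
      exact happ _ h₂' t ht
    have q1 := hpb z₁ h₁ t ht
    have q2 : ‖zetaConjPow (σ + t * I) z₂‖ ≤ Q := by
      rw [zetaConjPow_eq_conj, norm_conj]
      exact hpb _ h₂' t ht
    have q3 : ‖B t‖ ≤ Q + δ := by
      calc ‖B t‖ = ‖zetaConjPow (σ + t * I) z₂ - (zetaConjPow (σ + t * I) z₂ - B t)‖ := by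
            rw [sub_sub_cancel]
        _ ≤ _ := (norm_sub_le _ _).trans (add_le_add q2 p2)
    -- Replacing one factor at a time costs `Q δ + δ (Q + δ)`.
    have e : zetaPow (σ + t * I) z₁ * zetaConjPow (σ + t * I) z₂ - A t * B t
        = zetaPow (σ + t * I) z₁ * (zetaConjPow (σ + t * I) z₂ - B t)
          + (zetaPow (σ + t * I) z₁ - A t) * B t := by ring
    have hδ0 : 0 ≤ δ := (norm_nonneg _).trans p2
    rw [e]
    refine (norm_add_le _ _).trans ?_
    rw [norm_mul, norm_mul]
    calc _ ≤ Q * δ + δ * (Q + δ) := by gcongr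
      _ = _ := by ring
  have hint1 : IntervalIntegrable (fun t : ℝ => zetaPow (σ + t * I) z₁ * zetaConjPow (σ + t * I) z₂)
      volume T (2 * T) := by
    refine ContinuousOn.intervalIntegrable
      ((hRH.continuousOn_zetaPow_mul_zetaConjPow (by linarith) z₁ z₂).mono fun t ht => ?_)
    rw [uIcc_of_le (by linarith)] at ht
    exact hT0.trans_le ht.1
  have hint2 : IntervalIntegrable (fun t => A t * B t) volume T (2 * T) :=
    (hAc.mul hBc).intervalIntegrable _ _
  have hinv : ‖1 / (T : ℂ)‖ = 1 / T := by
    rw [norm_div, norm_real, Real.norm_of_nonneg hT0.le]; simp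
  have r1 : ‖1 / (T : ℂ) * (∫ t in T..(2 * T), zetaPow (σ + t * I) z₁ * zetaConjPow (σ + t * I) z₂)
      - 1 / (T : ℂ) * ∫ t in T..(2 * T), A t * B t‖ ≤ 2 * Q * δ + δ ^ 2 := by
    rw [← mul_sub, ← intervalIntegral.integral_sub hint1 hint2, norm_mul, hinv]
    have := intervalIntegral.norm_integral_le_of_norm_le_const (a := T) (b := 2 * T)
      (C := 2 * Q * δ + δ ^ 2) (f := fun t : ℝ => zetaPow (σ + t * I) z₁ * zetaConjPow (σ + t * I) z₂
        - A t * B t) (fun t ht => by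
          rw [uIoc_of_le (by linarith)] at ht
          exact hdiff t ⟨ht.1.le, ht.2⟩)
    rw [show 2 * T - T = T by ring, abs_of_pos hT0] at this
    calc _ ≤ 1 / T * ((2 * Q * δ + δ ^ 2) * T) := by gcongr
      _ = _ := by field_simp
  have r2 := norm_mean_mul_sub_tsum_le ha0 hb0 hT0 has hbs2
  have r2' : 2 / T * ((∑' n, ‖a n‖ * n) * ∑' n, ‖b n‖ * n)
      ≤ 2 / T * (Real.exp 9 * Real.exp (3 * M) * Real.exp (2 * κ)) ^ 2 := by
    simp only [hbn]
    rw [sq]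
    gcongr
  have r3 := norm_tsum_smoothed_sub_tsum_le h₁ h₂ hη hη1 hV hM0 hM hS
  have e3 : ∑' n, a n * b n = ∑' n : ℕ, (divisorFun z₁ n * divisorFun z₂ n /
      (((n : ℝ) ^ (2 * σ) : ℝ) : ℂ)) * (smoothWeight V (M - Real.log n) *
        starRingEnd ℂ (smoothWeight V (M - Real.log n))) :=
    tsum_congr fun n => smoothCoeff_mul_conj V M σ z₁ z₂ n
  rw [← e3] at r3
  refine (norm_sub_le_norm_sub_add_norm_sub _
    (1 / (T : ℂ) * ∫ t in T..(2 * T), A t * B t) _).trans ?_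
  have r4 := (norm_sub_le_norm_sub_add_norm_sub (1 / (T : ℂ) * ∫ t in T..(2 * T), A t * B t)
    (∑' n, a n * b n)
    (∑' n : ℕ, divisorFun z₁ n * divisorFun z₂ n / (((n : ℝ) ^ (2 * σ) : ℝ) : ℂ)))
  have r5 := r2.trans r2'
  calc _ ≤ _ := add_le_add r1 (r4.trans (add_le_add r5 r3))
    _ = _ := by ring

/-! ### Choice of parameters and conclusion. -/

theorem exists_mul_add_le_exp {ε : ℝ} (hε : 0 < ε) (A : ℝ) :
    ∃ x₁ : ℝ, ∀ x : ℝ, x₁ ≤ x → A ≤ x ∧ 10 * x * (8 / ε + x) ≤ Real.exp (ε * x) := by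
  refine ⟨max A (max 1 (60 * (8 / ε + 1) / ε ^ 3)), fun x hx => ⟨(le_max_left _ _).trans hx, ?_⟩⟩
  have h1 : 1 ≤ x := (le_max_left _ _).trans ((le_max_right _ _).trans hx)
  have h2 : 60 * (8 / ε + 1) / ε ^ 3 ≤ x := (le_max_right _ _).trans ((le_max_right _ _).trans hx)
  have h3 := Real.pow_div_factorial_le_exp (x := ε * x) (by positivity) 3
  rw [div_le_iff₀ (by positivity)] at h2
  have h8 : 0 < 8 / ε := by positivity
  calc 10 * x * (8 / ε + x) ≤ 10 * x * (8 / ε * x + x) := by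
        gcongr
        exact le_mul_of_one_le_right h8.le h1
    _ = x ^ 2 * (60 * (8 / ε + 1)) / 6 := by ring
    _ ≤ x ^ 2 * (x * ε ^ 3) / 6 := by gcongr
    _ = (ε * x) ^ 3 / (Nat.factorial 3 : ℕ) := by
        rw [show Nat.factorial 3 = 6 from rfl]; push_cast; ring
    _ ≤ _ := h3

/-- The exponents of `Y` in the bounds for `z` and `log ζ` add up to `1 + 2η`, and `Y^(2η) = e^K`.
The factor `e^(-2K)` in the bound for `z` absorbs this and leaves `e^(-K)` to spare. -/
theorem norm_zetaPow_le_exp {C t₀ ε : ℝ} (hC : 0 < C)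
    (hlog : ∀ t : ℝ, t₀ ≤ t → ∀ σ₀ : ℝ, 1 / 2 + 3 / Real.log (Real.log t) ≤ σ₀ → σ₀ ≤ 1 - ε →
      ∀ σ : ℝ, σ₀ ≤ σ →
      ‖logZeta (σ + t * I)‖ ≤ C * Real.log t ^ (2 - 2 * σ₀) / Real.log (Real.log t))
    {K T σ η l : ℝ} (hl : l = Real.log (Real.log T)) (hl2 : 2 ≤ l) (hT : 4 ≤ T) (hTt : 2 * t₀ ≤ T)
    (hε : 0 < ε) (hK : 12 ≤ K) (hCK : 4 * C * Real.exp (-K) ≤ 1 / 10) (hη : η = K / (2 * l))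
    (hσ : 1 / 2 + K / l ≤ σ) (hσ1 : σ ≤ 1 - ε) {z : ℂ}
    (hz : ‖z‖ ≤ Real.exp (-2 * K) * Real.log T ^ (2 * σ - 1)) {x v : ℝ} (hx : σ - η ≤ x)
    (hv : v ∈ Icc (T / 2) (5 * T / 2)) :
    ‖zetaPow (x + v * I) z‖ ≤ Real.exp (Real.log T / (10 * l)) := by
  have hT0 : 0 < T := by linarith
  have hl0 : 0 < l := by linarith
  set Y := Real.log T with hY
  have h2l1 : Real.log 2 ≤ 1 := by linarith [Real.log_two_lt_d9]
  have hY4 : 2 * Real.log 2 ≤ Y := by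
    rw [hY, show 2 * Real.log 2 = Real.log 4 by
      rw [show (4 : ℝ) = 2 ^ 2 by norm_num, Real.log_pow]; norm_num]
    exact Real.log_le_log (by norm_num) hT
  have hY0 : 0 < Y := by linarith [Real.log_pos one_lt_two]
  have hYe : Y = Real.exp l := by rw [hl, Real.exp_log hY0]
  have hv0 : 0 < v := by linarith [hv.1]
  have hlv1 : Y / 2 ≤ Real.log v := by
    have := Real.log_le_log (by linarith) hv.1
    rw [Real.log_div hT0.ne' two_ne_zero] at this
    linarith
  have hlv2 : Real.log v ≤ 2 * Y := by
    have h1 : v ≤ T ^ 2 := by nlinarith [hv.2]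
    have := Real.log_le_log hv0 h1
    rw [Real.log_pow] at this
    exact_mod_cast this
  have hlv0 : 0 < Real.log v := by linarith
  have hll : l / 2 ≤ Real.log (Real.log v) := by
    have := Real.log_le_log (by linarith) hlv1
    rw [Real.log_div hY0.ne' two_ne_zero, ← hl] at this
    linarith
  have hηl : η + η = K / l := by rw [hη]; field_simp; norm_num
  have hη0 : 0 < η := by rw [hη]; positivity
  -- As `log log v ≥ l / 2`, the bound for `log ζ` needs distance `6 / l` from the critical line; `K
  -- ≥ 12` makes `η` at least that.
  have hrange : 1 / 2 + 3 / Real.log (Real.log v) ≤ σ - η := by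
    have h1 : 3 / Real.log (Real.log v) ≤ 3 / (l / 2) := by gcongr
    have h2 : 3 / (l / 2) ≤ η := by
      rw [hη, div_div_eq_mul_div, div_le_div_iff₀ hl0 (by positivity)]
      nlinarith
    linarith
  have hb := hlog v (by linarith [hv.1]) (σ - η) hrange (by linarith) x hx
  have hexp0 : 0 ≤ 2 - 2 * (σ - η) := by linarith
  have hexp1 : 2 - 2 * (σ - η) ≤ 1 := by
    have : 0 ≤ 3 / Real.log (Real.log v) := by
      have : 0 < Real.log (Real.log v) := by linarith
      positivity
    linarith
  have hb2 : ‖logZeta (x + v * I)‖ ≤ 4 * C * Y ^ (2 - 2 * (σ - η)) / l := by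
    refine hb.trans ?_
    have h1 : Real.log v ^ (2 - 2 * (σ - η)) ≤ 2 * Y ^ (2 - 2 * (σ - η)) := by
      calc _ ≤ (2 * Y) ^ (2 - 2 * (σ - η)) := Real.rpow_le_rpow hlv0.le hlv2 hexp0
        _ = 2 ^ (2 - 2 * (σ - η)) * Y ^ (2 - 2 * (σ - η)) := Real.mul_rpow two_pos.le hY0.le
        _ ≤ 2 ^ (1 : ℝ) * Y ^ (2 - 2 * (σ - η)) := by
            gcongr
            norm_num
        _ = _ := by rw [Real.rpow_one]
    calc _ ≤ C * (2 * Y ^ (2 - 2 * (σ - η))) / (l / 2) := by gcongr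
      _ = _ := by field_simp; ring
  rw [zetaPow, norm_exp]
  refine Real.exp_le_exp.2 ((re_le_norm _).trans ?_)
  rw [norm_mul]
  have hpow : Y ^ (2 * σ - 1) * Y ^ (2 - 2 * (σ - η)) = Real.exp K * Y := by
    rw [← Real.rpow_add hY0, show 2 * σ - 1 + (2 - 2 * (σ - η)) = K / l + 1 by rw [← hηl]; ring,
      Real.rpow_add hY0, Real.rpow_one, Real.rpow_def_of_pos hY0, ← hl, mul_div_cancel₀ _ hl0.ne']
  have he : Real.exp (-2 * K) * Real.exp K = Real.exp (-K) := by
    rw [← Real.exp_add]; congr 1; ring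
  calc _ ≤ Real.exp (-2 * K) * Y ^ (2 * σ - 1) * (4 * C * Y ^ (2 - 2 * (σ - η)) / l) := by gcongr
    _ = 4 * C * Real.exp (-2 * K) * (Y ^ (2 * σ - 1) * Y ^ (2 - 2 * (σ - η))) / l := by ring
    _ = 4 * C * (Real.exp (-2 * K) * Real.exp K) * (Y / l) := by rw [hpow]; ring
    _ ≤ 1 / 10 * (Y / l) := by rw [he]; gcongr
    _ = _ := by ring

set_option maxHeartbeats 1000000 in
/-- The final estimate of the error terms. -/
theorem error_terms_le {ε K l Y T σ η κ S : ℝ} (hε : 0 < ε) (hε4 : ε ≤ 1 / 4) (hK : 24 ≤ K)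
    (hKl : K ≤ l) (hl : 10 * l * (8 / ε + l) ≤ Real.exp (ε * l)) (hY : Y = Real.exp l)
    (hT : T = Real.exp Y) (hη : η = K / (2 * l)) (hσ : 1 / 2 + K / l ≤ σ) (hσ1 : σ ≤ 1 - ε)
    (hκ : κ ≤ Y ^ (2 * σ - 1)) (hS0 : 0 ≤ S)
    (hS : S ≤ Real.exp (8 * Y ^ (σ - η) / (1 - (σ - η))
      + Y ^ (2 * (σ - η) - 1) / (2 * (σ - η) - 1))) :
    2 * Real.exp (Y / (10 * l)) *
        (Real.exp 10 * Real.exp (Y / (10 * l)) * Real.exp (-η * (Y / 12)) / η)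
      + (Real.exp 10 * Real.exp (Y / (10 * l)) * Real.exp (-η * (Y / 12)) / η) ^ 2
      + 2 / T * (Real.exp 9 * Real.exp (3 * (Y / 12)) * Real.exp (2 * κ)) ^ 2
      + 3 * Real.exp 20 * Real.exp (-η * (Y / 12)) / η ^ 2 * S
    ≤ 8 * Real.exp 20 * Real.exp (-(Y / (50 * l))) := by
  have hl1 : 24 ≤ l := by linarith
  have hl0 : 0 < l := by linarith
  have hY0 : 0 < Y := by rw [hY]; positivity
  have hK0 : 0 < K := by linarith
  have hη0 : 0 < η := by rw [hη]; positivity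
  have h8 : 32 ≤ 8 / ε := by rw [le_div_iff₀ hε]; linarith
  have hpow : ∀ a : ℝ, Y ^ a = Real.exp (l * a) := fun a => by
    rw [Real.rpow_def_of_pos hY0, hY, Real.log_exp]
  set m := Y / l with hm
  have hm0 : 0 < m := by positivity
  have hYm : Y = m * l := by rw [hm]; field_simp
  have hmY : m ≤ Y := by rw [hYm]; exact le_mul_of_one_le_right hm0.le (by linarith)
  have hlm : l ≤ m / 10 := by
    have h1 : Real.exp (ε * l) ≤ Y := by
      rw [hY]
      exact Real.exp_le_exp.2 (mul_le_of_le_one_left hl0.le (by linarith))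
    have h2 : 10 * l * l ≤ m * l := by
      rw [← hYm]
      exact (mul_le_mul_of_nonneg_left (by linarith) (by linarith)).trans (hl.trans h1)
    linarith [le_of_mul_le_mul_right h2 hl0]
  have e1 : Y / (10 * l) = m / 10 := by rw [hYm]; field_simp
  have e2 : Y / (50 * l) = m / 50 := by rw [hYm]; field_simp
  -- The saving is `exp (-(K/24) m)`, which is why `K ≥ 24`. Every other factor of the contour and
  -- diagonal errors is at most a power of `exp (m / 10)`, up to constants.
  have hE : Real.exp (-η * (Y / 12)) ≤ Real.exp (-m) := by
    refine Real.exp_le_exp.2 ?_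
    have : -η * (Y / 12) = -(K / 24 * m) := by rw [hη, hYm]; field_simp; norm_num
    rw [this]
    nlinarith
  have hη1 : 1 / η ≤ Real.exp (m / 10) := by
    have h1 : 1 / η ≤ l := by
      rw [hη, one_div_div, div_le_iff₀ hK0]
      nlinarith
    linarith [Real.add_one_le_exp (m / 10)]
  rw [e1, e2]
  set E := Real.exp (-η * (Y / 12)) with hEdef
  have hcmp : ∀ a : ℝ, a ≤ -(m / 50) → Real.exp a ≤ Real.exp (-(m / 50)) :=
    fun a ha => Real.exp_le_exp.2 ha
  set R := Real.exp (-(m / 50)) with hR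
  have hδ : Real.exp 10 * Real.exp (m / 10) * E / η ≤ Real.exp 10 * Real.exp (-(8 / 10 * m)) := by
    calc _ = Real.exp 10 * (Real.exp (m / 10) * E * (1 / η)) := by ring
      _ ≤ Real.exp 10 * (Real.exp (m / 10) * Real.exp (-m) * Real.exp (m / 10)) := by gcongr
      _ = _ := by
        rw [← Real.exp_add, ← Real.exp_add]
        congr 2
        ring
  have hδ0 : 0 ≤ Real.exp 10 * Real.exp (m / 10) * E / η := by positivity
  set δ := Real.exp 10 * Real.exp (m / 10) * E / η with hδdef
  have h10 : Real.exp 10 ≤ Real.exp 20 := Real.exp_le_exp.2 (by norm_num)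
  have t1 : 2 * Real.exp (m / 10) * δ ≤ 2 * Real.exp 20 * R := by
    calc _ ≤ 2 * Real.exp (m / 10) * (Real.exp 10 * Real.exp (-(8 / 10 * m))) := by gcongr
      _ = 2 * Real.exp 10 * Real.exp (m / 10 + -(8 / 10 * m)) := by rw [Real.exp_add]; ring
      _ ≤ _ := by
        gcongr
        exact hcmp _ (by linarith)
  have t2 : δ ^ 2 ≤ Real.exp 20 * R := by
    calc δ ^ 2 ≤ (Real.exp 10 * Real.exp (-(8 / 10 * m))) ^ 2 := by gcongr
      _ = Real.exp 20 * Real.exp (-(16 / 10 * m)) := by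
        rw [mul_pow, ← Real.exp_nat_mul, ← Real.exp_nat_mul]
        congr 2 <;> push_cast <;> ring
      _ ≤ _ := by
        gcongr
        exact hcmp _ (by linarith)
  -- The off-diagonal error is `T^(-1) T^(1/2) e^(4κ)` up to a constant, so `κ` must be a small
  -- multiple of `log T`; the margin `σ ≤ 1 - ε` provides this.
  have hκ4 : 4 * κ ≤ Y / 4 := by
    have h1 : Y ^ (2 * σ - 1) ≤ Real.exp (l - 2 * (ε * l)) := by
      rw [hpow]
      refine Real.exp_le_exp.2 ?_
      have := mul_le_mul_of_nonneg_left (show 2 * σ - 1 ≤ 1 - 2 * ε by linarith) hl0.le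
      linarith
    have h2 : 16 ≤ Real.exp (ε * l) := by
      refine le_trans ?_ hl
      have := mul_le_mul (show 24 ≤ 10 * l by linarith) (show 32 ≤ 8 / ε + l by linarith)
        (by norm_num) (by linarith)
      linarith
    have h3 : Y = Real.exp (l - 2 * (ε * l)) * (Real.exp (ε * l) * Real.exp (ε * l)) := by
      rw [hY, ← Real.exp_add, ← Real.exp_add]; congr 1; ring
    have h4 : 16 ≤ Real.exp (ε * l) * Real.exp (ε * l) :=
      h2.trans (le_mul_of_one_le_left (Real.exp_pos _).le (by linarith))
    have h5 : Real.exp (l - 2 * (ε * l)) * 16 ≤ Y := by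
      rw [h3]
      exact mul_le_mul_of_nonneg_left h4 (Real.exp_pos _).le
    linarith
  have t3 : 2 / T * (Real.exp 9 * Real.exp (3 * (Y / 12)) * Real.exp (2 * κ)) ^ 2
      ≤ 2 * Real.exp 20 * R := by
    calc _ = 2 * Real.exp (18 + (-Y + Y / 2 + 4 * κ)) := by
          rw [hT, div_eq_mul_inv, ← Real.exp_neg, ← Real.exp_add, ← Real.exp_add,
            ← Real.exp_nat_mul, mul_assoc, ← Real.exp_add]
          congr 2
          push_cast
          ring
      _ ≤ 2 * Real.exp (20 + -(m / 50)) := by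
          gcongr 2 * Real.exp ?_
          linarith
      _ = _ := by rw [Real.exp_add]; ring
  have hSm : S ≤ Real.exp (m / 10) := by
    refine hS.trans (Real.exp_le_exp.2 ?_)
    have hKl1 : 1 / l ≤ 2 * (σ - η) - 1 := by
      have : 2 * η = K / l := by rw [hη]; field_simp
      have h2 : 1 / l ≤ K / l := by gcongr; linarith
      linarith
    have a0 : 0 < 1 / l := by positivity
    have a1 : Y ^ (σ - η) ≤ Real.exp (l - ε * l) := by
      rw [hpow]
      refine Real.exp_le_exp.2 ?_
      have := mul_le_mul_of_nonneg_left (show σ - η ≤ 1 - ε by linarith) hl0.le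
      linarith
    have a2 : Y ^ (2 * (σ - η) - 1) ≤ Real.exp (l - ε * l) := by
      rw [hpow]
      refine Real.exp_le_exp.2 ?_
      have := mul_le_mul_of_nonneg_left (show 2 * (σ - η) - 1 ≤ 1 - ε by linarith) hl0.le
      linarith
    have a3 : ε ≤ 1 - (σ - η) := by linarith
    calc _ ≤ 8 * Real.exp (l - ε * l) / ε + Real.exp (l - ε * l) / (1 / l) := by gcongr
      _ = Real.exp (l - ε * l) * (8 / ε + l) := by field_simp
      _ ≤ Real.exp (l - ε * l) * (Real.exp (ε * l) / (10 * l)) := by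
          gcongr
          rw [le_div_iff₀ (by positivity)]
          linarith
      _ = Real.exp (l - ε * l + ε * l) / (10 * l) := by rw [Real.exp_add]; ring
      _ = m / 10 := by rw [sub_add_cancel, ← hY, hYm]; field_simp
  have t4 : 3 * Real.exp 20 * E / η ^ 2 * S ≤ 3 * Real.exp 20 * R := by
    calc _ = 3 * Real.exp 20 * (E * (1 / η) ^ 2 * S) := by ring
      _ ≤ 3 * Real.exp 20 * (Real.exp (-m) * Real.exp (m / 10) ^ 2 * Real.exp (m / 10)) := by gcongr
      _ = 3 * Real.exp 20 * Real.exp (-(7 / 10 * m)) := by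
        rw [← Real.exp_nat_mul, ← Real.exp_add, ← Real.exp_add]
        congr 2
        push_cast
        ring
      _ ≤ _ := by
        gcongr
        exact hcmp _ (by linarith)
  linarith

end

theorem theorem1p2 (hRH : RiemannHypothesis) (ε : ℝ) (hε : 0 < ε) :
    ∃ K : ℝ, 0 < K ∧ ∃ b : ℝ, 0 < b ∧ ∃ C T₀ : ℝ,
      ∀ T : ℝ, T₀ ≤ T →
      ∀ σ : ℝ, 1 / 2 + K / Real.log (Real.log T) ≤ σ → σ ≤ 1 - ε →
      ∀ z₁ z₂ : ℂ, ‖z₁‖ ≤ b * Real.log T ^ (2 * σ - 1) → ‖z₂‖ ≤ b * Real.log T ^ (2 * σ - 1) →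
        IntervalIntegrable
          (fun t : ℝ => zetaPow ((σ : ℂ) + (t : ℂ) * I) z₁ * zetaConjPow ((σ : ℂ) + (t : ℂ) * I) z₂)
          MeasureTheory.volume T (2 * T) ∧
        Summable (fun n : ℕ =>
          divisorFun z₁ n * divisorFun z₂ n / (((n : ℝ) ^ (2 * σ) : ℝ) : ℂ)) ∧
        ‖(1 / (T : ℂ)) * (∫ t in T..(2 * T),
              zetaPow ((σ : ℂ) + (t : ℂ) * I) z₁ * zetaConjPow ((σ : ℂ) + (t : ℂ) * I) z₂)
            - ∑' n : ℕ, divisorFun z₁ n * divisorFun z₂ n / (((n : ℝ) ^ (2 * σ) : ℝ) : ℂ)‖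
          ≤ C * Real.exp (-(Real.log T / (50 * Real.log (Real.log T)))) := by
  obtain ⟨ε', hε', hε4, hεε⟩ : ∃ ε' : ℝ, 0 < ε' ∧ ε' ≤ 1 / 4 ∧ ε' ≤ ε :=
    ⟨min ε (1 / 4), lt_min hε (by norm_num), min_le_right _ _, min_le_left _ _⟩
  obtain ⟨C, hC, t₀, hlog⟩ := hRH.norm_logZeta_le hε' hε4
  -- `K ≥ 24` serves the contour shift, and `K ≥ 40 C` gives `4 C e^(-K) ≤ 1/10` through `K ≤ e^K`.
  set K := max 24 (40 * C) with hKdef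
  have hK24 : 24 ≤ K := le_max_left _ _
  have hK0 : 0 < K := by linarith
  have hCK : 4 * C * Real.exp (-K) ≤ 1 / 10 := by
    have h1 : 40 * C ≤ Real.exp K :=
      ((le_max_right 24 (40 * C)).trans (by linarith [Real.add_one_le_exp K]))
    rw [Real.exp_neg, ← div_eq_mul_inv, div_le_iff₀ (Real.exp_pos K)]
    linarith
  obtain ⟨x₁, hx₁⟩ := exists_mul_add_le_exp hε' K
  refine ⟨K, hK0, Real.exp (-2 * K), Real.exp_pos _, 8 * Real.exp 20,
    max (2 * t₀) (max 4 (Real.exp (Real.exp x₁))), fun T hT σ hσ hσε z₁ z₂ h₁ h₂ => ?_⟩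
  have hTt : 2 * t₀ ≤ T := (le_max_left _ _).trans hT
  have hT4 : 4 ≤ T := (le_max_left _ _).trans ((le_max_right _ _).trans hT)
  have hTx : Real.exp (Real.exp x₁) ≤ T := (le_max_right _ _).trans ((le_max_right _ _).trans hT)
  have hT0 : 0 < T := by linarith
  have hσ1 : σ ≤ 1 - ε' := by linarith
  set Y := Real.log T with hYdef
  have hYx : Real.exp x₁ ≤ Y := (Real.le_log_iff_exp_le hT0).2 hTx
  have hY0 : 0 < Y := (Real.exp_pos _).trans_le hYx
  set l := Real.log Y with hldef
  have hlx : x₁ ≤ l := (Real.le_log_iff_exp_le hY0).2 hYx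
  obtain ⟨hKl, hl⟩ := hx₁ l hlx
  have hl0 : 0 < l := by linarith
  have hYe : Y = Real.exp l := (Real.exp_log hY0).symm
  have hTe : T = Real.exp Y := (Real.exp_log hT0).symm
  obtain ⟨η, hη⟩ : ∃ η, η = K / (2 * l) := ⟨_, rfl⟩
  have hη0 : 0 < η := by rw [hη]; positivity
  have hηl : 2 * η = K / l := by rw [hη]; field_simp
  have hη1 : η ≤ 1 := by
    rw [hη, div_le_one (by positivity)]
    linarith
  set κ := Real.exp (-2 * K) * Y ^ (2 * σ - 1) with hκdef
  have hση : 1 / 2 < σ - η := by linarith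
  have hpow : ∀ a : ℝ, Y ^ a = Real.exp (l * a) := fun a => Real.rpow_def_of_pos hY0 a
  have hlK : l * (K / l) = K := mul_div_cancel₀ _ hl0.ne'
  -- Since `2σ - 1 ≥ 2K / l`, the power of `Y` is at least `e^(2K)`, exactly the inverse of `b =
  -- e^(-2K)`.
  have hκ1 : 1 ≤ κ := by
    rw [hκdef, hpow, ← Real.exp_add]
    refine Real.one_le_exp ?_
    have := mul_le_mul_of_nonneg_left (show 2 * (K / l) ≤ 2 * σ - 1 by linarith) hl0.le
    nlinarith
  -- Lowering `σ` by `η` costs `Y^(2η) = e^K`, half of the exponent built into `b`.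
  have hκY : κ ≤ Y ^ (2 * (σ - η) - 1) / 2 := by
    have e : κ = Real.exp (-K) * Y ^ (2 * (σ - η) - 1) := by
      rw [hκdef, hpow, hpow, ← Real.exp_add, ← Real.exp_add]
      congr 1
      have : l * (2 * η) = K := by rw [hηl, hlK]
      linear_combination this
    have h2 : Real.exp (-K) ≤ 1 / 2 := by
      rw [Real.exp_neg, inv_le_comm₀ (Real.exp_pos _) (by norm_num)]
      linarith [Real.add_one_le_exp K]
    rw [e]
    have := mul_le_mul_of_nonneg_right h2 (Real.rpow_nonneg hY0.le (2 * (σ - η) - 1))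
    linarith
  have hκ2 : κ ≤ Y ^ (2 * σ - 1) := by
    rw [hκdef]
    refine mul_le_of_le_one_left (Real.rpow_nonneg hY0.le _) (Real.exp_le_one_iff.2 (by linarith))
  obtain ⟨hS, hSle⟩ := summable_and_tsum_divisorFun_sq_le hκ1 hση (by linarith)
    (by rw [hYe]; exact Real.one_le_exp hl0.le) hκY
  refine ⟨?_, summable_divisorFun_mul_div h₁ h₂ hη0.le hS, ?_⟩
  · refine ContinuousOn.intervalIntegrable
      ((hRH.continuousOn_zetaPow_mul_zetaConjPow (by linarith) z₁ z₂).mono fun t ht => ?_)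
    rw [Set.uIcc_of_le (by linarith)] at ht
    exact hT0.trans_le ht.1
  · have hM : 4 * (Y / 12) ≤ (T / 2) ^ 2 := by
      have : Y ≤ T := by linarith [Real.log_le_sub_one_of_pos hT0]
      nlinarith
    refine (hRH.norm_mean_zetaPow_sub_tsum_le (M := Y / 12) (κ := κ)
      (Q := Real.exp (Y / (10 * l))) hη0 hη1 (by linarith) (by positivity) hM hση h₁ h₂
      (fun z hz x hx v hv => norm_zetaPow_le_exp hC hlog rfl (by linarith) hT4 hTt hε'
        (by linarith) hCK hη hσ hσ1 hz hx hv) hS).trans ?_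
    exact error_terms_le hε' hε4 hK24 hKl hl hYe hTe hη hσ hσ1 hκ2
      (tsum_nonneg fun n => by positivity) hSle
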